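/- Let $d\ge 3$, let $\Omega\subset\mathbb R^d$ be a bounded domain (open, connected, non-empty) with smooth boundary, let $0<\alpha<1$, and let $f(\lambda)=\lambda^\alpha$ or $f(\lambda)=(\lambda+1)^\alpha-1$. Let $\Delta$ be the Dirichlet Laplacian on the real space $L^2(\Omega)=L^2(\Omega,dx)$, i.e. the operator associated with the form $\mathcal E(u,v)=\int_\Omega\nabla u\cdot\nabla v\,dx$ on $H^1_0(\Omega)$ (the closure of $C_c^\infty(\Omega)$ in $H^1(\Omega)$): $u\in D(\Delta)$ and $\Delta u=h$ if and only if $u\in H_0^1(\Omega)$, $h\in L^2(\Omega)$ and $\mathcal E(u,v)=-\int_\Omega hv\,dx$ for all $v\in H^1_0(\Omega)$. Then $f$ is a Bernstein function on $(0,\infty)$ (that is, $f$ is $C^\infty$, $f\ge0$ and $(-1)^{n-1}f^{(n)}\ge0$ for all $n\ge1$); $dx$ is a finite measure on $\Omega$; there is exactly one vaguely continuous convolution semigroup $(\nu_t)_{t\ge0}$ of sub-probability measures on $[0,\infty)$ (with $\nu_0=\delta_0$) such that $\int e^{-\lambda s}\,\nu_t(ds)=e^{-tf(\lambda)}$ for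 all $t\ge 0$, $\lambda>0$; and there is exactly one strongly continuous contraction semigroup $(P_t)_{t\ge0}$ on $L^2(\Omega)$ whose generator is $\Delta$. Let $$P^f_tu=\int_{[0,\infty)}P_su\;\nu_t(ds),\qquad t\ge0,\ u\in L^2(\Omega),$$ be the subordinate semigroup (the semigroup of $-f(-\Delta)$). Then $$\|P^f_t\|_{1\to2}:=\sup\{\|P^f_tu\|_{L^2(\Omega)}:u\in L^2(\Omega),\ \|u\|_{L^1(\Omega)}\le1\}<\infty\qquad\text{for all }t>0 .$$ Moreover $(P^f_t)_{t\ge0}$ is a symmetric, sub-Markovian, strongly continuous contraction semigroup on $L^2(\Omega)$ whose Dirichlet form $(\mathcal E^f,D(\mathcal E^f))$, where $\mathcal E^f(u,u)=\lim_{t\downarrow0}t^{-1}\langle u-P^f_tu,u\rangle$ and $D(\mathcal E^f)$ is the set of $u\in L^2(\Omega)$ for which this limit exists and is finite, is transient: there is a bounded integrable function $g>0$ a.e. on $\Omega$ with $\int_\Omega|u|g\,dx\le\sqrt{\mathcal E^f(u,u)}$ for all $u\in D(\mathcal E^f)$. -/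

import Mathlib

open MeasureTheory Filter Topology Set
open scoped NNReal ENNReal ContDiff Gradient

noncomputable section

namespace DirichletSubordination

/-! ### Contraction semigroups and subordination in the sense of Bochner -/

/-- A strongly continuous contraction semigroup on a real Banach space. -/
@[ext]
structure ContractionSemigroup (H : Type*) [NormedAddCommGroup H] [NormedSpace ℝ H] where
  toFun : ℝ≥0 → H →L[ℝ] H
  map_zero' : toFun 0 = ContinuousLinearMap.id ℝ H
  map_add' : ∀ s t, toFun (s + t) = (toFun s).comp (toFun t)
  norm_le' : ∀ t, ‖toFun t‖ ≤ 1
  continuous' : ∀ u, Continuous fun t => toFun t u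

/-- A convolution semigroup of sub-probability measures on `[0, ∞)`, vaguely continuous at `0`. -/
@[ext]
structure ConvolutionSemigroup where
  measure : ℝ≥0 → Measure ℝ≥0
  mass_le' : ∀ t, measure t univ ≤ 1
  measure_zero' : measure 0 = Measure.dirac 0
  measure_add' : ∀ s t, measure (s + t) = (measure s).conv (measure t)
  vague' : ∀ φ : ℝ≥0 → ℝ, Continuous φ → HasCompactSupport φ →
    Tendsto (fun t => ∫ s, φ s ∂(measure t)) (𝓝 0) (𝓝 (φ 0))

/-- `ν` has Laplace exponent `f`: `∫ e^{-l s} ν_t(ds) = e^{-t f(l)}` for `l > 0`, `t ≥ 0`. -/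
def ConvolutionSemigroup.HasLaplaceExponent (ν : ConvolutionSemigroup) (f : ℝ → ℝ) : Prop :=
  ∀ (t : ℝ≥0) (l : ℝ), 0 < l →
    ∫ s : ℝ≥0, Real.exp (-(l * (s : ℝ))) ∂(ν.measure t) = Real.exp (-((t : ℝ) * f l))

/-- Bernstein functions on `(0, ∞)`. -/
def IsBernsteinFunction (f : ℝ → ℝ) : Prop :=
  ContDiffOn ℝ ∞ f (Ioi 0) ∧ (∀ l, 0 < l → 0 ≤ f l) ∧
    ∀ n : ℕ, ∀ l, 0 < l → 0 ≤ (-1 : ℝ) ^ n * iteratedDeriv (n + 1) f l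

section Subordination

variable {H : Type*} [NormedAddCommGroup H] [NormedSpace ℝ H]

instance (ν : ConvolutionSemigroup) (t : ℝ≥0) : IsFiniteMeasure (ν.measure t) :=
  ⟨(ν.mass_le' t).trans_lt ENNReal.one_lt_top⟩

theorem ConvolutionSemigroup.real_mass_le (ν : ConvolutionSemigroup) (t : ℝ≥0) :
    (ν.measure t).real univ ≤ 1 :=
  ENNReal.toReal_le_of_le_ofReal zero_le_one (by simpa using ν.mass_le' t)

theorem ContractionSemigroup.norm_apply_le (P : ContractionSemigroup H) (t : ℝ≥0) (u : H) :
    ‖P.toFun t u‖ ≤ ‖u‖ := by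
  simpa using (P.toFun t).le_of_opNorm_le (P.norm_le' t) u

theorem ContractionSemigroup.stronglyMeasurable (P : ContractionSemigroup H) (u : H) :
    StronglyMeasurable fun s => P.toFun s u :=
  (P.continuous' u).stronglyMeasurable

theorem ContractionSemigroup.integrable (P : ContractionSemigroup H) (m : Measure ℝ≥0)
    [IsFiniteMeasure m] (u : H) : Integrable (fun s => P.toFun s u) m :=
  Integrable.of_bound (P.stronglyMeasurable u).aestronglyMeasurable ‖u‖
    (Eventually.of_forall fun s => P.norm_apply_le s u)

/-- The operator `u ↦ ∫ P_s u ν_t(ds)` (Bochner integral). -/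
def subordinateOp (P : ContractionSemigroup H) (ν : ConvolutionSemigroup) (t : ℝ≥0) :
    H →L[ℝ] H :=
  LinearMap.mkContinuous
    { toFun := fun u => ∫ s, P.toFun s u ∂(ν.measure t)
      map_add' := fun u v => by
        simp only [map_add]
        exact integral_add (P.integrable _ u) (P.integrable _ v)
      map_smul' := fun c u => by
        simp only [map_smul, RingHom.id_apply]
        exact integral_smul c _ } 1 (fun u => by
    have h := norm_integral_le_of_norm_le_const (μ := ν.measure t)
      (Eventually.of_forall fun s => P.norm_apply_le s u)
    have h1 := ν.real_mass_le t
    calc _ ≤ ‖u‖ * (ν.measure t).real univ := h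
      _ ≤ 1 * ‖u‖ := by nlinarith [norm_nonneg u])

theorem subordinateOp_apply (P : ContractionSemigroup H) (ν : ConvolutionSemigroup) (t : ℝ≥0)
    (u : H) : subordinateOp P ν t u = ∫ s, P.toFun s u ∂(ν.measure t) := rfl

theorem norm_subordinateOp_le (P : ContractionSemigroup H) (ν : ConvolutionSemigroup) (t : ℝ≥0) :
    ‖subordinateOp P ν t‖ ≤ 1 :=
  LinearMap.mkContinuous_norm_le _ zero_le_one _

theorem subordinateOp_zero [CompleteSpace H] (P : ContractionSemigroup H) (ν : ConvolutionSemigroup) :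
    subordinateOp P ν 0 = ContinuousLinearMap.id ℝ H := by
  ext u
  rw [subordinateOp_apply, ν.measure_zero', integral_dirac, P.map_zero']

theorem subordinateOp_add [CompleteSpace H] (P : ContractionSemigroup H) (ν : ConvolutionSemigroup) (s t : ℝ≥0) :
    subordinateOp P ν (s + t) = (subordinateOp P ν s).comp (subordinateOp P ν t) := by
  ext u
  rw [subordinateOp_apply, ν.measure_add',
    integral_conv (P.integrable _ u), ContinuousLinearMap.comp_apply, subordinateOp_apply]
  refine integral_congr_ae (Eventually.of_forall fun x => ?_)
  simp only [P.map_add', ContinuousLinearMap.comp_apply]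
  rw [subordinateOp_apply]
  exact ContinuousLinearMap.integral_comp_comm _ (P.integrable _ u)

theorem tendsto_subordinateOp [CompleteSpace H] (P : ContractionSemigroup H) (ν : ConvolutionSemigroup) (u : H) :
    Tendsto (fun t => subordinateOp P ν t u) (𝓝 0) (𝓝 u) := by
  rw [Metric.tendsto_nhds]
  intro ε hε
  have hc : Continuous fun s => ‖P.toFun s u - u‖ := ((P.continuous' u).sub continuous_const).norm
  have h0 : ‖P.toFun 0 u - u‖ = 0 := by simp [P.map_zero']
  have hev : ∀ᶠ s in 𝓝 (0 : ℝ≥0), ‖P.toFun s u - u‖ < ε / 2 := by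
    have := hc.tendsto 0
    rw [h0] at this
    exact this.eventually (gt_mem_nhds (half_pos hε))
  obtain ⟨δ, hδ, hball⟩ := Metric.eventually_nhds_iff.1 hev
  set φ : ℝ≥0 → ℝ := fun s => max 0 (1 - (s : ℝ) / δ) with hφ
  have hφc : Continuous φ := by fun_prop
  have hφs : HasCompactSupport φ := by
    refine HasCompactSupport.intro (isCompact_Icc (a := (0 : ℝ≥0)) (b := δ.toNNReal)) ?_
    intro x hx
    have hx' : δ < x := by
      by_contra hcon
      exact hx ⟨zero_le, (Real.le_toNNReal_iff_coe_le hδ.le).2 (not_lt.1 hcon)⟩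
    have : 1 ≤ (x : ℝ) / δ := (one_le_div hδ).2 hx'.le
    simp only [hφ]
    exact max_eq_left (by linarith)
  have hφ0 : φ 0 = 1 := by simp [hφ]
  have hφ1 : ∀ s, φ s ≤ 1 := fun s => by
    have : 0 ≤ (s : ℝ) / δ := div_nonneg s.2 hδ.le
    exact max_le zero_le_one (by linarith)
  have hbd : ∀ s, ‖P.toFun s u - u‖ ≤ ε / 2 + 2 * ‖u‖ * (1 - φ s) := fun s => by
    by_cases hs : (s : ℝ) < δ
    · have h1 : dist s 0 < δ := by
        rw [NNReal.dist_eq]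
        simpa using hs
      have h2 := hball h1
      have h3 := hφ1 s
      nlinarith [norm_nonneg u]
    · have h1 : φ s = 0 := by
        have : 1 ≤ (s : ℝ) / δ := (one_le_div hδ).2 (not_lt.1 hs)
        exact max_eq_left (by linarith)
      have h2 := norm_sub_le (P.toFun s u) u
      have h3 := P.norm_apply_le s u
      rw [h1]
      linarith
  have hlim := ν.vague' φ hφc hφs
  rw [hφ0] at hlim
  have hη : 0 < ε / (2 * (3 * ‖u‖ + 1)) := by positivity
  filter_upwards [hlim.eventually (lt_mem_nhds (sub_lt_self 1 hη))] with t ht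
  have hφi : Integrable φ (ν.measure t) := hφc.integrable_of_hasCompactSupport hφs
  have hm := ν.real_mass_le t
  have hm' : ∫ s, φ s ∂(ν.measure t) ≤ (ν.measure t).real univ := by
    have := integral_mono hφi (integrable_const (1 : ℝ)) hφ1
    simpa using this
  have e1 : ∫ s, (P.toFun s u - u) ∂(ν.measure t)
      = subordinateOp P ν t u - (ν.measure t).real univ • u := by
    rw [integral_sub (P.integrable _ u) (integrable_const u), integral_const, subordinateOp_apply]
  have e2 : ‖∫ s, (P.toFun s u - u) ∂(ν.measure t)‖
      ≤ ε / 2 * (ν.measure t).real univ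
        + 2 * ‖u‖ * ((ν.measure t).real univ - ∫ s, φ s ∂(ν.measure t)) := by
    have i1 : Integrable (fun s => 1 - φ s) (ν.measure t) := (integrable_const (1 : ℝ)).sub hφi
    have i2 : Integrable (fun s => 2 * ‖u‖ * (1 - φ s)) (ν.measure t) := i1.const_mul _
    refine (norm_integral_le_of_norm_le ((integrable_const (ε / 2)).add i2)
      (Eventually.of_forall hbd)).trans (le_of_eq ?_)
    simp only [Pi.add_apply]
    rw [integral_add (integrable_const (ε / 2)) i2, integral_const_mul,
      integral_sub (integrable_const (1 : ℝ)) hφi]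
    simp
    ring
  have e3 : subordinateOp P ν t u - u = ∫ s, (P.toFun s u - u) ∂(ν.measure t)
      - (1 - (ν.measure t).real univ) • u := by
    rw [e1, sub_smul, one_smul]
    abel
  have e4 : ‖(1 - (ν.measure t).real univ) • u‖ = (1 - (ν.measure t).real univ) * ‖u‖ := by
    rw [norm_smul, Real.norm_of_nonneg (by linarith)]
  rw [dist_eq_norm, e3]
  have e5 := norm_sub_le (∫ s, (P.toFun s u - u) ∂(ν.measure t))
    ((1 - (ν.measure t).real univ) • u)
  rw [e4] at e5
  have e6 : (3 * ‖u‖ + 1) * (1 - ∫ s, φ s ∂(ν.measure t)) < ε / 2 := by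
    have h1 : 0 < 3 * ‖u‖ + 1 := by positivity
    have h2 : (3 * ‖u‖ + 1) * (ε / (2 * (3 * ‖u‖ + 1))) = ε / 2 := by field_simp
    rw [← h2]
    exact mul_lt_mul_of_pos_left (by linarith) h1
  nlinarith [norm_nonneg u, mul_nonneg (norm_nonneg u) (sub_nonneg.2 hm),
    mul_nonneg (norm_nonneg u) (sub_nonneg.2 hm')]

theorem continuous_subordinateOp [CompleteSpace H] (P : ContractionSemigroup H) (ν : ConvolutionSemigroup) (u : H) :
    Continuous fun t => subordinateOp P ν t u := by
  have key : ∀ (a b : ℝ≥0), ‖subordinateOp P ν (a + b) u - subordinateOp P ν a u‖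
      ≤ ‖subordinateOp P ν b u - u‖ := fun a b => by
    rw [subordinateOp_add, ContinuousLinearMap.comp_apply, ← map_sub]
    simpa using (subordinateOp P ν a).le_of_opNorm_le (norm_subordinateOp_le P ν a)
      (subordinateOp P ν b u - u)
  rw [continuous_iff_continuousAt]
  intro t₀
  rw [ContinuousAt, tendsto_iff_norm_sub_tendsto_zero]
  have h1 : Tendsto (fun t : ℝ≥0 => nndist t t₀) (𝓝 t₀) (𝓝 0) := by
    have : Continuous fun t : ℝ≥0 => nndist t t₀ := by fun_prop
    simpa using this.tendsto t₀
  have h2 := (tendsto_iff_norm_sub_tendsto_zero.1 (tendsto_subordinateOp P ν u)).comp h1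
  refine squeeze_zero (fun _ => norm_nonneg _) (fun t => ?_) h2
  simp only [Function.comp_apply]
  rcases le_total t₀ t with h | h
  · have e : t = t₀ + nndist t t₀ := by
      apply NNReal.eq
      rw [NNReal.coe_add, coe_nndist, NNReal.dist_eq,
        abs_of_nonneg (sub_nonneg.2 (NNReal.coe_le_coe.2 h))]
      ring
    have := key t₀ (nndist t t₀)
    rwa [← e] at this
  · have e : t₀ = t + nndist t t₀ := by
      apply NNReal.eq
      rw [NNReal.coe_add, coe_nndist, NNReal.dist_eq,
        abs_of_nonpos (sub_nonpos.2 (NNReal.coe_le_coe.2 h))]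
      ring
    have := key t (nndist t t₀)
    rw [← e, norm_sub_rev] at this
    exact this

/-- The semigroup subordinate to `P` by means of `ν`: `P^f_t u = ∫ P_s u ν_t(ds)`. -/
def ContractionSemigroup.subordinate [CompleteSpace H] (P : ContractionSemigroup H)
    (ν : ConvolutionSemigroup) : ContractionSemigroup H where
  toFun := subordinateOp P ν
  map_zero' := subordinateOp_zero P ν
  map_add' := subordinateOp_add P ν
  norm_le' := norm_subordinateOp_le P ν
  continuous' := continuous_subordinateOp P ν

end Subordination

/-! ### Semigroups on `L²(μ)` -/

section LTwo

variable {X : Type*} [MeasurableSpace X] {μ : Measure X}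

/-- `(u, h)` is in the graph of the generator: `h = lim_{t → 0+} (P_t u - u) / t`. -/
def ContractionSemigroup.GeneratorRel (P : ContractionSemigroup (Lp ℝ 2 μ))
    (u h : Lp ℝ 2 μ) : Prop :=
  Tendsto (fun t : ℝ≥0 => (t : ℝ)⁻¹ • (P.toFun t u - u)) (𝓝[>] 0) (𝓝 h)

def ContractionSemigroup.IsSymmetric (P : ContractionSemigroup (Lp ℝ 2 μ)) : Prop :=
  ∀ t u v, inner ℝ (P.toFun t u) v = inner ℝ u (P.toFun t v)

/-- `0 ≤ u ≤ 1` a.e. implies `0 ≤ P_t u ≤ 1` a.e. -/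
def ContractionSemigroup.IsSubMarkovian (P : ContractionSemigroup (Lp ℝ 2 μ)) : Prop :=
  ∀ (t : ℝ≥0) (u : Lp ℝ 2 μ), (∀ᵐ x ∂μ, 0 ≤ u x ∧ u x ≤ 1) →
    ∀ᵐ x ∂μ, 0 ≤ P.toFun t u x ∧ P.toFun t u x ≤ 1

/-- For symmetric `P` with generator `L`: `u` lies in the domain `D(√-L)` of the Dirichlet form of
`P` and `𝓔(u, u) = e`, that is, the limit of `⟨u - P_t u, u⟩ / t` as `t → 0+` exists in `ℝ` and
equals `e`. -/
def ContractionSemigroup.HasEnergy (P : ContractionSemigroup (Lp ℝ 2 μ))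
    (u : Lp ℝ 2 μ) (e : ℝ) : Prop :=
  Tendsto (fun t : ℝ≥0 => (t : ℝ)⁻¹ * inner ℝ (u - P.toFun t u) u) (𝓝[>] 0) (𝓝 e)

/-- Transience of the Dirichlet form of `P`: there is a bounded integrable `g > 0` with
`∫ |u| g dμ ≤ √𝓔(u, u)` on the form domain. -/
def ContractionSemigroup.IsTransient (P : ContractionSemigroup (Lp ℝ 2 μ)) : Prop :=
  ∃ g : X → ℝ, Integrable g μ ∧ (∃ C : ℝ, ∀ᵐ x ∂μ, g x ≤ C) ∧ (∀ᵐ x ∂μ, 0 < g x) ∧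
    ∀ (u : Lp ℝ 2 μ) (e : ℝ), P.HasEnergy u e →
      ∫⁻ x, ENNReal.ofReal (|u x| * g x) ∂μ ≤ ENNReal.ofReal (√e)

/-- `‖T‖_{p → q}`: the norm of `T`, as an operator from `L^p(μ)` to `L^q(μ)`, computed on
`L²(μ) ∩ L^p(μ)`, possibly `∞`. -/
def normPQ (p q : ℝ≥0∞) (T : Lp ℝ 2 μ →L[ℝ] Lp ℝ 2 μ) : ℝ≥0∞ :=
  ⨆ (u : Lp ℝ 2 μ) (_ : eLpNorm u p μ ≤ 1), eLpNorm (T u) q μ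

end LTwo

/-! ### The Dirichlet Laplacian on a domain of `ℝ^d` -/

section Laplacian

variable {d : ℕ}

/-- A bounded domain with smooth boundary: near each boundary point, `Ω` is the sublevel set
`{ρ < 0}` of a smooth function `ρ` with nonvanishing differential. -/
def IsBoundedSmoothDomain (Ω : Set (EuclideanSpace ℝ (Fin d))) : Prop :=
  IsOpen Ω ∧ IsConnected Ω ∧ Bornology.IsBounded Ω ∧
    ∀ x ∈ frontier Ω, ∃ (V : Set (EuclideanSpace ℝ (Fin d))) (ρ : EuclideanSpace ℝ (Fin d) → ℝ),
      IsOpen V ∧ x ∈ V ∧ ContDiffOn ℝ ∞ ρ V ∧ fderiv ℝ ρ x ≠ 0 ∧ ∀ y ∈ V, y ∈ Ω ↔ ρ y < 0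

/-- `φ ∈ C_c^∞(Ω)`. -/
def IsTestFunction (Ω : Set (EuclideanSpace ℝ (Fin d))) (φ : EuclideanSpace ℝ (Fin d) → ℝ) :
    Prop :=
  ContDiff ℝ ∞ φ ∧ HasCompactSupport φ ∧ tsupport φ ⊆ Ω

/-- Real `L²(Ω)` for Lebesgue measure. -/
abbrev LTwo (Ω : Set (EuclideanSpace ℝ (Fin d))) := Lp ℝ 2 (volume.restrict Ω)

/-- `L²(Ω)` vector fields. -/
abbrev LTwoField (Ω : Set (EuclideanSpace ℝ (Fin d))) :=
  Lp (EuclideanSpace ℝ (Fin d)) 2 (volume.restrict Ω)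

/-- `g` is the weak gradient of `u` on `Ω`. -/
def IsWeakGradient (Ω : Set (EuclideanSpace ℝ (Fin d))) (u : LTwo Ω) (g : LTwoField Ω) : Prop :=
  ∀ φ, IsTestFunction Ω φ → ∫ x in Ω, u x • ∇ φ x = -∫ x in Ω, φ x • g x

/-- `u ∈ H_0^1(Ω)` and `g = ∇u` (weakly): `u` has weak gradient `g ∈ L²`, and `u` is in the closure
of `C_c^∞(Ω)` for the norm of `H^1(Ω)`. -/
def IsHZeroOne (Ω : Set (EuclideanSpace ℝ (Fin d))) (u : LTwo Ω) (g : LTwoField Ω) : Prop :=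
  IsWeakGradient Ω u g ∧ ∀ ε : ℝ≥0∞, 0 < ε → ∃ φ, IsTestFunction Ω φ ∧
    eLpNorm (fun x => u x - φ x) 2 (volume.restrict Ω) < ε ∧
    eLpNorm (fun x => g x - ∇ φ x) 2 (volume.restrict Ω) < ε

/-- `u ∈ D(Δ_Ω)` and `Δ_Ω u = h`, for the Dirichlet Laplacian `Δ_Ω`, the operator associated with
the form `𝓔(u, v) = ∫ ∇u · ∇v` on `H_0^1(Ω)`. -/
def DirichletLaplacianRel (Ω : Set (EuclideanSpace ℝ (Fin d))) (u h : LTwo Ω) : Prop :=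
  ∃ g, IsHZeroOne Ω u g ∧ ∀ v k, IsHZeroOne Ω v k → inner ℝ g k = -inner ℝ h v

/-- `P` is the semigroup on `L²(Ω)` whose generator is the Dirichlet Laplacian. -/
def IsDirichletHeatSemigroup (Ω : Set (EuclideanSpace ℝ (Fin d)))
    (P : ContractionSemigroup (LTwo Ω)) : Prop :=
  ∀ u h, P.GeneratorRel u h ↔ DirichletLaplacianRel Ω u h

end Laplacian

end DirichletSubordination

end

namespace DirichletSubordination

/-! ### Laplace transforms of finite measures -/

/-! The `1 → 2` bound rests on the ultracontractivity of the heat semigroup. Sobolev's inequality,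
with exponent `2d/(d-2)`, and Hölder interpolation give Nash's inequality on `H_0^1(Ω)`
(`exists_nash`). The operators `P_t` are symmetric and sub-Markovian, hence contract the `L¹` norm,
and Nash's differential inequality for `‖P_t u‖²` yields `‖P_s u‖₂ ≤ K s^(-d/4) ‖u‖₁`. Integrating
against `ν_t` leaves the moment `∫ s^(-d/4) ν_t(ds)`. It is finite: `Γ(γ) s^(-γ)` is the integral of
`l^(γ-1) e^{-ls}` over `l > 0`, and the Laplace transform of `ν_t` is at most `e^{-t(l^α - 1)}`
(`lintegral_rpow_neg_lt_top`).

Transience is a spectral gap. Poincaré's inequality gives `‖P_t‖ ≤ e^{-bt}` with `b > 0`, hence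
`‖P^f_t‖ ≤ e^{-t f(b)}` with `f(b) > 0`, so the form dominates `f(b) ‖u‖²`. Since `Ω` has finite
measure, Cauchy-Schwarz then allows a constant `g`.

The objects themselves must be constructed. Both functions are `(l + c)^α - c^α`, with `c = 0` or `c
= 1`. A stable law is obtained as a limit of compound Poisson laws; scaling gives the stable
subordinator, and an exponential density shifts `l` to `l + c` (`exists_tilted_stable`). Uniqueness
is Stone-Weierstrass for polynomials in `e^{-s}`.

The heat semigroup comes from Lax-Milgram resolvents through the Hille-Yosida theorem
(`IsResolventFamily.exists_semigroup`). The resolvent minimizes an energy that is not increased by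
clamping values to `[0, 1]`, so it is sub-Markovian. This property and symmetry pass to
exponentials, to strong limits and to subordinate operators. -/

theorem continuous_exp_neg_mul_coe (l : ℝ) : Continuous fun s : ℝ≥0 => Real.exp (-(l * (s : ℝ))) := by
  fun_prop

theorem exp_neg_mul_coe_le_one {l : ℝ} (hl : 0 ≤ l) (s : ℝ≥0) : Real.exp (-(l * (s : ℝ))) ≤ 1 :=
  Real.exp_le_one_iff.2 (neg_nonpos.2 (mul_nonneg hl s.2))

theorem integrable_exp_neg_mul_coe (m : Measure ℝ≥0) [IsFiniteMeasure m] {l : ℝ} (hl : 0 ≤ l) :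
    Integrable (fun s : ℝ≥0 => Real.exp (-(l * (s : ℝ)))) m :=
  Integrable.of_bound (continuous_exp_neg_mul_coe l).aestronglyMeasurable 1
    (Eventually.of_forall fun s => by
      rw [Real.norm_of_nonneg (Real.exp_pos _).le]
      exact exp_neg_mul_coe_le_one hl s)

/-- Laplace transforms are prescribed only for `l > 0`; the limit `l → 0` recovers the total mass.
-/
theorem tendsto_integral_exp_neg_mul_coe (m : Measure ℝ≥0) [IsFiniteMeasure m] :
    Tendsto (fun l : ℝ => ∫ s : ℝ≥0, Real.exp (-(l * (s : ℝ))) ∂m) (𝓝[>] 0) (𝓝 (m.real univ)) := by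
  have h : m.real univ = ∫ _ : ℝ≥0, (1 : ℝ) ∂m := by simp
  rw [h]
  refine tendsto_integral_filter_of_dominated_convergence (fun _ => (1 : ℝ)) ?_ ?_
    (integrable_const _) ?_
  · exact Eventually.of_forall fun l => (continuous_exp_neg_mul_coe l).aestronglyMeasurable
  · filter_upwards [self_mem_nhdsWithin] with l hl
    refine Eventually.of_forall fun s => ?_
    rw [Real.norm_of_nonneg (Real.exp_pos _).le]
    exact exp_neg_mul_coe_le_one (le_of_lt hl) s
  · refine Eventually.of_forall fun s => ?_
    have : Continuous fun l : ℝ => Real.exp (-(l * (s : ℝ))) := by fun_prop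
    simpa using (this.tendsto 0).mono_left nhdsWithin_le_nhds

/-- Finite measures on `[0, ∞)` are determined by their Laplace transforms on `(0, ∞)`. -/
theorem ext_of_laplace {m m' : Measure ℝ≥0} [IsFiniteMeasure m] [IsFiniteMeasure m']
    (h : ∀ l : ℝ, 0 < l → ∫ s : ℝ≥0, Real.exp (-(l * (s : ℝ))) ∂m
      = ∫ s : ℝ≥0, Real.exp (-(l * (s : ℝ))) ∂m') : m = m' := by
  -- Stone-Weierstrass: `F` is `e^{-s}`, which already separates points, and the integrals of
  -- polynomials in `F` are combinations of Laplace transforms at natural numbers.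
  let F : BoundedContinuousFunction ℝ≥0 ℝ := BoundedContinuousFunction.ofNormedAddCommGroup
    (fun s : ℝ≥0 => Real.exp (-(1 * (s : ℝ)))) (continuous_exp_neg_mul_coe 1) 1 (fun s => by
      rw [Real.norm_of_nonneg (Real.exp_pos _).le]
      exact exp_neg_mul_coe_le_one zero_le_one s)
  have hF : ∀ s, F s = Real.exp (-(1 * (s : ℝ))) := fun s => rfl
  let A : StarSubalgebra ℝ (BoundedContinuousFunction ℝ≥0 ℝ) :=
    { Algebra.adjoin ℝ {F} with
      star_mem' := fun {a} ha => by
        rwa [show star a = a from BoundedContinuousFunction.ext fun s => by simp] }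
  have hFA : F ∈ A := Algebra.subset_adjoin rfl
  -- Needed for the constant monomial, where `l = 0` is outside the hypothesis.
  have hm : m.real univ = m'.real univ := by
    refine tendsto_nhds_unique (tendsto_integral_exp_neg_mul_coe m)
      ((tendsto_integral_exp_neg_mul_coe m').congr' ?_)
    filter_upwards [self_mem_nhdsWithin] with l hl using (h l hl).symm
  refine ext_of_forall_mem_subalgebra_integral_eq_of_pseudoEMetric_complete_countable
    (𝕜 := ℝ) (A := A) ?_ ?_
  · intro x y hxy
    refine ⟨F, ⟨_, ⟨F, hFA, rfl⟩, rfl⟩, ?_⟩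
    rw [hF, hF]
    intro he
    have := Real.exp_injective he
    exact hxy (NNReal.eq (by linarith))
  · have key : ∀ p : Polynomial ℝ, ∫ s, (Polynomial.aeval F p) s ∂m
        = ∫ s, (Polynomial.aeval F p) s ∂m' := fun p => by
      induction p using Polynomial.induction_on' with
      | add p q hp hq =>
        simp only [map_add, BoundedContinuousFunction.coe_add, Pi.add_apply]
        rw [integral_add ((Polynomial.aeval F p).integrable m)
          ((Polynomial.aeval F q).integrable m), integral_add
          ((Polynomial.aeval F p).integrable m') ((Polynomial.aeval F q).integrable m'), hp, hq]
      | monomial n a =>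
        have e : ∀ s, (Polynomial.aeval F (Polynomial.monomial n a)) s
            = a * Real.exp (-((n : ℝ) * (s : ℝ))) := fun s => by
          rw [Polynomial.aeval_monomial]
          simp only [BoundedContinuousFunction.coe_mul, Pi.mul_apply,
            BoundedContinuousFunction.coe_pow, Pi.pow_apply,
            BoundedContinuousFunction.algebraMap_apply, hF]
          rw [← Real.exp_nat_mul]
          simp
        simp only [e]
        rw [integral_const_mul, integral_const_mul]
        rcases Nat.eq_zero_or_pos n with rfl | hn
        · simp [hm]
        · rw [h n (by exact_mod_cast hn)]
    intro g hg
    have hg' : g ∈ Algebra.adjoin ℝ {F} := hg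
    rw [Algebra.adjoin_singleton_eq_range_aeval] at hg'
    obtain ⟨p, rfl⟩ := hg'
    exact key p

theorem ConvolutionSemigroup.HasLaplaceExponent.unique {ν ν' : ConvolutionSemigroup} {f : ℝ → ℝ}
    (h : ν.HasLaplaceExponent f) (h' : ν'.HasLaplaceExponent f) : ν = ν' := by
  apply ConvolutionSemigroup.ext
  funext t
  exact ext_of_laplace fun l hl => (h t l hl).trans (h' t l hl).symm

/-! ### Bernstein functions -/

/-- The derivative of order `n + 1` carries the coefficient `a (a - 1) ⋯ (a - n)`, in which exactly
`n` factors are negative. -/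
theorem isBernsteinFunction_rpow_add {c a : ℝ} (hc : 0 ≤ c) (ha0 : 0 < a) (ha1 : a < 1) (b : ℝ)
    (hb : b ≤ c ^ a) : IsBernsteinFunction fun l => (l + c) ^ a - b := by
  have hd : ∀ n : ℕ, iteratedDeriv (n + 1) (fun l : ℝ => (l + c) ^ a - b)
      = fun l => (descPochhammer ℝ (n + 1)).eval a * (l + c) ^ (a - ((n + 1 : ℕ) : ℝ)) := by
    intro n
    have h1 : iteratedDeriv (n + 1) (fun l : ℝ => (l + c) ^ a - b)
        = iteratedDeriv (n + 1) (fun l : ℝ => (l + c) ^ a) := by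
      rw [iteratedDeriv_succ', iteratedDeriv_succ']
      congr 1
      funext x
      exact deriv_sub_const _
    rw [h1, iteratedDeriv_comp_add_const (n + 1) (fun l : ℝ => l ^ a) c]
    funext l
    rw [iteratedDeriv_eq_iterate, Real.iter_deriv_rpow_const]
  have hp : ∀ n : ℕ, 0 ≤ (-1 : ℝ) ^ n * (descPochhammer ℝ (n + 1)).eval a := by
    intro n
    induction n with
    | zero => simpa using ha0.le
    | succ n ih =>
      rw [descPochhammer_succ_right]
      simp only [Polynomial.eval_mul, Polynomial.eval_sub, Polynomial.eval_X,
        Polynomial.eval_natCast]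
      have : 0 ≤ ((n + 1 : ℕ) : ℝ) - a := by
        push_cast
        have : (0 : ℝ) ≤ n := n.cast_nonneg
        linarith
      calc (0 : ℝ) ≤ ((-1 : ℝ) ^ n * (descPochhammer ℝ (n + 1)).eval a) * (((n + 1 : ℕ) : ℝ) - a) :=
            mul_nonneg ih this
        _ = _ := by ring
  refine ⟨?_, ?_, ?_⟩
  · intro l hl
    have hl' : l + c ≠ 0 := by
      have : 0 < l := hl
      positivity
    exact (((contDiffAt_id.add contDiffAt_const).rpow_const_of_ne hl').sub
      contDiffAt_const).contDiffWithinAt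
  · intro l hl
    have := Real.rpow_le_rpow hc (by linarith : c ≤ l + c) ha0.le
    linarith
  · intro n l hl
    rw [hd, ← mul_assoc]
    exact mul_nonneg (hp n) (Real.rpow_nonneg (by linarith) _)

/-! ### Stable laws on `[0, ∞)` -/

/-- `φ` is the Laplace transform on `(0, ∞)` of a probability measure on `[0, ∞]`, written with the
variable `x = e^{-s} ∈ [0, 1]`. -/
def IsUnitLaplace (φ : ℝ → ℝ) : Prop :=
  ∃ m : ProbabilityMeasure unitInterval,
    ∀ l, 0 < l → ∫ x : unitInterval, (x : ℝ) ^ l ∂(m : Measure unitInterval) = φ l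

theorem continuous_unitInterval_rpow {l : ℝ} (hl : 0 < l) :
    Continuous fun x : unitInterval => (x : ℝ) ^ l :=
  continuous_subtype_val.rpow_const fun _ => Or.inr hl.le

theorem unitInterval_rpow_mem {l : ℝ} (hl : 0 < l) (x : unitInterval) :
    0 ≤ (x : ℝ) ^ l ∧ (x : ℝ) ^ l ≤ 1 :=
  ⟨Real.rpow_nonneg x.2.1 _, Real.rpow_le_one x.2.1 x.2.2 hl.le⟩

theorem integrable_unitInterval_rpow (m : Measure unitInterval) [IsFiniteMeasure m] {l : ℝ}
    (hl : 0 < l) : Integrable (fun x : unitInterval => (x : ℝ) ^ l) m :=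
  Integrable.of_bound (continuous_unitInterval_rpow hl).aestronglyMeasurable 1
    (Eventually.of_forall fun x => by
      rw [Real.norm_of_nonneg (unitInterval_rpow_mem hl x).1]
      exact (unitInterval_rpow_mem hl x).2)

theorem IsUnitLaplace.one : IsUnitLaplace fun _ => 1 :=
  ⟨⟨Measure.dirac 1, inferInstance⟩, fun l _ => by simp⟩

theorem IsUnitLaplace.mul {φ ψ : ℝ → ℝ} (hφ : IsUnitLaplace φ) (hψ : IsUnitLaplace ψ) :
    IsUnitLaplace fun l => φ l * ψ l := by
  obtain ⟨m, hm⟩ := hφ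
  obtain ⟨m', hm'⟩ := hψ
  have hmul : Measurable fun p : unitInterval × unitInterval => p.1 * p.2 :=
    continuous_mul.measurable
  refine ⟨⟨((m : Measure unitInterval).prod (m' : Measure unitInterval)).map (fun p => p.1 * p.2),
    Measure.isProbabilityMeasure_map hmul.aemeasurable⟩, fun l hl => ?_⟩
  rw [ProbabilityMeasure.coe_mk, integral_map hmul.aemeasurable
    (continuous_unitInterval_rpow hl).aestronglyMeasurable]
  simp only [← hm l hl, ← hm' l hl]
  rw [← integral_prod_mul]
  refine integral_congr_ae (Eventually.of_forall fun p => ?_)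
  simp only [Set.Icc.coe_mul]
  exact Real.mul_rpow p.1.2.1 p.2.2.1

theorem IsUnitLaplace.pow {φ : ℝ → ℝ} (hφ : IsUnitLaplace φ) (n : ℕ) :
    IsUnitLaplace fun l => φ l ^ n := by
  induction n with
  | zero => simpa using IsUnitLaplace.one
  | succ n ih => simpa only [pow_succ] using ih.mul hφ

theorem IsUnitLaplace.convexComb {φ ψ : ℝ → ℝ} (hφ : IsUnitLaplace φ) (hψ : IsUnitLaplace ψ)
    {a b : ℝ} (ha : 0 ≤ a) (hb : 0 ≤ b) (hab : a + b = 1) :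
    IsUnitLaplace fun l => a * φ l + b * ψ l := by
  obtain ⟨m, hm⟩ := hφ
  obtain ⟨m', hm'⟩ := hψ
  refine ⟨⟨ENNReal.ofReal a • (m : Measure unitInterval)
    + ENNReal.ofReal b • (m' : Measure unitInterval), ⟨?_⟩⟩, fun l hl => ?_⟩
  · simp [← ENNReal.ofReal_add ha hb, hab]
  · rw [ProbabilityMeasure.coe_mk, integral_add_measure
      ((integrable_unitInterval_rpow _ hl).smul_measure ENNReal.ofReal_ne_top)
      ((integrable_unitInterval_rpow _ hl).smul_measure ENNReal.ofReal_ne_top),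
      integral_smul_measure, integral_smul_measure, hm l hl, hm' l hl,
      ENNReal.toReal_ofReal ha, ENNReal.toReal_ofReal hb]
    rfl

/-- Probability measures on the compact interval form a compact space, so a limit point along an
ultrafilter exists without any tightness, and `x ↦ x^l` is continuous up to `x = 0` because `l > 0`.
The price is a possible atom at `x = 0`, that is, at `s = ∞`, which `exists_stable_law` excludes. -/
theorem IsUnitLaplace.of_tendsto {φ : ℕ → ℝ → ℝ} {ψ : ℝ → ℝ} (hφ : ∀ᶠ n in atTop, IsUnitLaplace (φ n))
    (h : ∀ l, 0 < l → Tendsto (fun n => φ n l) atTop (𝓝 (ψ l))) : IsUnitLaplace ψ := by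
  obtain ⟨N, hN⟩ := eventually_atTop.1 hφ
  choose m hm using fun n => hN (n + N) (Nat.le_add_left N n)
  obtain ⟨U, hU⟩ := Ultrafilter.exists_le (atTop : Filter ℕ)
  obtain ⟨m', -, hm'⟩ := isCompact_univ.ultrafilter_le_nhds (U.map m) (by simp)
  have hm'' : Tendsto m U (𝓝 m') := hm'
  rw [ProbabilityMeasure.tendsto_iff_forall_integral_tendsto] at hm''
  refine ⟨m', fun l hl => ?_⟩
  have h1 := hm'' (BoundedContinuousFunction.mkOfCompact ⟨_, continuous_unitInterval_rpow hl⟩)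
  simp only [BoundedContinuousFunction.mkOfCompact_apply, ContinuousMap.coe_mk, hm _ l hl] at h1
  exact tendsto_nhds_unique h1 (((h l hl).comp (tendsto_add_atTop_nat N)).mono_left hU)

/-- A compound Poisson law, as the limit of `((1 - c/n) + (c/n) ψ)^n`: powers of convex combinations
of `1` and `ψ` as soon as `n ≥ c`. -/
theorem IsUnitLaplace.exp {ψ : ℝ → ℝ} (hψ : IsUnitLaplace ψ) {c : ℝ} (hc : 0 ≤ c) :
    IsUnitLaplace fun l => Real.exp (-(c * (1 - ψ l))) := by
  refine IsUnitLaplace.of_tendsto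
    (φ := fun n l => (1 + (-(c * (1 - ψ l))) / n) ^ n) ?_ fun l _ =>
      Real.tendsto_one_add_div_pow_exp _
  filter_upwards [eventually_ge_atTop (⌈c⌉₊ + 1)] with n hn
  have hn1 : c ≤ n := (Nat.le_ceil c).trans (by exact_mod_cast (Nat.le_succ _).trans hn)
  have hn0 : (0 : ℝ) < n := by
    have : 0 < n := by omega
    exact_mod_cast this
  have h1 : 0 ≤ 1 - c / n := sub_nonneg.2 ((div_le_one hn0).2 hn1)
  have := (IsUnitLaplace.one.convexComb hψ h1 (div_nonneg hc hn0.le) (by ring)).pow n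
  convert this using 3
  field_simp
  ring

/-- The function `s ↦ 1 - e^{-l s}` is integrable against the Lévy measure `s^{-1-a} ds`. -/
theorem integrableOn_stable_levy {a : ℝ} (ha0 : 0 < a) (ha1 : a < 1) {l : ℝ} (hl : 0 < l) :
    IntegrableOn (fun s : ℝ => (1 - Real.exp (-(l * s))) * s ^ (-1 - a)) (Ioi 0) := by
  have hmeas : ∀ t : Set ℝ, AEStronglyMeasurable
      (fun s : ℝ => (1 - Real.exp (-(l * s))) * s ^ (-1 - a)) (volume.restrict t) := fun t => by
    have : Measurable (fun s : ℝ => (1 - Real.exp (-(l * s))) * s ^ (-1 - a)) := by fun_prop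
    exact this.aestronglyMeasurable
  rw [← Ioc_union_Ioi_eq_Ioi (zero_le_one (α := ℝ))]
  refine IntegrableOn.union ?_ ?_
  · have h : IntegrableOn (fun s : ℝ => l * s ^ (-a)) (Ioc 0 1) :=
      ((intervalIntegrable_iff_integrableOn_Ioc_of_le zero_le_one).1
        (intervalIntegral.intervalIntegrable_rpow' (by linarith))).const_mul l
    refine Integrable.mono' h (hmeas _) ?_
    filter_upwards [ae_restrict_mem measurableSet_Ioc] with s hs
    have hs0 : 0 < s := hs.1
    have e1 : Real.exp (-(l * s)) ≤ 1 := Real.exp_le_one_iff.2 (by nlinarith)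
    have e2 : 1 - Real.exp (-(l * s)) ≤ l * s := by
      have := Real.add_one_le_exp (-(l * s))
      linarith
    rw [Real.norm_of_nonneg (mul_nonneg (by linarith) (Real.rpow_nonneg hs0.le _))]
    calc _ ≤ (l * s) * s ^ (-1 - a) := by gcongr
      _ = l * (s ^ (1 : ℝ) * s ^ (-1 - a)) := by rw [Real.rpow_one]; ring
      _ = l * s ^ (-a) := by rw [← Real.rpow_add hs0]; ring_nf
  · have h : IntegrableOn (fun s : ℝ => s ^ (-1 - a)) (Ioi 1) :=
      integrableOn_Ioi_rpow_of_lt (by linarith) zero_lt_one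
    refine Integrable.mono' h (hmeas _) ?_
    filter_upwards [ae_restrict_mem measurableSet_Ioi] with s hs
    have hs0 : 0 < s := zero_lt_one.trans hs
    have e1 : Real.exp (-(l * s)) ≤ 1 := Real.exp_le_one_iff.2 (by nlinarith)
    have e2 := Real.exp_pos (-(l * s))
    have e3 := Real.rpow_nonneg hs0.le (-1 - a)
    rw [Real.norm_of_nonneg (mul_nonneg (by linarith) e3)]
    nlinarith

/-- Scaling `s ↦ l s`: homogeneity of the Lévy density produces the factor `l^a`. -/
theorem integral_stable_levy {a : ℝ} {l : ℝ} (hl : 0 < l) :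
    ∫ s in Ioi (0 : ℝ), (1 - Real.exp (-(l * s))) * s ^ (-1 - a)
      = l ^ a * ∫ s in Ioi (0 : ℝ), (1 - Real.exp (-(1 * s))) * s ^ (-1 - a) := by
  have h := integral_comp_mul_left_Ioi
    (fun s : ℝ => (1 - Real.exp (-(1 * s))) * s ^ (-1 - a)) 0 hl
  rw [mul_zero, smul_eq_mul] at h
  have h2 : ∫ s in Ioi (0 : ℝ), (1 - Real.exp (-(1 * (l * s)))) * (l * s) ^ (-1 - a)
      = l ^ (-1 - a) * ∫ s in Ioi (0 : ℝ), (1 - Real.exp (-(l * s))) * s ^ (-1 - a) := by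
    rw [← integral_const_mul]
    refine setIntegral_congr_fun measurableSet_Ioi fun s hs => ?_
    simp only [one_mul]
    rw [Real.mul_rpow hl.le (le_of_lt hs)]
    ring
  rw [h2] at h
  have e : l ^ (-1 - a) * l ^ (1 + a) = 1 := by
    rw [← Real.rpow_add hl]
    simp
  have e2 : l ^ (1 + a) * l⁻¹ = l ^ a := by
    rw [← Real.rpow_neg_one, ← Real.rpow_add hl]
    ring_nf
  calc _ = l ^ (1 + a) * (l ^ (-1 - a)
        * ∫ s in Ioi (0 : ℝ), (1 - Real.exp (-(l * s))) * s ^ (-1 - a)) := by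
        rw [← mul_assoc, mul_comm (l ^ (1 + a)), e, one_mul]
    _ = _ := by rw [h, ← mul_assoc, e2]

theorem integral_stable_levy_pos {a : ℝ} (ha0 : 0 < a) (ha1 : a < 1) :
    0 < ∫ s in Ioi (0 : ℝ), (1 - Real.exp (-(1 * s))) * s ^ (-1 - a) := by
  rw [setIntegral_pos_iff_support_of_nonneg_ae]
  · have : Ioi (0 : ℝ) ⊆ (Function.support fun s : ℝ =>
        (1 - Real.exp (-(1 * s))) * s ^ (-1 - a)) ∩ Ioi 0 := fun s hs => by
      refine ⟨?_, hs⟩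
      have hs' : (0 : ℝ) < s := hs
      have h1 : Real.exp (-(1 * s)) < 1 := Real.exp_lt_one_iff.2 (by linarith)
      exact (mul_pos (by linarith) (Real.rpow_pos_of_pos hs' _)).ne'
    exact lt_of_lt_of_le (by simp) (measure_mono this)
  · filter_upwards [ae_restrict_mem measurableSet_Ioi] with s hs
    have hs' : (0 : ℝ) < s := hs
    have h1 : Real.exp (-(1 * s)) < 1 := Real.exp_lt_one_iff.2 (by linarith)
    exact (mul_pos (by linarith) (Real.rpow_pos_of_pos hs' _)).le
  · exact integrableOn_stable_levy ha0 ha1 one_pos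

/-- Compound Poisson laws with jump density proportional to `s^{-1-a}` on `(ε, ∞)`. -/
theorem isUnitLaplace_truncated_stable {a : ℝ} (ha0 : 0 < a) {ε : ℝ} (hε : 0 < ε) {k : ℝ}
    (hk : 0 ≤ k) : IsUnitLaplace fun l => Real.exp (-(k *
      ∫ s in Ioi ε, (1 - Real.exp (-(l * s))) * s ^ (-1 - a))) := by
  have hint : IntegrableOn (fun s : ℝ => s ^ (-1 - a)) (Ioi ε) :=
    integrableOn_Ioi_rpow_of_lt (by linarith) hε
  have hpos : ∀ s ∈ Ioi ε, 0 < s ^ (-1 - a) := fun s hs =>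
    Real.rpow_pos_of_pos (hε.trans hs) _
  set c : ℝ := ∫ s in Ioi ε, s ^ (-1 - a) with hc
  have hc0 : 0 < c := by
    rw [hc, setIntegral_pos_iff_support_of_nonneg_ae _ hint]
    · have : Ioi ε ⊆ (Function.support fun s : ℝ => s ^ (-1 - a)) ∩ Ioi ε := fun s hs =>
        ⟨(hpos s hs).ne', hs⟩
      exact lt_of_lt_of_le (by simp) (measure_mono this)
    · filter_upwards [ae_restrict_mem measurableSet_Ioi] with s hs using (hpos s hs).le
  set M : Measure ℝ := (volume.restrict (Ioi ε)).withDensity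
    (fun s => ENNReal.ofReal (c⁻¹ * s ^ (-1 - a))) with hM
  have hdens : Measurable fun s : ℝ => c⁻¹ * s ^ (-1 - a) := by fun_prop
  have hMp : IsProbabilityMeasure M := ⟨by
    rw [hM, withDensity_apply _ MeasurableSet.univ, Measure.restrict_univ,
      ← ofReal_integral_eq_lintegral_ofReal (hint.const_mul _)]
    · rw [integral_const_mul, ← hc, inv_mul_cancel₀ hc0.ne', ENNReal.ofReal_one]
    · filter_upwards [ae_restrict_mem measurableSet_Ioi] with s hs
      exact mul_nonneg (inv_nonneg.2 hc0.le) (hpos s hs).le⟩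
  -- The maximum only makes `e` well defined on all of `ℝ`; it is inactive on `(ε, ∞)`, which
  -- carries `M`.
  let e : ℝ → unitInterval := fun s => ⟨Real.exp (-(max 0 s)), (Real.exp_pos _).le,
    Real.exp_le_one_iff.2 (neg_nonpos.2 (le_max_left _ _))⟩
  have he : Measurable e := by
    refine Measurable.subtype_mk ?_
    fun_prop
  have hψ : IsUnitLaplace fun l => ∫ s in Ioi ε, c⁻¹ * s ^ (-1 - a) * Real.exp (-(l * s)) := by
    refine ⟨⟨M.map e, Measure.isProbabilityMeasure_map he.aemeasurable⟩, fun l hl => ?_⟩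
    rw [ProbabilityMeasure.coe_mk, integral_map he.aemeasurable
      (continuous_unitInterval_rpow hl).aestronglyMeasurable, hM]
    have : (fun s : ℝ => ENNReal.ofReal (c⁻¹ * s ^ (-1 - a)))
      = fun s : ℝ => ((c⁻¹ * s ^ (-1 - a)).toNNReal : ℝ≥0∞) := rfl
    rw [this, integral_withDensity_eq_integral_smul hdens.real_toNNReal]
    refine setIntegral_congr_fun measurableSet_Ioi fun s hs => ?_
    have hs0 : 0 < s := hε.trans hs
    simp only [e, NNReal.smul_def, smul_eq_mul]
    rw [Real.coe_toNNReal _ (mul_nonneg (inv_nonneg.2 hc0.le) (hpos s hs).le),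
      max_eq_right hs0.le, ← Real.exp_mul]
    ring_nf
  -- Since `c` is the total mass of `s^{-1-a}` on `(ε, ∞)`, the rate `k c` undoes the normalization
  -- of the jump law.
  obtain ⟨m, hm⟩ := hψ.exp (mul_nonneg hk hc0.le)
  refine ⟨m, fun l hl => ?_⟩
  rw [hm l hl]
  have hint' : IntegrableOn (fun s : ℝ => s ^ (-1 - a) * Real.exp (-(l * s))) (Ioi ε) := by
    refine Integrable.mono' hint (by
      have : Measurable (fun s : ℝ => s ^ (-1 - a) * Real.exp (-(l * s))) := by fun_prop
      exact this.aestronglyMeasurable) ?_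
    filter_upwards [ae_restrict_mem measurableSet_Ioi] with s hs
    have hs0 : 0 < s := hε.trans hs
    rw [Real.norm_of_nonneg (mul_nonneg (hpos s hs).le (Real.exp_pos _).le)]
    exact mul_le_of_le_one_right (hpos s hs).le (Real.exp_le_one_iff.2 (by nlinarith))
  have e1 : ∫ s in Ioi ε, c⁻¹ * s ^ (-1 - a) * Real.exp (-(l * s))
      = c⁻¹ * ∫ s in Ioi ε, s ^ (-1 - a) * Real.exp (-(l * s)) := by
    rw [← integral_const_mul]
    simp only [mul_assoc]
  have e2 : ∫ s in Ioi ε, (1 - Real.exp (-(l * s))) * s ^ (-1 - a)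
      = c - ∫ s in Ioi ε, s ^ (-1 - a) * Real.exp (-(l * s)) := by
    rw [hc, ← integral_sub hint hint']
    congr 1
    funext s
    ring
  simp only [e1, e2]
  congr 2
  field_simp

/-- As the truncation `1/(n+1)` tends to `0`, the truncated integrals converge to `K l^a`, and the
factor `K⁻¹` normalizes the exponent. -/
theorem isUnitLaplace_stable {a : ℝ} (ha0 : 0 < a) (ha1 : a < 1) :
    IsUnitLaplace fun l => Real.exp (-(l ^ a)) := by
  set K := ∫ s in Ioi (0 : ℝ), (1 - Real.exp (-(1 * s))) * s ^ (-1 - a) with hK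
  have hK0 : 0 < K := integral_stable_levy_pos ha0 ha1
  refine IsUnitLaplace.of_tendsto (φ := fun n l => Real.exp (-(K⁻¹ *
      ∫ s in Ioi (1 / ((n : ℝ) + 1)), (1 - Real.exp (-(l * s))) * s ^ (-1 - a))))
    (Eventually.of_forall fun n => isUnitLaplace_truncated_stable ha0
      Nat.one_div_pos_of_nat (inv_nonneg.2 hK0.le)) fun l hl => ?_
  have hU : ⋃ n : ℕ, Ioi (1 / ((n : ℝ) + 1)) = Ioi 0 := by
    ext s
    simp only [mem_iUnion, mem_Ioi]
    exact ⟨fun ⟨n, hn⟩ => Nat.one_div_pos_of_nat.trans hn, fun hs => exists_nat_one_div_lt hs⟩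
  have h := tendsto_setIntegral_of_monotone (μ := volume)
    (f := fun s : ℝ => (1 - Real.exp (-(l * s))) * s ^ (-1 - a))
    (s := fun n : ℕ => Ioi (1 / ((n : ℝ) + 1))) (fun _ => measurableSet_Ioi)
    (fun m n hmn => Ioi_subset_Ioi (Nat.one_div_le_one_div hmn))
    (by rw [hU]; exact integrableOn_stable_levy ha0 ha1 hl)
  rw [hU, integral_stable_levy hl, ← hK] at h
  have h2 := ((h.const_mul K⁻¹).neg).rexp
  convert h2 using 4
  field_simp

/-- There is a probability measure on `[0, ∞)` with Laplace transform `e^{-l^a}`. -/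
theorem exists_stable_law {a : ℝ} (ha0 : 0 < a) (ha1 : a < 1) :
    ∃ m : Measure ℝ≥0, IsProbabilityMeasure m ∧ ∀ l : ℝ, 0 < l →
      ∫ s : ℝ≥0, Real.exp (-(l * (s : ℝ))) ∂m = Real.exp (-(l ^ a)) := by
  obtain ⟨m, hm⟩ := isUnitLaplace_stable ha0 ha1
  -- The complement of `S` is the point `x = 0`, that is, `s = ∞`. It has no mass: `x^l` vanishes
  -- there, so `e^{-l^a} ≤ m(S)` for all `l > 0`, and `l → 0` gives `m(S) ≥ 1`.
  set S : Set unitInterval := {x | (0 : ℝ) < x} with hS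
  have hSm : MeasurableSet S := measurableSet_lt measurable_const measurable_subtype_coe
  have hr : ∀ l : ℝ, 0 < l → ∫ x in S, (x : ℝ) ^ l ∂(m : Measure unitInterval)
      = Real.exp (-(l ^ a)) := fun l hl => by
    refine Eq.trans ?_ (hm l hl)
    refine setIntegral_eq_integral_of_forall_compl_eq_zero fun x hx => ?_
    have : (x : ℝ) = 0 := le_antisymm (not_lt.1 hx) x.2.1
    rw [this, Real.zero_rpow hl.ne']
  have hle : ∀ l : ℝ, 0 < l → Real.exp (-(l ^ a)) ≤ (m : Measure unitInterval).real S :=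
    fun l hl => by
      rw [← hr l hl]
      calc _ ≤ ∫ _ in S, (1 : ℝ) ∂(m : Measure unitInterval) :=
            integral_mono (integrable_unitInterval_rpow _ hl) (integrable_const _)
              fun x => (unitInterval_rpow_mem hl x).2
        _ = _ := by simp
  have h1 : 1 ≤ (m : Measure unitInterval).real S := by
    have ht : Tendsto (fun l : ℝ => Real.exp (-(l ^ a))) (𝓝[>] 0) (𝓝 1) := by
      have hc : Continuous fun l : ℝ => Real.exp (-(l ^ a)) :=
        Real.continuous_exp.comp (continuous_id.rpow_const fun _ => Or.inr ha0.le).neg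
      have := (hc.tendsto 0).mono_left (nhdsWithin_le_nhds (s := Ioi 0))
      simpa [Real.zero_rpow ha0.ne'] using this
    refine le_of_tendsto ht ?_
    filter_upwards [self_mem_nhdsWithin] with l hl using hle l hl
  let g : unitInterval → ℝ≥0 := fun x => (-Real.log x).toNNReal
  have hg : Measurable g := by
    have : Measurable fun x : unitInterval => -Real.log x :=
      (Real.measurable_log.comp measurable_subtype_coe).neg
    exact this.real_toNNReal
  refine ⟨((m : Measure unitInterval).restrict S).map g, ⟨?_⟩, fun l hl => ?_⟩
  · rw [Measure.map_apply hg MeasurableSet.univ, preimage_univ, Measure.restrict_apply_univ]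
    refine le_antisymm prob_le_one ?_
    rw [← ENNReal.ofReal_one]
    exact ENNReal.ofReal_le_of_le_toReal h1
  · rw [integral_map hg.aemeasurable (continuous_exp_neg_mul_coe l).aestronglyMeasurable,
      ← hr l hl]
    refine setIntegral_congr_fun hSm fun x hx => ?_
    have hx0 : (0 : ℝ) < x := hx
    simp only [g]
    rw [Real.coe_toNNReal _ (neg_nonneg.2 (Real.log_nonpos x.2.1 x.2.2)),
      Real.rpow_def_of_pos hx0]
    ring_nf

theorem integral_exp_conv (m m' : Measure ℝ≥0) [IsFiniteMeasure m] [IsFiniteMeasure m'] {l : ℝ}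
    (hl : 0 ≤ l) : ∫ s : ℝ≥0, Real.exp (-(l * (s : ℝ))) ∂(m.conv m')
      = (∫ s : ℝ≥0, Real.exp (-(l * (s : ℝ))) ∂m) * ∫ s : ℝ≥0, Real.exp (-(l * (s : ℝ))) ∂m' := by
  rw [integral_conv (integrable_exp_neg_mul_coe _ hl), ← integral_mul_const]
  refine integral_congr_ae (Eventually.of_forall fun x => ?_)
  simp only
  rw [← integral_const_mul]
  refine integral_congr_ae (Eventually.of_forall fun y => ?_)
  simp only
  rw [← Real.exp_add, NNReal.coe_add]
  ring_nf

/-- Exponentially tilted stable subordinators. -/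
theorem exists_tilted_stable {a : ℝ} (ha0 : 0 < a) (ha1 : a < 1) {c : ℝ} (hc : 0 ≤ c) :
    ∃ ν : ConvolutionSemigroup, ν.HasLaplaceExponent fun l => (l + c) ^ a - c ^ a := by
  obtain ⟨m, hmp, hm⟩ := exists_stable_law ha0 ha1
  -- By self-similarity, scaling by `t^(1/a)` turns the exponent `l^a` into `t l^a`. The density
  -- `e^{t c^a - c s}` then replaces `l` by `l + c` and subtracts `c^a`.
  let σ : ℝ≥0 → ℝ≥0 → ℝ≥0 := fun t s => t ^ a⁻¹ * s
  have hσ : ∀ t, Measurable (σ t) := fun t => measurable_const_mul _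
  let ν : ℝ≥0 → Measure ℝ≥0 := fun t => (m.map (σ t)).withDensity fun s =>
    ((Real.exp (t * c ^ a - c * s)).toNNReal : ℝ≥0∞)
  have hint : ∀ (t : ℝ≥0) (φ : ℝ≥0 → ℝ), Continuous φ → ∫ s, φ s ∂(ν t)
      = ∫ s, Real.exp (t * c ^ a - c * (σ t s : ℝ)) * φ (σ t s) ∂m := fun t φ hφ => by
    have h1 : Measurable fun s : ℝ≥0 => Real.exp (t * c ^ a - c * s) := by fun_prop
    have h2 : Continuous fun s : ℝ≥0 => Real.exp (t * c ^ a - c * s) * φ s := by fun_prop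
    simp only [ν]
    rw [integral_withDensity_eq_integral_smul h1.real_toNNReal,
      ← integral_map (hσ t).aemeasurable h2.aestronglyMeasurable]
    refine integral_congr_ae (Eventually.of_forall fun s => ?_)
    simp only [NNReal.smul_def, smul_eq_mul]
    rw [Real.coe_toNNReal _ (Real.exp_pos _).le]
  have hfin : ∀ t, IsFiniteMeasure (ν t) := fun t => by
    have : IsProbabilityMeasure (m.map (σ t)) := Measure.isProbabilityMeasure_map (hσ t).aemeasurable
    refine isFiniteMeasure_withDensity (ne_of_lt ?_)
    refine lt_of_le_of_lt (lintegral_mono (g := fun _ => ENNReal.ofReal (Real.exp (t * c ^ a)))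
      fun s => ?_) (by simp)
    refine ENNReal.ofReal_le_ofReal (Real.exp_le_exp.2 ?_)
    have : 0 ≤ c * s := mul_nonneg hc s.2
    linarith
  have hlap : ∀ (t : ℝ≥0) (l : ℝ), 0 < l → ∫ s : ℝ≥0, Real.exp (-(l * (s : ℝ))) ∂(ν t)
      = Real.exp (-((t : ℝ) * ((l + c) ^ a - c ^ a))) := fun t l hl => by
    rw [hint t _ (continuous_exp_neg_mul_coe l)]
    have e : ∀ s, Real.exp (t * c ^ a - c * (σ t s : ℝ)) * Real.exp (-(l * (σ t s : ℝ)))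
        = Real.exp (t * c ^ a) * Real.exp (-(((l + c) * (t : ℝ) ^ a⁻¹) * (s : ℝ))) := fun s => by
      rw [← Real.exp_add, ← Real.exp_add]
      simp only [σ, NNReal.coe_mul, NNReal.coe_rpow]
      ring_nf
    simp only [e]
    rw [integral_const_mul]
    rcases eq_or_ne t 0 with rfl | ht
    · simp [Real.zero_rpow (inv_ne_zero ha0.ne')]
    · have ht0 : (0 : ℝ) < t := by exact_mod_cast pos_iff_ne_zero.2 ht
      rw [hm _ (mul_pos (by linarith) (Real.rpow_pos_of_pos ht0 _)), ← Real.exp_add,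
        Real.mul_rpow (by linarith) (Real.rpow_nonneg ht0.le _), ← Real.rpow_mul ht0.le,
        inv_mul_cancel₀ ha0.ne', Real.rpow_one]
      ring_nf
  have hmass : ∀ t, ν t univ ≤ 1 := fun t => by
    have h1 : (ν t).real univ ≤ 1 := by
      refine le_of_tendsto (tendsto_integral_exp_neg_mul_coe (ν t)) ?_
      filter_upwards [self_mem_nhdsWithin] with l hl
      have hl0 : (0 : ℝ) < l := hl
      rw [hlap t l hl0]
      have := Real.rpow_le_rpow hc (by linarith : c ≤ l + c) ha0.le
      exact Real.exp_le_one_iff.2 (neg_nonpos.2 (mul_nonneg t.2 (by linarith)))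
    rw [← ENNReal.ofReal_one]
    exact (ENNReal.le_ofReal_iff_toReal_le (measure_ne_top _ _) zero_le_one).2 h1
  refine ⟨⟨ν, hmass, ?_, fun s t => ?_, fun φ hφ hs => ?_⟩, fun t l hl => hlap t l hl⟩
  · exact ext_of_laplace fun l hl => by
      rw [hlap 0 l hl, integral_dirac]
      simp
  · exact ext_of_laplace fun l hl => by
      rw [hlap _ l hl, integral_exp_conv _ _ hl.le, hlap _ l hl, hlap _ l hl, ← Real.exp_add,
        NNReal.coe_add]
      ring_nf
  -- Vague continuity: all `ν t` are expressed through the one law `m`, and `σ t s → 0` for each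
  -- `s`, so dominated convergence applies; restricting to `t < 1` bounds the density by `e^{c^a}`.
  · obtain ⟨M, hM⟩ := hs.exists_bound_of_continuous hφ
    simp only [hint _ φ hφ]
    have hσ0 : ∀ s, σ 0 s = 0 := fun s => by
      simp [σ, NNReal.zero_rpow (inv_ne_zero ha0.ne')]
    have hσc : ∀ s, Continuous fun t => σ t s := fun s =>
      (NNReal.continuous_rpow_const (inv_nonneg.2 ha0.le)).mul continuous_const
    have e : φ 0 = ∫ s, φ 0 ∂m := by simp
    rw [e]
    refine tendsto_integral_filter_of_dominated_convergence
      (fun _ => Real.exp (c ^ a) * M) ?_ ?_ (integrable_const _) ?_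
    · refine Eventually.of_forall fun t => ?_
      have h2 : Continuous fun s : ℝ≥0 => Real.exp (t * c ^ a - c * s) * φ s := by fun_prop
      exact (h2.measurable.comp (hσ t)).aestronglyMeasurable
    · filter_upwards [gt_mem_nhds (zero_lt_one (α := ℝ≥0))] with t ht
      refine Eventually.of_forall fun s => ?_
      rw [norm_mul, Real.norm_of_nonneg (Real.exp_pos _).le]
      have ht1 : (t : ℝ) ≤ 1 := by exact_mod_cast ht.le
      have h0 := Real.rpow_nonneg hc a
      have h1 : 0 ≤ c * (σ t s : ℝ) := mul_nonneg hc (σ t s).2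
      gcongr
      · nlinarith
      · exact hM _
    · refine Eventually.of_forall fun s => ?_
      have h2 : Continuous fun t : ℝ≥0 => Real.exp (t * c ^ a - c * (σ t s : ℝ)) * φ (σ t s) := by
        have := hσc s
        fun_prop
      have := h2.tendsto 0
      simpa [hσ0] using this

/-! ### Negative moments of subordinators -/

/-- Write `s^(-γ)` as `Γ(γ)⁻¹` times the integral of `l^(γ-1) e^{-ls}` over `l > 0` and exchange
integrals; what remains is dominated by `e^t` times the convergent integral of `l^(γ-1) e^{-t l^a}`.
The `-1` in the hypothesis leaves room for tilted exponents. -/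
theorem lintegral_rpow_neg_lt_top {m : Measure ℝ≥0} [IsFiniteMeasure m] {t a γ : ℝ} (ht : 0 < t)
    (ha : 0 < a) (hγ : 0 < γ) (h : ∀ l : ℝ, 0 < l →
      ∫ s : ℝ≥0, Real.exp (-(l * (s : ℝ))) ∂m ≤ Real.exp (-(t * (l ^ a - 1)))) :
    ∫⁻ s : ℝ≥0, (s : ℝ≥0∞) ^ (-γ) ∂m < ⊤ := by
  -- In `ℝ≥0∞`, `0^(-γ) = ∞`, so an atom at `0` must be excluded. It is bounded by the Laplace
  -- transform at every `l`, which tends to `0` as `l → ∞`.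
  have hm0 : m {0} = 0 := by
    have h1 : ∀ l : ℝ, 0 < l → m.real {0} ≤ Real.exp (-(t * (l ^ a - 1))) := fun l hl => by
      refine le_trans ?_ (h l hl)
      have := setIntegral_le_integral (s := {(0 : ℝ≥0)}) (integrable_exp_neg_mul_coe m hl.le)
        (Eventually.of_forall fun s => (Real.exp_pos _).le)
      simpa [measureReal_def] using this
    have h2 : Tendsto (fun l : ℝ => Real.exp (-(t * (l ^ a - 1)))) atTop (𝓝 0) := by
      refine Real.tendsto_exp_neg_atTop_nhds_zero.comp (Tendsto.const_mul_atTop ht ?_)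
      exact tendsto_atTop_add_const_right _ _ (tendsto_rpow_atTop ha)
    have h3 : m.real {0} ≤ 0 := by
      refine ge_of_tendsto h2 ?_
      filter_upwards [eventually_gt_atTop 0] with l hl using h1 l hl
    have h4 : m.real {0} = 0 := le_antisymm h3 measureReal_nonneg
    exact (measureReal_eq_zero_iff (measure_ne_top _ _)).1 h4
  have hΓ : 0 < Real.Gamma γ := Real.Gamma_pos_of_pos hγ
  have key : ∀ s : ℝ≥0, s ≠ 0 → (s : ℝ≥0∞) ^ (-γ) = ENNReal.ofReal (Real.Gamma γ)⁻¹ *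
      ∫⁻ l in Ioi (0 : ℝ), ENNReal.ofReal (l ^ (γ - 1) * Real.exp (-(l * (s : ℝ)))) := fun s hs => by
    have hs0 : (0 : ℝ) < s := by exact_mod_cast pos_iff_ne_zero.2 hs
    have e1 := Real.integral_rpow_mul_exp_neg_mul_Ioi hγ hs0
    have e2 : ∀ l : ℝ, l ^ (γ - 1) * Real.exp (-(s * l)) = l ^ (γ - 1) * Real.exp (-(l * s)) :=
      fun l => by rw [mul_comm l (s : ℝ)]
    simp only [e2] at e1
    -- A non-integrable function would have integral `0` by convention, against the positive value
    -- just found. The same device is used below for `e3`.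
    have hi : Integrable (fun l : ℝ => l ^ (γ - 1) * Real.exp (-(l * s)))
        (volume.restrict (Ioi 0)) := by
      by_contra hcon
      rw [integral_undef hcon] at e1
      have : 0 < (1 / (s : ℝ)) ^ γ * Real.Gamma γ :=
        mul_pos (Real.rpow_pos_of_pos (by positivity) _) hΓ
      linarith
    rw [← ofReal_integral_eq_lintegral_ofReal hi, e1, ← ENNReal.ofReal_mul (inv_nonneg.2 hΓ.le)]
    · rw [← ENNReal.coe_rpow_of_ne_zero hs, ← ENNReal.ofReal_coe_nnreal, NNReal.coe_rpow]
      congr 1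
      rw [one_div, Real.inv_rpow hs0.le, Real.rpow_neg hs0.le]
      field_simp
    · filter_upwards [ae_restrict_mem measurableSet_Ioi] with l hl
      exact mul_nonneg (Real.rpow_nonneg (le_of_lt hl) _) (Real.exp_pos _).le
  have hae : ∀ᵐ s ∂m, s ≠ 0 := by
    rw [ae_iff]
    simpa using hm0
  have hmeas : Measurable fun p : ℝ≥0 × ℝ =>
      ENNReal.ofReal (p.2 ^ (γ - 1) * Real.exp (-(p.2 * (p.1 : ℝ)))) := by fun_prop
  rw [lintegral_congr_ae (hae.mono fun s hs => key s hs), lintegral_const_mul' _ _ ENNReal.ofReal_ne_top,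
    lintegral_lintegral_swap hmeas.aemeasurable]
  refine ENNReal.mul_lt_top ENNReal.ofReal_lt_top ?_
  have e3 := integral_rpow_mul_exp_neg_mul_rpow ha (by linarith : -1 < γ - 1) ht
  have hi : Integrable (fun l : ℝ => l ^ (γ - 1) * Real.exp (-t * l ^ a))
      (volume.restrict (Ioi 0)) := by
    by_contra hcon
    rw [integral_undef hcon] at e3
    have : 0 < t ^ (-(γ - 1 + 1) / a) * (1 / a) * Real.Gamma ((γ - 1 + 1) / a) := by
      have : 0 < Real.Gamma ((γ - 1 + 1) / a) := Real.Gamma_pos_of_pos (by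
        rw [sub_add_cancel]
        positivity)
      positivity
    linarith
  refine lt_of_le_of_lt ?_ (hi.const_mul (Real.exp t)).lintegral_lt_top
  refine lintegral_mono_ae ?_
  filter_upwards [ae_restrict_mem measurableSet_Ioi] with l hl
  have hl0 : (0 : ℝ) < l := hl
  have hp : 0 ≤ l ^ (γ - 1) := Real.rpow_nonneg hl0.le _
  rw [← ofReal_integral_eq_lintegral_ofReal ((integrable_exp_neg_mul_coe m hl0.le).const_mul _)
    (Eventually.of_forall fun s => mul_nonneg hp (Real.exp_pos _).le), integral_const_mul]
  refine ENNReal.ofReal_le_ofReal ?_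
  calc _ ≤ l ^ (γ - 1) * Real.exp (-(t * (l ^ a - 1))) := mul_le_mul_of_nonneg_left (h l hl0) hp
    _ = l ^ (γ - 1) * (Real.exp t * Real.exp (-t * l ^ a)) := by
        rw [← Real.exp_add]
        ring_nf
    _ = _ := by ring

/-! ### Generators of contraction semigroups on Hilbert spaces -/

section Generator

variable {H : Type*} [NormedAddCommGroup H] [InnerProductSpace ℝ H]

/-- `(u, h)` is in the graph of the generator of `P`. -/
def ContractionSemigroup.HasGenerator (P : ContractionSemigroup H) (u h : H) : Prop :=
  Tendsto (fun t : ℝ≥0 => (t : ℝ)⁻¹ • (P.toFun t u - u)) (𝓝[>] 0) (𝓝 h)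

instance : (𝓝[>] (0 : ℝ≥0)).NeBot := nhdsGT_neBot 0

theorem ContractionSemigroup.HasGenerator.sub {P : ContractionSemigroup H} {u h v k : H}
    (hu : P.HasGenerator u h) (hv : P.HasGenerator v k) : P.HasGenerator (u - v) (h - k) := by
  refine (Tendsto.sub hu hv).congr fun t => ?_
  rw [← smul_sub, map_sub]
  congr 1
  abel

theorem ContractionSemigroup.HasGenerator.apply {P : ContractionSemigroup H} {u h : H}
    (hu : P.HasGenerator u h) (s : ℝ≥0) : P.HasGenerator (P.toFun s u) (P.toFun s h) := by
  refine (((P.toFun s).continuous.tendsto h).comp hu).congr fun t => ?_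
  simp only [Function.comp_apply]
  rw [map_smul, map_sub, ← ContinuousLinearMap.comp_apply, ← P.map_add', add_comm, P.map_add',
    ContinuousLinearMap.comp_apply]

/-- Dissipativity: `⟨u, P_t u⟩ ≤ ‖u‖²` for a contraction, and division by `t` preserves the sign. -/
theorem ContractionSemigroup.HasGenerator.inner_nonpos {P : ContractionSemigroup H} {u h : H}
    (hu : P.HasGenerator u h) : inner ℝ u h ≤ 0 := by
  refine le_of_tendsto' (Tendsto.inner tendsto_const_nhds hu) fun t => ?_
  rw [inner_smul_right, inner_sub_right, real_inner_self_eq_norm_sq]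
  refine mul_nonpos_of_nonneg_of_nonpos (inv_nonneg.2 t.2) ?_
  have h1 := real_inner_le_norm u (P.toFun t u)
  have h2 := P.norm_apply_le t u
  nlinarith [norm_nonneg u]

/-- The right derivative follows at once from `P_r = P_s P_{r-s}`, and it is all that the comparison
theorem for functions on an interval requires. -/
theorem ContractionSemigroup.HasGenerator.hasDerivWithinAt {P : ContractionSemigroup H} {u h : H}
    (hu : P.HasGenerator u h) {s : ℝ} (hs : 0 ≤ s) :
    HasDerivWithinAt (fun r : ℝ => P.toFun r.toNNReal u) (P.toFun s.toNNReal h) (Ici s) s := by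
  rw [← hasDerivWithinAt_Ioi_iff_Ici, hasDerivWithinAt_iff_tendsto_slope' self_notMem_Ioi]
  have hm : Tendsto (fun r : ℝ => (r - s).toNNReal) (𝓝[>] s) (𝓝[>] 0) := by
    refine tendsto_nhdsWithin_iff.2 ⟨?_, ?_⟩
    · have hc : Continuous fun r : ℝ => (r - s).toNNReal := by fun_prop
      simpa using (hc.tendsto s).mono_left nhdsWithin_le_nhds
    · filter_upwards [self_mem_nhdsWithin] with r hr
      exact Real.toNNReal_pos.2 (sub_pos.2 hr)
  refine (((P.toFun s.toNNReal).continuous.tendsto h).comp (Tendsto.comp hu hm)).congr' ?_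
  filter_upwards [self_mem_nhdsWithin] with r hr
  have hrs : 0 ≤ r - s := sub_nonneg.2 (le_of_lt hr)
  simp only [Function.comp_apply]
  have e : r.toNNReal = s.toNNReal + (r - s).toNNReal := by
    rw [← Real.toNNReal_add hs hrs]
    congr 1
    ring
  rw [map_smul, map_sub, ← ContinuousLinearMap.comp_apply, ← P.map_add', ← e, slope_def_module,
    Real.coe_toNNReal _ hrs]

theorem ContractionSemigroup.continuous_real (P : ContractionSemigroup H) (u : H) :
    Continuous fun r : ℝ => P.toFun r.toNNReal u :=
  (P.continuous' u).comp continuous_real_toNNReal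

theorem ContractionSemigroup.HasGenerator.hasDerivWithinAt_norm_sq {P : ContractionSemigroup H}
    {u h : H} (hu : P.HasGenerator u h) {s : ℝ} (hs : 0 ≤ s) :
    HasDerivWithinAt (fun r : ℝ => ‖P.toFun r.toNNReal u‖ ^ 2)
      (2 * inner ℝ (P.toFun s.toNNReal u) (P.toFun s.toNNReal h)) (Ici s) s :=
  (hu.hasDerivWithinAt hs).norm_sq

/-- A contraction semigroup is determined by its generator. -/
theorem ContractionSemigroup.eq_of_hasGenerator_iff {P Q : ContractionSemigroup H}
    (h : ∀ u k, P.HasGenerator u k ↔ Q.HasGenerator u k)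
    (hd : Dense {u | ∃ k, P.HasGenerator u k}) : P = Q := by
  have key : ∀ u k, P.HasGenerator u k → ∀ t, P.toFun t u = Q.toFun t u := by
    intro u k hu t
    -- The difference of the two orbits starts at `0` and solves `w' = A w` for the common
    -- generator, so by dissipativity `‖w‖²` cannot increase.
    let w : ℝ → H := fun r => P.toFun r.toNNReal u - Q.toFun r.toNNReal u
    have hw : ∀ s : ℝ, 0 ≤ s → HasDerivWithinAt w
        (P.toFun s.toNNReal k - Q.toFun s.toNNReal k) (Ici s) s := fun s hs =>
      (hu.hasDerivWithinAt hs).sub (((h u k).1 hu).hasDerivWithinAt hs)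
    have hwc : Continuous w := (P.continuous_real u).sub (Q.continuous_real u)
    have hle := image_le_of_deriv_right_le_deriv_boundary (f := fun r => ‖w r‖ ^ 2)
      (f' := fun s => 2 * inner ℝ (w s) (P.toFun s.toNNReal k - Q.toFun s.toNNReal k))
      (B := fun _ => 0) (B' := fun _ => 0) (a := 0) (b := (t : ℝ))
      (hwc.norm.pow 2).continuousOn (fun s hs => (hw s hs.1).norm_sq)
      (by simp [w, P.map_zero', Q.map_zero']) continuousOn_const
      (fun s _ => hasDerivWithinAt_const _ _ _)
      (fun s hs => by
        have h1 : P.HasGenerator (w s) (P.toFun s.toNNReal k - Q.toFun s.toNNReal k) :=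
          (hu.apply _).sub ((h _ _).2 (((h u k).1 hu).apply _))
        have := h1.inner_nonpos
        linarith) (right_mem_Icc.2 t.2)
    have h0 : ‖w t‖ = 0 := by
      have := sq_nonneg ‖w t‖
      exact pow_eq_zero_iff two_ne_zero |>.1 (le_antisymm hle this)
    have := norm_eq_zero.1 h0
    simp only [w, Real.toNNReal_coe] at this
    exact sub_eq_zero.1 this
  apply ContractionSemigroup.ext
  funext t
  exact ContinuousLinearMap.ext fun u => congrFun (Continuous.ext_on hd (P.toFun t).continuous
    (Q.toFun t).continuous fun u ⟨k, hk⟩ => key u k hk t) u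

end Generator

/-! ### The Hille-Yosida theorem -/

/-- `J b = b (b - A)⁻¹` are the normalized resolvents of the densely defined relation `A`. -/
structure IsResolventFamily {H : Type*} [NormedAddCommGroup H] [InnerProductSpace ℝ H]
    (A : H → H → Prop) (J : ℝ → H →L[ℝ] H) : Prop where
  norm_le : ∀ b, 0 < b → ‖J b‖ ≤ 1
  rel_iff : ∀ b, 0 < b → ∀ u h, A u h ↔ J b (u - b⁻¹ • h) = u
  dense : Dense {u | ∃ h, A u h}

section HilleYosida

variable {H : Type*} [NormedAddCommGroup H] [InnerProductSpace ℝ H]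
  {A : H → H → Prop} {J : ℝ → H →L[ℝ] H}

theorem continuous_of_tendsto_zero {T : ℝ≥0 → H →L[ℝ] H} (hn : ∀ t, ‖T t‖ ≤ 1)
    (hadd : ∀ s t, T (s + t) = (T s).comp (T t)) (u : H)
    (h0 : Tendsto (fun t => T t u) (𝓝 0) (𝓝 u)) : Continuous fun t => T t u := by
  have key : ∀ a b : ℝ≥0, ‖T (a + b) u - T a u‖ ≤ ‖T b u - u‖ := fun a b => by
    rw [hadd, ContinuousLinearMap.comp_apply, ← map_sub]
    simpa using (T a).le_of_opNorm_le (hn a) (T b u - u)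
  rw [continuous_iff_continuousAt]
  intro t₀
  rw [ContinuousAt, tendsto_iff_norm_sub_tendsto_zero]
  -- With truncated subtraction this sum is `|t - t₀|`.
  have h1 : Tendsto (fun t : ℝ≥0 => (t - t₀) + (t₀ - t)) (𝓝 t₀) (𝓝 0) := by
    have : Continuous fun t : ℝ≥0 => (t - t₀) + (t₀ - t) := by fun_prop
    simpa using this.tendsto t₀
  have h2 := (tendsto_iff_norm_sub_tendsto_zero.1 h0).comp h1
  refine squeeze_zero (fun _ => norm_nonneg _) (fun t => ?_) h2
  simp only [Function.comp_apply]
  rcases le_total t₀ t with h | h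
  · have := key t₀ (t - t₀)
    rw [add_tsub_cancel_of_le h] at this
    rwa [tsub_eq_zero_of_le h, add_zero]
  · have := key t (t₀ - t)
    rw [add_tsub_cancel_of_le h, norm_sub_rev] at this
    rwa [tsub_eq_zero_of_le h, zero_add]

/-- The Yosida approximation `n (J_n - 1)`, at `n + 1`. -/
noncomputable def yosida (J : ℝ → H →L[ℝ] H) (n : ℕ) : H →L[ℝ] H :=
  ((n : ℝ) + 1) • (J ((n : ℝ) + 1) - 1)

namespace IsResolventFamily

variable (hA : IsResolventFamily A J)

include hA

theorem rel_apply {b : ℝ} (hb : 0 < b) (F : H) : A (J b F) (b • (J b F - F)) := by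
  rw [hA.rel_iff b hb, smul_smul, inv_mul_cancel₀ hb.ne', one_smul, sub_sub_cancel]

theorem apply_of_rel {b : ℝ} (hb : 0 < b) {u h : H} (hu : A u h) : J b h = b • (J b u - u) := by
  have h1 := (hA.rel_iff b hb u h).1 hu
  rw [map_sub, map_smul] at h1
  have h2 : J b u - u = b⁻¹ • J b h := by
    rw [sub_eq_iff_eq_add, add_comm]
    exact sub_eq_iff_eq_add.1 h1
  rw [h2, smul_smul, mul_inv_cancel₀ hb.ne', one_smul]

theorem norm_apply_le {b : ℝ} (hb : 0 < b) (u : H) : ‖J b u‖ ≤ ‖u‖ := by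
  simpa using (J b).le_of_opNorm_le (hA.norm_le b hb) u

/-- Use `J_b A u = b (J_b u - u)` at `u = J_c F`, and the same with `b` and `c` exchanged; the sum
of the two identities is `(c - b)(J_b J_c - J_c J_b) F = 0`. -/
theorem commute {b c : ℝ} (hb : 0 < b) (hc : 0 < c) : Commute (J b) (J c) := by
  rcases eq_or_ne b c with rfl | hbc
  · exact Commute.refl _
  refine ContinuousLinearMap.ext fun F => ?_
  have h1 := hA.apply_of_rel hb (hA.rel_apply hc F)
  have h2 := hA.apply_of_rel hc (hA.rel_apply hb F)
  simp only [map_smul, map_sub] at h1 h2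
  simp only [mul_apply_eq_comp]
  have h3 : (c - b) • (J b (J c F) - J c (J b F)) = 0 := by
    linear_combination (norm := module) h1 + h2
  rcases smul_eq_zero.1 h3 with h | h
  · exact absurd (sub_eq_zero.1 h).symm hbc
  · exact sub_eq_zero.1 h

/-- On the domain, `J_b u - u = b⁻¹ J_b A u` is of order `1/b`; density and `‖J_b‖ ≤ 1` extend the
convergence. -/
theorem tendsto_apply (F : H) : Tendsto (fun n : ℕ => J ((n : ℝ) + 1) F) atTop (𝓝 F) := by
  have hpos : ∀ n : ℕ, (0 : ℝ) < (n : ℝ) + 1 := fun n => by positivity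
  rw [Metric.tendsto_nhds]
  intro ε hε
  obtain ⟨u, huF, h, hu⟩ := Metric.dense_iff.1 hA.dense F (ε / 3) (by positivity)
  have hl : Tendsto (fun n : ℕ => ‖h‖ * (1 / ((n : ℝ) + 1))) atTop (𝓝 0) := by
    simpa using tendsto_one_div_add_atTop_nhds_zero_nat.const_mul ‖h‖
  filter_upwards [hl.eventually (gt_mem_nhds (show (0 : ℝ) < ε / 3 by positivity))] with n hn
  have h1 : ‖J ((n : ℝ) + 1) u - u‖ ≤ ‖h‖ * (1 / ((n : ℝ) + 1)) := by
    have h2 := hA.norm_apply_le (hpos n) h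
    rw [hA.apply_of_rel (hpos n) hu, norm_smul, Real.norm_of_nonneg (hpos n).le] at h2
    rw [mul_one_div, le_div_iff₀ (hpos n), mul_comm]
    exact h2
  have h3 : ‖u - F‖ < ε / 3 := by simpa [dist_eq_norm] using huF
  have h4 := hA.norm_apply_le (hpos n) (F - u)
  rw [norm_sub_rev F u, map_sub] at h4
  rw [dist_eq_norm]
  calc ‖J ((n : ℝ) + 1) F - F‖ = ‖(J ((n : ℝ) + 1) F - J ((n : ℝ) + 1) u)
        + (J ((n : ℝ) + 1) u - u) + (u - F)‖ := by congr 1; abel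
    _ ≤ _ := norm_add₃_le
    _ < ε := by linarith

theorem commute_yosida (n m : ℕ) : Commute (yosida J n) (yosida J m) := by
  have h := hA.commute (b := (n : ℝ) + 1) (c := (m : ℝ) + 1) (by positivity) (by positivity)
  refine Commute.smul_left (Commute.smul_right ?_ _) _
  exact (h.sub_left (Commute.one_left _)).sub_right ((Commute.one_right _))

theorem yosida_apply {u h : H} (hu : A u h) (n : ℕ) : yosida J n u = J ((n : ℝ) + 1) h := by
  rw [hA.apply_of_rel (by positivity) hu]
  simp [yosida]

end IsResolventFamily

variable [CompleteSpace H]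

theorem exp_add_of_commute_clm {B C : H →L[ℝ] H} (h : Commute B C) :
    NormedSpace.exp (B + C) = NormedSpace.exp B * NormedSpace.exp C :=
  letI := NormedAlgebra.restrictScalars ℚ ℝ (H →L[ℝ] H)
  NormedSpace.exp_add_of_commute h

theorem continuous_exp_smul_clm (B : H →L[ℝ] H) :
    Continuous fun s : ℝ => NormedSpace.exp (s • B) :=
  letI := NormedAlgebra.restrictScalars ℚ ℝ (H →L[ℝ] H)
  NormedSpace.exp_continuous.comp (continuous_id.smul continuous_const)

theorem norm_exp_smul_clm_le {T : H →L[ℝ] H} (hT : ‖T‖ ≤ 1) {c : ℝ} (hc : 0 ≤ c) :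
    ‖NormedSpace.exp (c • T)‖ ≤ Real.exp c := by
  have h1 : HasSum (fun n : ℕ => ((n.factorial : ℝ))⁻¹ • (c • T) ^ n) (NormedSpace.exp (c • T)) :=
    NormedSpace.exp_series_hasSum_exp' (𝕂 := ℝ) _
  have h2 : HasSum (fun n : ℕ => ((n.factorial : ℝ))⁻¹ • c ^ n) (Real.exp c) := by
    rw [Real.exp_eq_exp_ℝ]
    exact NormedSpace.exp_series_hasSum_exp' (𝕂 := ℝ) _
  refine h1.norm_le_of_bounded h2 fun n => ?_
  have h3 : ‖T ^ n‖ ≤ 1 := by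
    rcases Nat.eq_zero_or_pos n with rfl | hn
    · rw [pow_zero]
      exact ContinuousLinearMap.norm_id_le
    · exact (norm_pow_le' T hn).trans (pow_le_one₀ (norm_nonneg _) hT)
  have h4 : (0 : ℝ) ≤ ((n.factorial : ℝ))⁻¹ := by positivity
  rw [smul_pow, norm_smul, norm_smul, Real.norm_of_nonneg h4, Real.norm_of_nonneg (pow_nonneg hc n)]
  exact mul_le_mul_of_nonneg_left (mul_le_of_le_one_right (pow_nonneg hc n) h3) h4

theorem exp_smul_sub_one (T : H →L[ℝ] H) (c : ℝ) :
    NormedSpace.exp (c • (T - 1)) = Real.exp (-c) • NormedSpace.exp (c • T) := by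
  have e : c • (T - 1) = c • T + (-c) • (1 : H →L[ℝ] H) := by
    rw [smul_sub, sub_eq_add_neg, neg_smul]
  have e2 : NormedSpace.exp ((-c) • (1 : H →L[ℝ] H)) = Real.exp (-c) • (1 : H →L[ℝ] H) := by
    rw [← Algebra.algebraMap_eq_smul_one, ← Algebra.algebraMap_eq_smul_one,
      ← NormedSpace.algebraMap_exp_comm, Real.exp_eq_exp_ℝ]
  rw [e, exp_add_of_commute_clm (((Commute.one_right T).smul_left c).smul_right (-c)), e2,
    mul_smul_comm, mul_one]

/-- The factor `e^{-c}` split off from `-c` cancels the bound `e^c` for `e^{cT}`. -/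
theorem norm_exp_smul_sub_one_le {T : H →L[ℝ] H} (hT : ‖T‖ ≤ 1) {c : ℝ} (hc : 0 ≤ c) :
    ‖NormedSpace.exp (c • (T - 1))‖ ≤ 1 := by
  rw [exp_smul_sub_one, norm_smul, Real.norm_of_nonneg (Real.exp_pos _).le]
  calc _ ≤ Real.exp (-c) * Real.exp c :=
        mul_le_mul_of_nonneg_left (norm_exp_smul_clm_le hT hc) (Real.exp_pos _).le
    _ = 1 := by rw [← Real.exp_add]; simp

/-- Interpolate along `s ↦ e^{sB} e^{(t-s)C} u`, whose derivative is a contraction applied to `(B -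
C) u`. The form `e^{tC} e^{s(B-C)}` of the path has a single factor to differentiate. -/
theorem norm_exp_smul_sub_exp_smul_le {B C : H →L[ℝ] H} (hBC : Commute B C)
    (hB : ∀ s : ℝ, 0 ≤ s → ‖NormedSpace.exp (s • B)‖ ≤ 1)
    (hC : ∀ s : ℝ, 0 ≤ s → ‖NormedSpace.exp (s • C)‖ ≤ 1) {t : ℝ} (ht : 0 ≤ t) (u : H) :
    ‖NormedSpace.exp (t • B) u - NormedSpace.exp (t • C) u‖ ≤ t * ‖B u - C u‖ := by
  have hcomm : ∀ s r : ℝ, Commute (s • B) (r • C) := fun s r => (hBC.smul_left s).smul_right r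
  have e : ∀ s, NormedSpace.exp (t • C) * NormedSpace.exp (s • (B - C))
      = NormedSpace.exp (s • B) * NormedSpace.exp ((t - s) • C) := fun s => by
    have h1 : Commute (t • C) (s • (B - C)) := by
      refine Commute.smul_left (Commute.smul_right ?_ s) t
      exact hBC.symm.sub_right (Commute.refl C)
    rw [← exp_add_of_commute_clm h1, ← exp_add_of_commute_clm (hcomm s (t - s))]
    congr 1
    module
  let F : ℝ → H := fun s => (NormedSpace.exp (t • C) * NormedSpace.exp (s • (B - C))) u
  have hF : ∀ s, HasDerivAt F
      ((NormedSpace.exp (t • C) * NormedSpace.exp (s • (B - C))) ((B - C) u)) s := fun s => by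
    have h1 := ((hasDerivAt_exp_smul_const (𝕂 := ℝ) (B - C) s).const_mul
      (NormedSpace.exp (t • C))).clm_apply (hasDerivAt_const s u)
    simpa [F, mul_assoc] using h1
  have hb := (convex_Icc (0 : ℝ) t).norm_image_sub_le_of_norm_hasDerivWithin_le
    (C := ‖B u - C u‖) (fun s _ => (hF s).hasDerivWithinAt) (fun s hs => by
      rw [e s]
      have h1 : ‖NormedSpace.exp (s • B) * NormedSpace.exp ((t - s) • C)‖ ≤ 1 :=
        (norm_mul_le _ _).trans (mul_le_one₀ (hB s hs.1) (norm_nonneg _)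
          (hC (t - s) (sub_nonneg.2 hs.2)))
      simpa using (NormedSpace.exp (s • B) * NormedSpace.exp ((t - s) • C)).le_of_opNorm_le h1
        ((B - C) u)) (left_mem_Icc.2 ht) (right_mem_Icc.2 ht)
  have e1 : F t = NormedSpace.exp (t • B) u := by
    simp only [F]
    rw [e t]
    simp
  have e0 : F 0 = NormedSpace.exp (t • C) u := by simp [F]
  rw [e1, e0, sub_zero, Real.norm_of_nonneg ht, mul_comm] at hb
  exact hb

namespace IsResolventFamily

variable (hA : IsResolventFamily A J)

include hA

theorem norm_exp_yosida_le (n : ℕ) {t : ℝ} (ht : 0 ≤ t) :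
    ‖NormedSpace.exp (t • yosida J n)‖ ≤ 1 := by
  rw [yosida, smul_smul]
  exact norm_exp_smul_sub_one_le (hA.norm_le _ (by positivity)) (by positivity)

/-- For `u'` in the domain, with image `h`, the Yosida approximations of `u'` are `J_{n+1} h`, which
converge; the comparison of exponentials makes the orbits of `u'` Cauchy. Density handles the
general `u`. -/
theorem exists_tendsto_exp_yosida {t : ℝ} (ht : 0 ≤ t) (u : H) :
    ∃ v, Tendsto (fun n => NormedSpace.exp (t • yosida J n) u) atTop (𝓝 v) := by
  refine cauchySeq_tendsto_of_complete (Metric.cauchySeq_iff'.2 fun ε hε => ?_)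
  obtain ⟨u', huF, h, hu⟩ := Metric.dense_iff.1 hA.dense u (ε / 3) (by positivity)
  have h3 : ‖u' - u‖ < ε / 3 := by simpa [dist_eq_norm] using huF
  have hc := (hA.tendsto_apply h).cauchySeq
  obtain ⟨N, hN⟩ := Metric.cauchySeq_iff'.1 hc (ε / (3 * (t + 1))) (by positivity)
  refine ⟨N, fun n hn => ?_⟩
  have h4 : ∀ n, ‖NormedSpace.exp (t • yosida J n) u - NormedSpace.exp (t • yosida J n) u'‖
      < ε / 3 := fun n => by
    rw [← map_sub]
    refine lt_of_le_of_lt ((NormedSpace.exp (t • yosida J n)).le_of_opNorm_le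
      (hA.norm_exp_yosida_le n ht) _) ?_
    rw [one_mul, norm_sub_rev]
    exact h3
  have h5 := norm_exp_smul_sub_exp_smul_le (hA.commute_yosida n N)
    (fun s hs => hA.norm_exp_yosida_le n hs) (fun s hs => hA.norm_exp_yosida_le N hs) ht u'
  rw [hA.yosida_apply hu, hA.yosida_apply hu, ← dist_eq_norm (J _ h)] at h5
  have h6 : t * dist (J ((n : ℝ) + 1) h) (J ((N : ℝ) + 1) h) ≤ ε / 3 := by
    have := (hN n hn).le
    calc _ ≤ t * (ε / (3 * (t + 1))) := by gcongr
      _ ≤ (t + 1) * (ε / (3 * (t + 1))) := by gcongr; linarith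
      _ = ε / 3 := by field_simp
  have h7 := h4 n
  have h8 := h4 N
  rw [dist_eq_norm]
  rw [norm_sub_rev] at h8
  calc _ = ‖(NormedSpace.exp (t • yosida J n) u - NormedSpace.exp (t • yosida J n) u')
        + (NormedSpace.exp (t • yosida J n) u' - NormedSpace.exp (t • yosida J N) u')
        + (NormedSpace.exp (t • yosida J N) u' - NormedSpace.exp (t • yosida J N) u)‖ := by
          congr 1; abel
    _ ≤ _ := norm_add₃_le
    _ < ε := by linarith

/-- Hille-Yosida: `A` generates a contraction semigroup, the limit of the Yosida semigroups. -/
theorem exists_semigroup : ∃ P : ContractionSemigroup H,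
    (∀ u h, P.HasGenerator u h ↔ A u h) ∧
    ∀ (t : ℝ≥0) (u : H),
      Tendsto (fun n => NormedSpace.exp ((t : ℝ) • yosida J n) u) atTop (𝓝 (P.toFun t u)) := by
  choose S hS using fun t : ℝ≥0 => fun u => hA.exists_tendsto_exp_yosida t.2 u
  let T : ℝ≥0 → H →L[ℝ] H := fun t => continuousLinearMapOfTendsto
    (fun n => NormedSpace.exp ((t : ℝ) • yosida J n)) (tendsto_pi_nhds.2 (hS t))
  have hT : ∀ (t : ℝ≥0) (u : H),
      Tendsto (fun n => NormedSpace.exp ((t : ℝ) • yosida J n) u) atTop (𝓝 (T t u)) := hS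
  have hle : ∀ (n : ℕ) (t : ℝ≥0) (u : H), ‖NormedSpace.exp ((t : ℝ) • yosida J n) u‖ ≤ ‖u‖ :=
    fun n t u => by
      simpa using (NormedSpace.exp ((t : ℝ) • yosida J n)).le_of_opNorm_le
        (hA.norm_exp_yosida_le n t.2) u
  have hn : ∀ t, ‖T t‖ ≤ 1 := fun t => ContinuousLinearMap.opNorm_le_bound _ zero_le_one fun u => by
    rw [one_mul]
    exact le_of_tendsto' (hT t u).norm fun n => hle n t u
  have h0 : T 0 = ContinuousLinearMap.id ℝ H := ContinuousLinearMap.ext fun u => by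
    refine tendsto_nhds_unique (hT 0 u) ?_
    simp
  have hadd : ∀ s t, T (s + t) = (T s).comp (T t) := fun s t => ContinuousLinearMap.ext fun u => by
    refine tendsto_nhds_unique (hT (s + t) u) ?_
    have e : ∀ n, NormedSpace.exp (((s + t : ℝ≥0) : ℝ) • yosida J n) u
        = NormedSpace.exp ((s : ℝ) • yosida J n) (NormedSpace.exp ((t : ℝ) • yosida J n) u - T t u)
          + NormedSpace.exp ((s : ℝ) • yosida J n) (T t u) := fun n => by
      rw [← map_add, sub_add_cancel, NNReal.coe_add, add_smul, exp_add_of_commute_clm]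
      · rfl
      · exact ((Commute.refl _).smul_left _).smul_right _
    simp only [e]
    have h1 : Tendsto (fun n => NormedSpace.exp ((s : ℝ) • yosida J n)
        (NormedSpace.exp ((t : ℝ) • yosida J n) u - T t u)) atTop (𝓝 0) := by
      refine squeeze_zero_norm (fun n => hle n s _) ?_
      exact tendsto_iff_norm_sub_tendsto_zero.1 (hT t u)
    simpa using h1.add (hT s (T t u))
  have hlip : ∀ {u h : H}, A u h → ∀ t : ℝ≥0, ‖T t u - u‖ ≤ t * ‖h‖ := fun {u h} hu t => by
    refine le_of_tendsto' ((hT t u).sub_const u).norm fun n => ?_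
    have h1 := norm_exp_smul_sub_exp_smul_le (Commute.zero_right (yosida J n))
      (fun s hs => hA.norm_exp_yosida_le n hs)
      (fun s _ => by rw [smul_zero, NormedSpace.exp_zero]; exact ContinuousLinearMap.norm_id_le)
      t.2 u
    simp only [smul_zero, NormedSpace.exp_zero, one_apply_eq_self,
      zero_apply, sub_zero] at h1
    refine h1.trans (mul_le_mul_of_nonneg_left ?_ t.2)
    rw [hA.yosida_apply hu]
    exact hA.norm_apply_le (by positivity) h
  have hT0 : ∀ u, Tendsto (fun t => T t u) (𝓝 0) (𝓝 u) := fun u => by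
    rw [Metric.tendsto_nhds]
    intro ε hε
    obtain ⟨u', huF, h, hu⟩ := Metric.dense_iff.1 hA.dense u (ε / 3) (by positivity)
    have h3 : ‖u' - u‖ < ε / 3 := by simpa [dist_eq_norm] using huF
    have hc : Continuous fun t : ℝ≥0 => (t : ℝ) * ‖h‖ := by fun_prop
    have h4 := hc.tendsto 0
    simp only [NNReal.coe_zero, zero_mul] at h4
    filter_upwards [h4.eventually (gt_mem_nhds (show (0 : ℝ) < ε / 3 by positivity))] with t ht
    have h5 := hlip hu t
    have h6 := (T t).le_of_opNorm_le (hn t) (u - u')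
    rw [one_mul, norm_sub_rev u u', map_sub] at h6
    rw [dist_eq_norm]
    calc _ = ‖(T t u - T t u') + (T t u' - u') + (u' - u)‖ := by congr 1; abel
      _ ≤ _ := norm_add₃_le
      _ < ε := by linarith
  let P : ContractionSemigroup H := ⟨T, h0, hadd, hn, fun u =>
    continuous_of_tendsto_zero hn hadd u (hT0 u)⟩
  have hPT : ∀ t, P.toFun t = T t := fun _ => rfl
  -- Pass to the limit in `e^{tA_n} u - u = ∫ e^{sA_n} A_n u ds` over `[0, t]`, where `A_n` is the
  -- Yosida approximation, and differentiate at `t = 0`.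
  have hgen : ∀ u h, A u h → P.HasGenerator u h := fun u h hu => by
    have hint : ∀ t : ℝ, 0 ≤ t → P.toFun t.toNNReal u - u = ∫ s in (0 : ℝ)..t, P.toFun s.toNNReal h := by
      intro t ht
      have h1 : ∀ n, NormedSpace.exp (t • yosida J n) u - u
          = ∫ s in (0 : ℝ)..t, NormedSpace.exp (s • yosida J n) (yosida J n u) := fun n => by
        have hd : ∀ s : ℝ, HasDerivAt (fun s : ℝ => NormedSpace.exp (s • yosida J n) u)
            (NormedSpace.exp (s • yosida J n) (yosida J n u)) s := fun s => by
          have := (hasDerivAt_exp_smul_const (𝕂 := ℝ) (yosida J n) s).clm_apply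
            (hasDerivAt_const s u)
          simpa using this
        have hc : Continuous fun s : ℝ => NormedSpace.exp (s • yosida J n) (yosida J n u) := by
          exact (continuous_exp_smul_clm _).clm_apply continuous_const
        rw [intervalIntegral.integral_eq_sub_of_hasDerivAt (fun s _ => hd s)
          (hc.intervalIntegrable _ _)]
        simp
      have hlim1 : Tendsto (fun n => NormedSpace.exp (t • yosida J n) u - u) atTop
          (𝓝 (P.toFun t.toNNReal u - u)) := by
        have := (hT t.toNNReal u).sub_const u
        rwa [Real.coe_toNNReal t ht] at this
      refine tendsto_nhds_unique hlim1 ?_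
      simp only [h1]
      refine intervalIntegral.tendsto_integral_filter_of_dominated_convergence (fun _ => ‖h‖)
        ?_ ?_ intervalIntegrable_const ?_
      · refine Eventually.of_forall fun n => ?_
        exact ((continuous_exp_smul_clm _).clm_apply continuous_const).aestronglyMeasurable
      · refine Eventually.of_forall fun n => Eventually.of_forall fun s hs => ?_
        rw [uIoc_of_le ht] at hs
        have := hle n ⟨s, hs.1.le⟩ (yosida J n u)
        refine this.trans ?_
        rw [hA.yosida_apply hu]
        exact hA.norm_apply_le (by positivity) h
      · refine Eventually.of_forall fun s hs => ?_
        rw [uIoc_of_le ht] at hs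
        have e : ∀ n, NormedSpace.exp (s • yosida J n) (yosida J n u)
            = NormedSpace.exp (s • yosida J n) (yosida J n u - h)
              + NormedSpace.exp (s • yosida J n) h := fun n => by
          rw [← map_add, sub_add_cancel]
        simp only [e]
        have h2 : Tendsto (fun n => NormedSpace.exp (s • yosida J n) (yosida J n u - h)) atTop
            (𝓝 0) := by
          refine squeeze_zero_norm (fun n => hle n ⟨s, hs.1.le⟩ _) ?_
          simp only [hA.yosida_apply hu]
          exact tendsto_iff_norm_sub_tendsto_zero.1 (hA.tendsto_apply h)
        have h3 := hT s.toNNReal h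
        rw [Real.coe_toNNReal s hs.1.le] at h3
        simpa using h2.add h3
    have hd : HasDerivAt (fun t : ℝ => ∫ s in (0 : ℝ)..t, P.toFun s.toNNReal h) h 0 := by
      have h1 := (P.continuous_real h).deriv_integral
      have h2 := intervalIntegral.integral_hasDerivAt_right
        ((P.continuous_real h).intervalIntegrable 0 0)
        ((P.continuous_real h).stronglyMeasurableAtFilter _ _) (P.continuous_real h).continuousAt
      simpa [P.map_zero'] using h2
    rw [hasDerivAt_iff_tendsto_slope_zero] at hd
    have hm : Tendsto (fun t : ℝ≥0 => (t : ℝ)) (𝓝[>] 0) (𝓝[≠] 0) := by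
      refine tendsto_nhdsWithin_iff.2 ⟨?_, ?_⟩
      · simpa using (NNReal.continuous_coe.tendsto 0).mono_left nhdsWithin_le_nhds
      · filter_upwards [self_mem_nhdsWithin] with t ht
        have : (0 : ℝ≥0) < t := ht
        exact (NNReal.coe_pos.2 this).ne'
    refine (hd.comp hm).congr fun t => ?_
    simp only [Function.comp_apply, zero_add, intervalIntegral.integral_same, sub_zero]
    rw [← hint t t.2, Real.toNNReal_coe]
  refine ⟨P, fun u h => ⟨fun hu => ?_, hgen u h⟩, hT⟩
  -- The generator is no larger than `A`. The vector `z = u - J_1 (u - h)` is mapped by the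
  -- generator to `z` itself, so dissipativity gives `‖z‖² ≤ 0`.
  have h1 := hA.rel_apply one_pos (u - h)
  have h2 := hu.sub (hgen _ _ h1)
  have h3 := h2.inner_nonpos
  have e : h - (1 : ℝ) • (J 1 (u - h) - (u - h)) = u - J 1 (u - h) := by
    rw [one_smul]
    abel
  rw [e, real_inner_self_eq_norm_sq] at h3
  have h4 : u - J 1 (u - h) = 0 := by
    rw [← norm_eq_zero]
    exact pow_eq_zero_iff two_ne_zero |>.1 (le_antisymm h3 (sq_nonneg _))
  rw [hA.rel_iff 1 one_pos, inv_one, one_smul]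
  exact (sub_eq_zero.1 h4).symm

end IsResolventFamily

end HilleYosida

/-! ### Resolvents of a closed form -/

/-- The operator of the form `(v, w) ↦ ⟨q v, q w⟩` on the Hilbert space `V`, embedded in `H` by `i`. -/
def FormRel {V H K : Type*} [NormedAddCommGroup H] [InnerProductSpace ℝ H]
    [NormedAddCommGroup K] [InnerProductSpace ℝ K] (i : V → H) (q : V → K) (u h : H) : Prop :=
  ∃ v, i v = u ∧ ∀ w, inner ℝ (q v) (q w) = -inner ℝ h (i w)

section Form

variable {V H K : Type*} [NormedAddCommGroup V] [InnerProductSpace ℝ V]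
  [NormedAddCommGroup H] [InnerProductSpace ℝ H]
  [NormedAddCommGroup K] [InnerProductSpace ℝ K] {i : V →L[ℝ] H} {q : V →L[ℝ] K}

theorem form_solution_unique (hn : ∀ v, ‖v‖ ^ 2 = ‖i v‖ ^ 2 + ‖q v‖ ^ 2) {b : ℝ} (hb : 0 < b) {v v' : V}
    (h : ∀ w, inner ℝ (q v) (q w) + b * inner ℝ (i v) (i w)
      = inner ℝ (q v') (q w) + b * inner ℝ (i v') (i w)) : v = v' := by
  have h1 := h (v - v')
  have h2 : ‖q (v - v')‖ ^ 2 + b * ‖i (v - v')‖ ^ 2 = 0 := by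
    rw [← real_inner_self_eq_norm_sq, ← real_inner_self_eq_norm_sq]
    have e1 : inner ℝ (q (v - v')) (q (v - v'))
        = inner ℝ (q v) (q (v - v')) - inner ℝ (q v') (q (v - v')) := by
      rw [← inner_sub_left, ← map_sub]
    have e2 : inner ℝ (i (v - v')) (i (v - v'))
        = inner ℝ (i v) (i (v - v')) - inner ℝ (i v') (i (v - v')) := by
      rw [← inner_sub_left, ← map_sub]
    rw [e1, e2]
    linarith
  have h3 : b * ‖i (v - v')‖ ^ 2 = 0 := by
    nlinarith [sq_nonneg ‖q (v - v')‖, mul_nonneg hb.le (sq_nonneg ‖i (v - v')‖)]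
  have h4 : ‖i (v - v')‖ ^ 2 = 0 := (mul_eq_zero.1 h3).resolve_left hb.ne'
  have h5 := hn (v - v')
  rw [h4] at h5
  have h6 : ‖v - v'‖ ^ 2 = 0 := by linarith
  exact sub_eq_zero.1 (norm_eq_zero.1 (pow_eq_zero_iff two_ne_zero |>.1 h6))

variable [CompleteSpace V] [CompleteSpace H]

/-- Lax-Milgram, with coercivity constant `min 1 b`; the adjoint of `i` represents the right-hand
side in `V`. -/
theorem exists_form_solution (hn : ∀ v, ‖v‖ ^ 2 = ‖i v‖ ^ 2 + ‖q v‖ ^ 2) {b : ℝ} (hb : 0 < b) :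
    ∃ S : H →L[ℝ] V, ∀ F w,
      inner ℝ (q (S F)) (q w) + b * inner ℝ (i (S F)) (i w) = b * inner ℝ F (i w) := by
  let B : V →L[ℝ] V →L[ℝ] ℝ := (innerSL ℝ).bilinearComp q q + b • (innerSL ℝ).bilinearComp i i
  have hB : ∀ v w, B v w = inner ℝ (q v) (q w) + b * inner ℝ (i v) (i w) := fun v w => rfl
  have hco : IsCoercive B := ⟨min 1 b, lt_min one_pos hb, fun v => by
    rw [hB, real_inner_self_eq_norm_sq, real_inner_self_eq_norm_sq, mul_assoc, ← pow_two, hn]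
    have h1 := mul_le_mul_of_nonneg_right (min_le_left 1 b) (sq_nonneg ‖q v‖)
    have h2 := mul_le_mul_of_nonneg_right (min_le_right 1 b) (sq_nonneg ‖i v‖)
    linarith⟩
  refine ⟨b • ((hco.continuousLinearEquivOfBilin.symm : V →L[ℝ] V).comp
    (ContinuousLinearMap.adjoint i)), fun F w => ?_⟩
  rw [← hB, ← hco.continuousLinearEquivOfBilin_apply]
  simp [inner_smul_left, ContinuousLinearMap.adjoint_inner_left]

/-- The solution operator of `⟨q v, q w⟩ + b ⟨i v, i w⟩ = b ⟨F, i w⟩`. -/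
noncomputable def formSolution (i : V →L[ℝ] H) (q : V →L[ℝ] K)
    (hn : ∀ v, ‖v‖ ^ 2 = ‖i v‖ ^ 2 + ‖q v‖ ^ 2) (b : ℝ) : H →L[ℝ] V :=
  if hb : 0 < b then (exists_form_solution hn hb).choose else 0

variable (hn : ∀ v, ‖v‖ ^ 2 = ‖i v‖ ^ 2 + ‖q v‖ ^ 2)

theorem formSolution_spec {b : ℝ} (hb : 0 < b) (F : H) (w : V) :
    inner ℝ (q (formSolution i q hn b F)) (q w)
      + b * inner ℝ (i (formSolution i q hn b F)) (i w) = b * inner ℝ F (i w) := by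
  rw [formSolution, dif_pos hb]
  exact (exists_form_solution hn hb).choose_spec F w

/-- The normalized resolvents `b (b - A)⁻¹` of the operator of the form. -/
noncomputable def formResolvent (b : ℝ) : H →L[ℝ] H := i.comp (formSolution i q hn b)

/-- Test the equation of each solution with the other solution. -/
theorem formResolvent_symm {b : ℝ} (hb : 0 < b) (F G : H) :
    inner ℝ (formResolvent hn b F) G = inner ℝ F (formResolvent hn b G) := by
  have h1 := formSolution_spec hn hb F (formSolution i q hn b G)
  have h2 := formSolution_spec hn hb G (formSolution i q hn b F)
  rw [real_inner_comm, real_inner_comm (i (formSolution i q hn b F))] at h2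
  simp only [formResolvent, ContinuousLinearMap.comp_apply]
  rw [real_inner_comm]
  exact mul_left_cancel₀ hb.ne' (h2.symm.trans h1)

/-- The range of the resolvent at `1` lies in the domain of the operator. By symmetry a vector
orthogonal to it is in the kernel; injectivity of `i` makes the solution in `V` vanish, so the
vector is orthogonal to the range of `i`, and `hd` applies. -/
theorem isResolventFamily_formResolvent (hi : ∀ v, i v = 0 → v = 0)
    (hd : ∀ G, (∀ w, inner ℝ G (i w) = 0) → G = 0) :
    IsResolventFamily (FormRel i q) (formResolvent hn) := by
  have hrel : ∀ b, 0 < b → ∀ u h, FormRel i q u h ↔ formResolvent hn b (u - b⁻¹ • h) = u := by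
    intro b hb u h
    constructor
    · rintro ⟨v, rfl, hv⟩
      have : formSolution i q hn b (i v - b⁻¹ • h) = v := by
        refine form_solution_unique hn hb fun w => ?_
        rw [formSolution_spec hn hb, hv w, inner_sub_left, inner_smul_left]
        simp only [conj_trivial]
        field_simp
        ring
      simp only [formResolvent, ContinuousLinearMap.comp_apply]
      rw [this]
    · intro hu
      refine ⟨formSolution i q hn b (u - b⁻¹ • h), hu, fun w => ?_⟩
      have h1 := formSolution_spec hn hb (u - b⁻¹ • h) w
      have h2 : i (formSolution i q hn b (u - b⁻¹ • h)) = u := hu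
      rw [h2, inner_sub_left, inner_smul_left] at h1
      simp only [conj_trivial] at h1
      rw [mul_sub, mul_inv_cancel_left₀ hb.ne'] at h1
      linarith
  refine ⟨fun b hb => ContinuousLinearMap.opNorm_le_bound _ zero_le_one fun F => ?_, hrel, ?_⟩
  · have h1 := formSolution_spec hn hb F (formSolution i q hn b F)
    rw [real_inner_self_eq_norm_sq, real_inner_self_eq_norm_sq] at h1
    have h2 := real_inner_le_norm F (i (formSolution i q hn b F))
    have h3 : ‖i (formSolution i q hn b F)‖ ^ 2 ≤ ‖F‖ * ‖i (formSolution i q hn b F)‖ := by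
      have h4 : b * ‖i (formSolution i q hn b F)‖ ^ 2
          ≤ b * (‖F‖ * ‖i (formSolution i q hn b F)‖) := by
        nlinarith [sq_nonneg ‖q (formSolution i q hn b F)‖]
      exact le_of_mul_le_mul_left h4 hb
    simp only [formResolvent, ContinuousLinearMap.comp_apply, one_mul]
    rcases (norm_nonneg (i (formSolution i q hn b F))).eq_or_lt with h | h
    · rw [← h]
      exact norm_nonneg F
    · exact le_of_mul_le_mul_right (by rwa [← pow_two]) h
  · have h1 : (LinearMap.range (formResolvent hn 1 : H →ₗ[ℝ] H)).topologicalClosure = ⊤ := by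
      rw [Submodule.topologicalClosure_eq_top_iff, Submodule.eq_bot_iff]
      intro G hG
      have h2 : formResolvent hn 1 G = 0 := by
        have := (Submodule.mem_orthogonal _ _).1 hG _ ⟨formResolvent hn 1 G, rfl⟩
        rw [← inner_self_eq_zero (𝕜 := ℝ), ← formResolvent_symm hn one_pos]
        exact this
      have h3 : formSolution i q hn 1 G = 0 := hi _ h2
      refine hd G fun w => ?_
      have h4 := formSolution_spec hn one_pos G w
      rw [h3] at h4
      simpa using h4.symm
    have h2 : Dense ((LinearMap.range (formResolvent hn 1 : H →ₗ[ℝ] H) : Submodule ℝ H) : Set H) := by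
      rw [Submodule.dense_iff_topologicalClosure_eq_top]
      exact h1
    refine h2.mono ?_
    rintro _ ⟨F, rfl⟩
    refine ⟨(1 : ℝ) • (formResolvent hn 1 F - F), (hrel 1 one_pos _ _).2 ?_⟩
    simp

/-- The solution minimizes `‖q w‖² + b ‖i w - F‖²`. -/
theorem form_energy_eq {b : ℝ} (hb : 0 < b) (F : H) (w : V) :
    ‖q w‖ ^ 2 + b * ‖i w - F‖ ^ 2
      = ‖q (formSolution i q hn b F)‖ ^ 2 + b * ‖i (formSolution i q hn b F) - F‖ ^ 2
        + (‖q (w - formSolution i q hn b F)‖ ^ 2 + b * ‖i (w - formSolution i q hn b F)‖ ^ 2) := by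
  set v := formSolution i q hn b F with hv
  obtain ⟨z, rfl⟩ : ∃ z, w = v + z := ⟨w - v, by abel⟩
  have h1 := formSolution_spec hn hb F z
  rw [← hv] at h1
  rw [add_sub_cancel_left, map_add, map_add, add_sub_right_comm, norm_add_sq_real,
    norm_add_sq_real, inner_sub_left]
  linear_combination 2 * h1

end Form

/-! ### Exponentials of positive operators -/

/-- `e^{c(T-1)}` is the Poisson average, with weights `e^{-c} c^n / n!`, of the powers `T^n`, each
of which preserves the order interval. -/
theorem mapsTo_exp_smul_sub_one {H : Type*} [NormedAddCommGroup H] [InnerProductSpace ℝ H]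
    [CompleteSpace H] [PartialOrder H] [IsOrderedAddMonoid H] [IsOrderedModule ℝ H]
    [OrderClosedTopology H] {T : H →L[ℝ] H} {e : H} (hT : MapsTo T (Icc 0 e) (Icc 0 e)) {c : ℝ}
    (hc : 0 ≤ c) : MapsTo (NormedSpace.exp (c • (T - 1)) : H →L[ℝ] H) (Icc 0 e) (Icc 0 e) := by
  intro u hu
  have h1 := (ContinuousLinearMap.apply ℝ H u).hasSum
    (NormedSpace.exp_series_hasSum_exp' (𝕂 := ℝ) (c • T))
  have h2 : HasSum (fun n : ℕ => (((n.factorial : ℝ))⁻¹ • c ^ n) • e) (Real.exp c • e) := by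
    rw [Real.exp_eq_exp_ℝ]
    exact (NormedSpace.exp_series_hasSum_exp' (𝕂 := ℝ) c).smul_const _
  have hpos : ∀ n : ℕ, 0 ≤ ((n.factorial : ℝ))⁻¹ • c ^ n := fun n => by
    have := pow_nonneg hc n
    positivity
  have hpow : ∀ n : ℕ, (T ^ n) u ∈ Icc 0 e := fun n => by
    induction n with
    | zero => exact hu
    | succ n ih =>
      rw [pow_succ', mul_apply_eq_comp]
      exact hT ih
  have hterm : ∀ n : ℕ, (((n.factorial : ℝ))⁻¹ • (c • T) ^ n) u
      = (((n.factorial : ℝ))⁻¹ • c ^ n) • (T ^ n) u := fun n => by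
    rw [smul_pow, ← smul_assoc]
    rfl
  simp only [ContinuousLinearMap.apply_apply, hterm] at h1
  have hle : NormedSpace.exp (c • T) u ≤ Real.exp c • e :=
    hasSum_le (fun n => smul_le_smul_of_nonneg_left (hpow n).2 (hpos n)) h1 h2
  have hge : 0 ≤ NormedSpace.exp (c • T) u := h1.nonneg fun n => smul_nonneg (hpos n) (hpow n).1
  have hexp : NormedSpace.exp (c • (T - 1)) u = Real.exp (-c) • NormedSpace.exp (c • T) u := by
    rw [exp_smul_sub_one]
    rfl
  rw [hexp]
  refine ⟨smul_nonneg (Real.exp_pos _).le hge, ?_⟩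
  have := smul_le_smul_of_nonneg_left hle (Real.exp_pos (-c)).le
  rwa [smul_smul, ← Real.exp_add, neg_add_cancel, Real.exp_zero, one_smul] at this

/-! ### Sub-Markovian operators -/

section SubMarkov

variable {X : Type*} [MeasurableSpace X] {μ : Measure X}

instance isOrderedModule_LTwo : IsOrderedModule ℝ (Lp ℝ 2 μ) where
  smul_le_smul_of_nonneg_left a ha u v huv := by
    rw [← Lp.coeFn_le] at huv ⊢
    filter_upwards [huv, Lp.coeFn_smul a u, Lp.coeFn_smul a v] with x h1 h2 h3
    rw [h2, h3]
    exact mul_le_mul_of_nonneg_left h1 ha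
  smul_le_smul_of_nonneg_right u hu a b hab := by
    rw [← Lp.coeFn_le] at hu ⊢
    filter_upwards [hu, Lp.coeFn_smul a u, Lp.coeFn_smul b u, Lp.coeFn_zero ℝ 2 μ]
      with x h1 h2 h3 h4
    rw [h2, h3]
    rw [h4] at h1
    exact mul_le_mul_of_nonneg_right hab h1

variable [IsFiniteMeasure μ]

/-- The constant functions, as elements of `L²(μ)`. -/
noncomputable abbrev constLTwo (μ : Measure X) [IsFiniteMeasure μ] (c : ℝ) : Lp ℝ 2 μ :=
  Lp.const 2 μ c

theorem mem_Icc_constLTwo_iff {u : Lp ℝ 2 μ} {a b : ℝ} :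
    u ∈ Icc (constLTwo μ a) (constLTwo μ b) ↔ ∀ᵐ x ∂μ, a ≤ u x ∧ u x ≤ b := by
  rw [mem_Icc, ← Lp.coeFn_le, ← Lp.coeFn_le]
  constructor
  · rintro ⟨h1, h2⟩
    filter_upwards [h1, h2, Lp.coeFn_const 2 μ a, Lp.coeFn_const 2 μ b] with x h1 h2 h3 h4
    rw [h3] at h1
    rw [h4] at h2
    exact ⟨h1, h2⟩
  · intro h
    constructor
    · filter_upwards [h, Lp.coeFn_const 2 μ a] with x h1 h3
      rw [h3]
      exact h1.1
    · filter_upwards [h, Lp.coeFn_const 2 μ b] with x h1 h3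
      rw [h3]
      exact h1.2

/-- `0 ≤ u ≤ 1` implies `0 ≤ T u ≤ 1`. -/
def IsSubMarkovOp (T : Lp ℝ 2 μ →L[ℝ] Lp ℝ 2 μ) : Prop :=
  MapsTo T (Icc (constLTwo μ 0) (constLTwo μ 1)) (Icc (constLTwo μ 0) (constLTwo μ 1))

theorem ContractionSemigroup.isSubMarkovian_iff {P : ContractionSemigroup (Lp ℝ 2 μ)} :
    P.IsSubMarkovian ↔ ∀ t, IsSubMarkovOp (P.toFun t) := by
  simp only [ContractionSemigroup.IsSubMarkovian, IsSubMarkovOp, MapsTo, mem_Icc_constLTwo_iff]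

theorem IsSubMarkovOp.of_tendsto {T : ℕ → Lp ℝ 2 μ →L[ℝ] Lp ℝ 2 μ} {S : Lp ℝ 2 μ →L[ℝ] Lp ℝ 2 μ}
    (hT : ∀ n, IsSubMarkovOp (T n)) (h : ∀ u, Tendsto (fun n => T n u) atTop (𝓝 (S u))) :
    IsSubMarkovOp S := fun u hu =>
  isClosed_Icc.mem_of_tendsto (h u) (Eventually.of_forall fun n => hT n hu)

theorem IsSubMarkovOp.exp_smul_sub_one {T : Lp ℝ 2 μ →L[ℝ] Lp ℝ 2 μ} (hT : IsSubMarkovOp T) {c : ℝ}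
    (hc : 0 ≤ c) : IsSubMarkovOp (NormedSpace.exp (c • (T - 1))) := by
  have h0 : constLTwo μ 0 = 0 := map_zero _
  rw [IsSubMarkovOp, h0] at hT ⊢
  exact mapsTo_exp_smul_sub_one hT hc

theorem IsSubMarkovOp.subordinateOp {P : ContractionSemigroup (Lp ℝ 2 μ)}
    (hP : ∀ t, IsSubMarkovOp (P.toFun t)) (ν : ConvolutionSemigroup) (t : ℝ≥0) :
    IsSubMarkovOp (subordinateOp P ν t) := by
  intro u hu
  have h0 : constLTwo μ 0 = 0 := map_zero _
  rw [subordinateOp_apply]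
  refine ⟨?_, ?_⟩
  · rw [h0]
    refine integral_nonneg fun s => ?_
    have := (hP s hu).1
    rwa [h0] at this
  · have h1 : ∫ s, P.toFun s u ∂(ν.measure t) ≤ ∫ _, constLTwo μ 1 ∂(ν.measure t) :=
      integral_mono (P.integrable _ u) (integrable_const _) fun s => (hP s hu).2
    refine h1.trans ?_
    rw [integral_const]
    have h2 : (0 : Lp ℝ 2 μ) ≤ constLTwo μ 1 := by
      have := hu.1.trans hu.2
      rwa [h0] at this
    calc _ ≤ (1 : ℝ) • constLTwo μ 1 := smul_le_smul_of_nonneg_right (ν.real_mass_le t) h2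
      _ = _ := one_smul _ _

end SubMarkov

/-! ### Symmetric operators -/

section Symmetric

variable {H : Type*} [NormedAddCommGroup H] [InnerProductSpace ℝ H] [CompleteSpace H]

theorem inner_exp_smul_sub_one {T : H →L[ℝ] H} (hT : ∀ u v, inner ℝ (T u) v = inner ℝ u (T v))
    (c : ℝ) (u v : H) : inner ℝ (NormedSpace.exp (c • (T - 1)) u) v
      = inner ℝ u (NormedSpace.exp (c • (T - 1)) v) := by
  have h0 : ∀ u v, inner ℝ ((c • (T - 1)) u) v = inner ℝ u ((c • (T - 1)) v) := fun u v => by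
    simp [inner_smul_left, inner_smul_right, inner_sub_left, inner_sub_right, hT]
  have hsym : ∀ (n : ℕ) (u v : H), inner ℝ (((c • (T - 1)) ^ n) u) v
      = inner ℝ u (((c • (T - 1)) ^ n) v) := fun n => by
    induction n with
    | zero => simp
    | succ n ih =>
      intro u v
      rw [pow_succ, mul_apply_eq_comp, ih, h0, ← mul_apply_eq_comp, ← pow_succ', pow_succ]
  have hs := NormedSpace.exp_series_hasSum_exp' (𝕂 := ℝ) (c • (T - 1))
  have h1 := ((ContinuousLinearMap.apply ℝ H u).hasSum hs).mapL (innerSL ℝ v)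
  have h2 := ((ContinuousLinearMap.apply ℝ H v).hasSum hs).mapL (innerSL ℝ u)
  rw [real_inner_comm]
  refine HasSum.unique h1 (h2.congr_fun fun n => ?_)
  simp only [ContinuousLinearMap.apply_apply, innerSL_apply_apply]
  rw [real_inner_comm]
  simp only [smul_apply, inner_smul_left, inner_smul_right, hsym, conj_trivial]

theorem inner_subordinateOp {P : ContractionSemigroup H}
    (hP : ∀ t u v, inner ℝ (P.toFun t u) v = inner ℝ u (P.toFun t v)) (ν : ConvolutionSemigroup)
    (t : ℝ≥0) (u v : H) :
    inner ℝ (subordinateOp P ν t u) v = inner ℝ u (subordinateOp P ν t v) := by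
  rw [subordinateOp_apply, subordinateOp_apply, ← integral_inner (P.integrable _ v),
    real_inner_comm, ← integral_inner (P.integrable _ u)]
  refine integral_congr_ae (Eventually.of_forall fun s => ?_)
  simp only
  rw [real_inner_comm, hP]

end Symmetric

/-! ### Test functions -/

section TestFunction

variable {d : ℕ} {Ω : Set (EuclideanSpace ℝ (Fin d))}

theorem norm_gradient (φ : EuclideanSpace ℝ (Fin d) → ℝ) (x : EuclideanSpace ℝ (Fin d)) :
    ‖∇ φ x‖ = ‖fderiv ℝ φ x‖ := by
  rw [gradient, LinearIsometryEquiv.norm_map]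

namespace IsTestFunction

variable {φ ψ : EuclideanSpace ℝ (Fin d) → ℝ}

theorem differentiable (hφ : IsTestFunction Ω φ) : Differentiable ℝ φ :=
  hφ.1.differentiable (by simp)

theorem continuous_gradient (hφ : IsTestFunction Ω φ) : Continuous (∇ φ) :=
  (InnerProductSpace.toDual ℝ (EuclideanSpace ℝ (Fin d))).symm.continuous.comp
    (hφ.1.continuous_fderiv (by simp))

theorem hasCompactSupport_gradient (hφ : IsTestFunction Ω φ) : HasCompactSupport (∇ φ) :=
  (hφ.2.1.fderiv (𝕜 := ℝ)).comp_left (map_zero _)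

theorem memLp (hφ : IsTestFunction Ω φ) (p : ℝ≥0∞) : MemLp φ p (volume.restrict Ω) :=
  (hφ.1.continuous.memLp_of_hasCompactSupport hφ.2.1).restrict Ω

theorem memLp_gradient (hφ : IsTestFunction Ω φ) (p : ℝ≥0∞) :
    MemLp (∇ φ) p (volume.restrict Ω) :=
  (hφ.continuous_gradient.memLp_of_hasCompactSupport hφ.hasCompactSupport_gradient).restrict Ω

theorem zero : IsTestFunction Ω 0 :=
  ⟨contDiff_const, HasCompactSupport.zero, by simp [tsupport]⟩

theorem add (hφ : IsTestFunction Ω φ) (hψ : IsTestFunction Ω ψ) : IsTestFunction Ω (φ + ψ) :=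
  ⟨hφ.1.add hψ.1, hφ.2.1.add hψ.2.1,
    (tsupport_add φ ψ).trans (union_subset hφ.2.2 hψ.2.2)⟩

theorem const_smul (hφ : IsTestFunction Ω φ) (c : ℝ) : IsTestFunction Ω (c • φ) := by
  have h : tsupport (c • φ) ⊆ tsupport φ := closure_mono (Function.support_const_smul_subset c φ)
  exact ⟨hφ.1.const_smul c, hφ.2.1.of_isClosed_subset (isClosed_tsupport _) h, h.trans hφ.2.2⟩

theorem gradient_add (hφ : IsTestFunction Ω φ) (hψ : IsTestFunction Ω ψ) :
    ∇ (φ + ψ) = ∇ φ + ∇ ψ := by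
  funext x
  simp only [gradient, Pi.add_apply]
  rw [fderiv_add (hφ.differentiable x) (hψ.differentiable x), map_add]

theorem gradient_const_smul (hφ : IsTestFunction Ω φ) (c : ℝ) : ∇ (c • φ) = c • ∇ φ := by
  funext x
  simp only [gradient, Pi.smul_apply]
  rw [fderiv_const_smul (hφ.differentiable x), map_smul]

theorem comp (hφ : IsTestFunction Ω φ) {η : ℝ → ℝ} (hη : ContDiff ℝ ∞ η) (h0 : η 0 = 0) :
    IsTestFunction Ω (η ∘ φ) := by
  have h : tsupport (η ∘ φ) ⊆ tsupport φ := closure_mono (Function.support_comp_subset h0 φ)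
  exact ⟨hη.comp hφ.1, hφ.2.1.comp_left h0, h.trans hφ.2.2⟩

theorem norm_gradient_comp_le (hφ : IsTestFunction Ω φ) {η : ℝ → ℝ} (hη : ContDiff ℝ ∞ η)
    (h1 : ∀ y, |deriv η y| ≤ 1) (x : EuclideanSpace ℝ (Fin d)) :
    ‖∇ (η ∘ φ) x‖ ≤ ‖∇ φ x‖ := by
  have hd : HasDerivAt η (deriv η (φ x)) (φ x) :=
    ((hη.differentiable (by simp)) (φ x)).hasDerivAt
  rw [norm_gradient, norm_gradient,
    (hd.comp_hasFDerivAt x (hφ.differentiable x).hasFDerivAt).fderiv, norm_smul]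
  exact mul_le_of_le_one_left (norm_nonneg _) (h1 _)

theorem eq_zero_of_notMem (hφ : IsTestFunction Ω φ) {x : EuclideanSpace ℝ (Fin d)} (hx : x ∉ Ω) :
    φ x = 0 :=
  image_eq_zero_of_notMem_tsupport fun h => hx (hφ.2.2 h)

theorem integral_mul_gradient (hφ : IsTestFunction Ω φ) (hψ : IsTestFunction Ω ψ)
    (e : EuclideanSpace ℝ (Fin d)) :
    ∫ x in Ω, ψ x * inner ℝ (∇ φ x) e = -∫ x in Ω, φ x * inner ℝ (∇ ψ x) e := by
  have hint : ∀ {φ ψ : EuclideanSpace ℝ (Fin d) → ℝ}, IsTestFunction Ω φ → IsTestFunction Ω ψ →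
      Integrable (fun x => φ x * fderiv ℝ ψ x e) := fun {φ ψ} hφ hψ => by
    refine Continuous.integrable_of_hasCompactSupport ?_ ?_
    · exact hφ.1.continuous.mul ((hψ.1.continuous_fderiv (by simp)).clm_apply continuous_const)
    · exact hφ.2.1.mul_right
  rw [setIntegral_eq_integral_of_forall_compl_eq_zero (fun x hx => by
      rw [hψ.eq_zero_of_notMem hx, zero_mul]),
    setIntegral_eq_integral_of_forall_compl_eq_zero (fun x hx => by
      rw [hφ.eq_zero_of_notMem hx, zero_mul])]
  simp only [inner_gradient_left]
  have hi := hint hφ hψ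
  rw [integral_mul_fderiv_eq_neg_fderiv_mul_of_integrable (by simpa [mul_comm] using hi)
    (hint hψ hφ) ((hφ.1.continuous.mul hψ.1.continuous).integrable_of_hasCompactSupport
      hφ.2.1.mul_right |>.congr (Eventually.of_forall fun x => by simp [mul_comm]))
    (fun x _ => hψ.differentiable x) (fun x _ => hφ.differentiable x)]
  simp only [mul_comm]

end IsTestFunction

/-- The fundamental lemma of the calculus of variations in `L²(Ω)`. -/
theorem ae_eq_zero_of_integral_test_eq_zero {F : Type*} [NormedAddCommGroup F] [NormedSpace ℝ F]
    [CompleteSpace F] [IsFiniteMeasure (volume.restrict Ω)] (hΩ : IsOpen Ω)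
    {f : EuclideanSpace ℝ (Fin d) → F} (hf : MemLp f 2 (volume.restrict Ω))
    (h : ∀ φ, IsTestFunction Ω φ → ∫ x in Ω, φ x • f x = 0) : f =ᵐ[volume.restrict Ω] 0 := by
  have h1 : IntegrableOn f Ω := hf.integrable (by norm_num)
  have h2 := hΩ.ae_eq_zero_of_integral_contDiff_smul_eq_zero (μ := volume) (f := f)
    h1.locallyIntegrableOn fun φ h1 h2 h3 => by
      have hφ : IsTestFunction Ω φ := ⟨h1, h2, h3⟩
      rw [← h φ hφ]
      refine (setIntegral_eq_integral_of_forall_compl_eq_zero fun x hx => ?_).symm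
      rw [hφ.eq_zero_of_notMem hx, zero_smul]
  exact (ae_restrict_iff' hΩ.measurableSet).2 h2

/-- Pairing with constant vectors turns the vector identity into scalar ones, which are `L²` inner
products with fixed functions and so survive limits in `u` and `g`. -/
theorem isWeakGradient_iff {u : LTwo Ω} {g : LTwoField Ω} : IsWeakGradient Ω u g ↔
    ∀ φ, IsTestFunction Ω φ → ∀ e, ∫ x in Ω, u x * inner ℝ (∇ φ x) e
      = -∫ x in Ω, φ x * inner ℝ (g x) e := by
  have key : ∀ φ, IsTestFunction Ω φ → ∀ e,
      inner ℝ (∫ x in Ω, u x • ∇ φ x) e = ∫ x in Ω, u x * inner ℝ (∇ φ x) e ∧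
      inner ℝ (-∫ x in Ω, φ x • g x) e = -∫ x in Ω, φ x * inner ℝ (g x) e := by
    intro φ hφ e
    have i1 : Integrable (fun x => u x • ∇ φ x) (volume.restrict Ω) :=
      memLp_one_iff_integrable.1 ((hφ.memLp_gradient 2).smul (Lp.memLp u))
    have i2 : Integrable (fun x => φ x • g x) (volume.restrict Ω) :=
      memLp_one_iff_integrable.1 ((Lp.memLp g).smul (hφ.memLp 2))
    rw [inner_neg_left, real_inner_comm, ← integral_inner i1, real_inner_comm,
      ← integral_inner i2]
    simp only [inner_smul_right, real_inner_comm e]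
    exact ⟨trivial, trivial⟩
  constructor
  · intro h φ hφ e
    rw [← (key φ hφ e).1, ← (key φ hφ e).2, h φ hφ]
  · intro h φ hφ
    refine ext_inner_right ℝ fun e => ?_
    rw [(key φ hφ e).1, (key φ hφ e).2, h φ hφ e]

end TestFunction

/-! ### The Sobolev space `H_0^1(Ω)` -/

section Sobolev

variable {d : ℕ}

theorem norm_map_sub_le_of_norm_map_le {V H : Type*} [NormedAddCommGroup V] [NormedSpace ℝ V]
    [NormedAddCommGroup H] [NormedSpace ℝ H] (i : V →L[ℝ] H) (h : ∀ v, ‖i v‖ ≤ ‖v‖) (v w : V) :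
    ‖i v - i w‖ ≤ ‖v - w‖ := by
  rw [← map_sub]
  exact h _

/-- The pairs `(φ, ∇φ)` of test functions. -/
noncomputable def testSpace (Ω : Set (EuclideanSpace ℝ (Fin d))) :
    Submodule ℝ (WithLp 2 (LTwo Ω × LTwoField Ω)) where
  carrier := {p | ∃ φ, IsTestFunction Ω φ ∧ p.fst =ᵐ[volume.restrict Ω] φ ∧
    p.snd =ᵐ[volume.restrict Ω] ∇ φ}
  zero_mem' := by
    refine ⟨0, IsTestFunction.zero, Lp.coeFn_zero _ _ _, ?_⟩
    filter_upwards [Lp.coeFn_zero (EuclideanSpace ℝ (Fin d)) 2 (volume.restrict Ω)] with x hx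
    change (0 : LTwoField Ω) x = _
    rw [hx]
    simp [gradient]
  add_mem' := by
    rintro p p' ⟨φ, hφ, h1, h2⟩ ⟨φ', hφ', h1', h2'⟩
    refine ⟨φ + φ', hφ.add hφ', ?_, ?_⟩
    · filter_upwards [Lp.coeFn_add p.fst p'.fst, h1, h1'] with x a b c
      change (p.fst + p'.fst) x = _
      rw [a, Pi.add_apply, b, c, Pi.add_apply]
    · filter_upwards [Lp.coeFn_add p.snd p'.snd, h2, h2'] with x a b c
      change (p.snd + p'.snd) x = _
      rw [a, Pi.add_apply, b, c, hφ.gradient_add hφ', Pi.add_apply]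
  smul_mem' := by
    rintro c p ⟨φ, hφ, h1, h2⟩
    refine ⟨c • φ, hφ.const_smul c, ?_, ?_⟩
    · filter_upwards [Lp.coeFn_smul c p.fst, h1] with x a b
      change (c • p.fst) x = _
      rw [a, Pi.smul_apply, b, Pi.smul_apply]
    · filter_upwards [Lp.coeFn_smul c p.snd, h2] with x a b
      change (c • p.snd) x = _
      rw [a, Pi.smul_apply, b, hφ.gradient_const_smul, Pi.smul_apply]

/-- `H_0^1(Ω)` as the closure of `C_c^∞(Ω)`. -/
noncomputable abbrev HZeroOne (Ω : Set (EuclideanSpace ℝ (Fin d))) :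
    Submodule ℝ (WithLp 2 (LTwo Ω × LTwoField Ω)) :=
  (testSpace Ω).topologicalClosure

/-- The inclusion of `H_0^1(Ω)` into `L²(Ω)`. -/
noncomputable def hIncl (Ω : Set (EuclideanSpace ℝ (Fin d))) : HZeroOne Ω →L[ℝ] LTwo Ω :=
  (WithLp.fstL 2 ℝ (LTwo Ω) (LTwoField Ω)).comp (HZeroOne Ω).subtypeL

/-- The weak gradient on `H_0^1(Ω)`. -/
noncomputable def hGrad (Ω : Set (EuclideanSpace ℝ (Fin d))) : HZeroOne Ω →L[ℝ] LTwoField Ω :=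
  (WithLp.sndL 2 ℝ (LTwo Ω) (LTwoField Ω)).comp (HZeroOne Ω).subtypeL

variable {Ω : Set (EuclideanSpace ℝ (Fin d))}

theorem hZeroOne_norm_sq (v : HZeroOne Ω) : ‖v‖ ^ 2 = ‖hIncl Ω v‖ ^ 2 + ‖hGrad Ω v‖ ^ 2 :=
  WithLp.prod_norm_sq_eq_of_L2 v.1

theorem norm_hIncl_le (v : HZeroOne Ω) : ‖hIncl Ω v‖ ≤ ‖v‖ := by
  rw [← sq_le_sq₀ (norm_nonneg _) (norm_nonneg _), hZeroOne_norm_sq]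
  exact le_add_of_nonneg_right (sq_nonneg _)

theorem norm_hGrad_le (v : HZeroOne Ω) : ‖hGrad Ω v‖ ≤ ‖v‖ := by
  rw [← sq_le_sq₀ (norm_nonneg _) (norm_nonneg _), hZeroOne_norm_sq]
  exact le_add_of_nonneg_left (sq_nonneg _)

/-- The element of `H_0^1(Ω)` given by a test function. -/
noncomputable def IsTestFunction.toH {φ : EuclideanSpace ℝ (Fin d) → ℝ}
    (hφ : IsTestFunction Ω φ) : HZeroOne Ω :=
  ⟨WithLp.toLp 2 ((hφ.memLp 2).toLp φ, (hφ.memLp_gradient 2).toLp (∇ φ)),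
    subset_closure ⟨φ, hφ, (hφ.memLp 2).coeFn_toLp, (hφ.memLp_gradient 2).coeFn_toLp⟩⟩

theorem IsTestFunction.hIncl_toH {φ : EuclideanSpace ℝ (Fin d) → ℝ} (hφ : IsTestFunction Ω φ) :
    hIncl Ω hφ.toH = (hφ.memLp 2).toLp φ := rfl

theorem IsTestFunction.hGrad_toH {φ : EuclideanSpace ℝ (Fin d) → ℝ} (hφ : IsTestFunction Ω φ) :
    hGrad Ω hφ.toH = (hφ.memLp_gradient 2).toLp (∇ φ) := rfl

theorem IsTestFunction.coeFn_hIncl {φ : EuclideanSpace ℝ (Fin d) → ℝ} (hφ : IsTestFunction Ω φ) :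
    hIncl Ω hφ.toH =ᵐ[volume.restrict Ω] φ := (hφ.memLp 2).coeFn_toLp

theorem IsTestFunction.coeFn_hGrad {φ : EuclideanSpace ℝ (Fin d) → ℝ} (hφ : IsTestFunction Ω φ) :
    hGrad Ω hφ.toH =ᵐ[volume.restrict Ω] ∇ φ := (hφ.memLp_gradient 2).coeFn_toLp

theorem denseRange_toH (v : HZeroOne Ω) {ε : ℝ} (hε : 0 < ε) :
    ∃ (φ : EuclideanSpace ℝ (Fin d) → ℝ) (hφ : IsTestFunction Ω φ), ‖v - hφ.toH‖ < ε := by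
  obtain ⟨p, ⟨φ, hφ, h1, h2⟩, hp⟩ := Metric.mem_closure_iff.1 v.2 ε hε
  refine ⟨φ, hφ, ?_⟩
  have e : p = hφ.toH.1 := by
    have e1 : p.fst = (hφ.memLp 2).toLp φ := Lp.ext (h1.trans (hφ.memLp 2).coeFn_toLp.symm)
    have e2 : p.snd = (hφ.memLp_gradient 2).toLp (∇ φ) :=
      Lp.ext (h2.trans (hφ.memLp_gradient 2).coeFn_toLp.symm)
    change p = WithLp.toLp 2 ((hφ.memLp 2).toLp φ, (hφ.memLp_gradient 2).toLp (∇ φ))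
    rw [← e1, ← e2]
    rfl
  rw [e, dist_eq_norm] at hp
  exact hp

/-- A closed condition that holds for test functions holds on `H_0^1(Ω)`. -/
theorem hZeroOne_induction {p : HZeroOne Ω → Prop} (hc : IsClosed {v | p v})
    (ht : ∀ φ (hφ : IsTestFunction Ω φ), p hφ.toH) (v : HZeroOne Ω) : p v := by
  have : v ∈ closure {v | p v} := Metric.mem_closure_iff.2 fun ε hε => by
    obtain ⟨φ, hφ, h⟩ := denseRange_toH v hε
    exact ⟨hφ.toH, ht φ hφ, by rwa [dist_eq_norm]⟩
  rw [hc.closure_eq] at this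
  exact this

/-- For test functions this is integration by parts, and both sides are continuous in the `H¹` norm.
-/
theorem isWeakGradient_hGrad (v : HZeroOne Ω) : IsWeakGradient Ω (hIncl Ω v) (hGrad Ω v) := by
  rw [isWeakGradient_iff]
  intro φ hφ e
  have m1 : MemLp (fun x => inner ℝ (∇ φ x) e) 2 (volume.restrict Ω) :=
    (hφ.memLp_gradient 2).inner_const e
  have m2 : MemLp (fun x => φ x • e) 2 (volume.restrict Ω) := by
    refine MemLp.restrict Ω (Continuous.memLp_of_hasCompactSupport ?_ ?_)
    · exact hφ.1.continuous.smul continuous_const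
    · exact hφ.2.1.smul_right
  have e1 : ∀ u : LTwo Ω, ∫ x in Ω, u x * inner ℝ (∇ φ x) e = inner ℝ (m1.toLp _) u := fun u => by
    rw [L2.inner_def]
    refine integral_congr_ae ?_
    filter_upwards [m1.coeFn_toLp] with x hx
    rw [hx]
    simp
  have e2 : ∀ g : LTwoField Ω, ∫ x in Ω, φ x * inner ℝ (g x) e = inner ℝ (m2.toLp _) g := fun g => by
    rw [L2.inner_def]
    refine integral_congr_ae ?_
    filter_upwards [m2.coeFn_toLp] with x hx
    rw [hx, inner_smul_left, real_inner_comm]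
    simp
  refine hZeroOne_induction (p := fun v => ∫ x in Ω, (hIncl Ω v) x * inner ℝ (∇ φ x) e
    = -∫ x in Ω, φ x * inner ℝ ((hGrad Ω v) x) e) ?_ (fun ψ hψ => ?_) v
  · simp only [e1, e2]
    refine isClosed_eq ?_ ?_
    · exact continuous_const.inner (hIncl Ω).continuous
    · exact (continuous_const.inner (hGrad Ω).continuous).neg
  · rw [hψ.hIncl_toH, hψ.hGrad_toH]
    have h := hφ.integral_mul_gradient hψ e
    convert h using 1
    · refine integral_congr_ae ?_
      filter_upwards [(hψ.memLp 2).coeFn_toLp] with x hx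
      rw [hx]
    · congr 1
      refine integral_congr_ae ?_
      filter_upwards [(hψ.memLp_gradient 2).coeFn_toLp] with x hx
      rw [hx]

theorem eLpNorm_sub_eq_enorm {F : Type*} [NormedAddCommGroup F]
    {f : EuclideanSpace ℝ (Fin d) → F} (hf : MemLp f 2 (volume.restrict Ω))
    (u : Lp F 2 (volume.restrict Ω)) :
    eLpNorm (fun x => u x - f x) 2 (volume.restrict Ω) = ‖u - hf.toLp f‖ₑ := by
  rw [Lp.enorm_def]
  refine eLpNorm_congr_ae ?_
  filter_upwards [hf.coeFn_toLp, Lp.coeFn_sub u (hf.toLp f)] with x h1 h2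
  rw [h2, Pi.sub_apply, h1]

theorem isHZeroOne_iff {u : LTwo Ω} {g : LTwoField Ω} :
    IsHZeroOne Ω u g ↔ ∃ v : HZeroOne Ω, hIncl Ω v = u ∧ hGrad Ω v = g := by
  constructor
  · rintro ⟨-, h⟩
    refine ⟨⟨WithLp.toLp 2 (u, g), Metric.mem_closure_iff.2 fun ε hε => ?_⟩, rfl, rfl⟩
    obtain ⟨φ, hφ, h1, h2⟩ := h (ENNReal.ofReal (ε / 2)) (by simpa using hε)
    rw [eLpNorm_sub_eq_enorm (hφ.memLp 2), ← ofReal_norm,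
      ENNReal.ofReal_lt_ofReal_iff (half_pos hε)] at h1
    rw [eLpNorm_sub_eq_enorm (hφ.memLp_gradient 2), ← ofReal_norm,
      ENNReal.ofReal_lt_ofReal_iff (half_pos hε)] at h2
    refine ⟨hφ.toH.1, ⟨φ, hφ, (hφ.memLp 2).coeFn_toLp, (hφ.memLp_gradient 2).coeFn_toLp⟩, ?_⟩
    rw [dist_eq_norm]
    refine lt_of_pow_lt_pow_left₀ 2 hε.le ?_
    have h3 := WithLp.prod_norm_sq_eq_of_L2 (WithLp.toLp 2 (u, g) - hφ.toH.1)
    have h4 : (WithLp.toLp 2 (u, g) - hφ.toH.1).fst = u - (hφ.memLp 2).toLp φ := rfl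
    have h5 : (WithLp.toLp 2 (u, g) - hφ.toH.1).snd = g - (hφ.memLp_gradient 2).toLp (∇ φ) := rfl
    rw [h4, h5] at h3
    rw [h3]
    nlinarith [norm_nonneg (u - (hφ.memLp 2).toLp φ),
      norm_nonneg (g - (hφ.memLp_gradient 2).toLp (∇ φ))]
  · rintro ⟨v, rfl, rfl⟩
    refine ⟨isWeakGradient_hGrad v, fun ε hε => ?_⟩
    obtain ⟨δ, hδ, hδε⟩ : ∃ δ : ℝ, 0 < δ ∧ ENNReal.ofReal δ ≤ ε := by
      rcases eq_or_ne ε ⊤ with rfl | h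
      · exact ⟨1, one_pos, le_top⟩
      · exact ⟨ε.toReal, ENNReal.toReal_pos hε.ne' h, (ENNReal.ofReal_toReal h).le⟩
    obtain ⟨φ, hφ, h⟩ := denseRange_toH v hδ
    refine ⟨φ, hφ, ?_, ?_⟩
    · rw [eLpNorm_sub_eq_enorm (hφ.memLp 2), ← ofReal_norm]
      refine lt_of_lt_of_le ((ENNReal.ofReal_lt_ofReal_iff hδ).2 (lt_of_le_of_lt ?_ h)) hδε
      exact norm_map_sub_le_of_norm_map_le (hIncl Ω) norm_hIncl_le v hφ.toH
    · rw [eLpNorm_sub_eq_enorm (hφ.memLp_gradient 2), ← ofReal_norm]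
      refine lt_of_lt_of_le ((ENNReal.ofReal_lt_ofReal_iff hδ).2 (lt_of_le_of_lt ?_ h)) hδε
      exact norm_map_sub_le_of_norm_map_le (hGrad Ω) norm_hGrad_le v hφ.toH

attribute [irreducible] IsTestFunction.toH hIncl hGrad

theorem dirichletLaplacianRel_iff {u h : LTwo Ω} :
    DirichletLaplacianRel Ω u h ↔ FormRel (hIncl Ω) (hGrad Ω) u h := by
  constructor
  · rintro ⟨g, hg, H⟩
    obtain ⟨v, hv, rfl⟩ := isHZeroOne_iff.1 hg
    exact ⟨v, hv, fun w => H _ _ (isHZeroOne_iff.2 ⟨w, rfl, rfl⟩)⟩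
  · rintro ⟨v, hv, H⟩
    refine ⟨hGrad Ω v, isHZeroOne_iff.2 ⟨v, hv, rfl⟩, fun w k hw => ?_⟩
    obtain ⟨z, rfl, rfl⟩ := isHZeroOne_iff.1 hw
    exact H z

variable [IsFiniteMeasure (volume.restrict Ω)]

/-- Closability of the gradient: the weak gradient of `0` is `0`, so a pair in the closure is
determined by its first component. -/
theorem hIncl_injective (hΩ : IsOpen Ω) (v : HZeroOne Ω) (hv : hIncl Ω v = 0) : v = 0 := by
  have h1 := isWeakGradient_hGrad v
  have h2 : hGrad Ω v = 0 := by
    rw [Lp.eq_zero_iff_ae_eq_zero]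
    refine ae_eq_zero_of_integral_test_eq_zero hΩ (Lp.memLp _) fun φ hφ => ?_
    have h3 := h1 φ hφ
    rw [hv] at h3
    have h4 : ∫ x in Ω, (0 : LTwo Ω) x • ∇ φ x = 0 := by
      refine integral_eq_zero_of_ae ?_
      filter_upwards [Lp.coeFn_zero ℝ 2 (volume.restrict Ω)] with x hx
      rw [hx]
      simp
    rw [h4] at h3
    exact neg_eq_zero.1 h3.symm
  have h3 := hZeroOne_norm_sq v
  rw [hv, h2] at h3
  simpa using h3

theorem eq_zero_of_inner_hIncl_eq_zero (hΩ : IsOpen Ω) (G : LTwo Ω)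
    (hG : ∀ w, inner ℝ G (hIncl Ω w) = 0) : G = 0 := by
  rw [Lp.eq_zero_iff_ae_eq_zero]
  refine ae_eq_zero_of_integral_test_eq_zero hΩ (Lp.memLp _) fun φ hφ => ?_
  rw [← hG hφ.toH, hφ.hIncl_toH, L2.inner_def]
  refine integral_congr_ae ?_
  filter_upwards [(hφ.memLp 2).coeFn_toLp] with x hx
  rw [hx]
  simp

end Sobolev

/-! ### The Dirichlet resolvents are sub-Markovian -/

/-- If competitors of the minimization problem can be moved into a closed set `C` without increasing
the energy, then the minimizer lies in `C`. -/
theorem formResolvent_mem_of_isClosed {V H K : Type*} [NormedAddCommGroup V]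
    [InnerProductSpace ℝ V] [CompleteSpace V] [NormedAddCommGroup H] [InnerProductSpace ℝ H]
    [CompleteSpace H] [NormedAddCommGroup K] [InnerProductSpace ℝ K] {i : V →L[ℝ] H}
    {q : V →L[ℝ] K} (hn : ∀ v, ‖v‖ ^ 2 = ‖i v‖ ^ 2 + ‖q v‖ ^ 2) {b : ℝ} (hb : 0 < b) {F : H}
    {C : Set H} (hC : IsClosed C) (h : ∀ v : V, ∀ ρ : ℝ, 0 < ρ → ∃ w₀ w : V, ‖v - w₀‖ < ρ ∧
      ‖q w‖ ≤ ‖q w₀‖ ∧ ‖i w - F‖ ≤ ‖i w₀ - F‖ ∧ i w ∈ C) : formResolvent hn b F ∈ C := by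
  set v := formSolution i q hn b F with hv
  rw [← hC.closure_eq]
  refine Metric.mem_closure_iff.2 fun δ hδ => ?_
  have hcont : Continuous fun w : V => ‖q w‖ ^ 2 + b * ‖i w - F‖ ^ 2 := by fun_prop
  -- The energy of `w₀`, hence that of `w`, exceeds the minimum by less than `b δ²`; by
  -- `form_energy_eq` this excess dominates `b ‖i (w - v)‖²`. The intermediate `w₀` is there because
  -- competitors can be built only near `v`, from test functions.
  obtain ⟨ρ, hρ, hQ⟩ := Metric.continuousAt_iff.1 (hcont.continuousAt (x := v)) (b * δ ^ 2)
    (mul_pos hb (pow_pos hδ 2))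
  obtain ⟨w₀, w, h1, h2, h3, h4⟩ := h v ρ hρ
  refine ⟨i w, h4, ?_⟩
  have h5 := hQ (x := w₀) (by rwa [dist_eq_norm, norm_sub_rev])
  rw [Real.dist_eq] at h5
  have h6 := (abs_lt.1 h5).2
  have h7 := form_energy_eq hn hb F w
  rw [← hv] at h7
  have h8 : ‖q w‖ ^ 2 + b * ‖i w - F‖ ^ 2 ≤ ‖q w₀‖ ^ 2 + b * ‖i w₀ - F‖ ^ 2 := by gcongr
  have h9 : b * ‖i (w - v)‖ ^ 2 < b * δ ^ 2 := by
    have := sq_nonneg ‖q (w - v)‖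
    linarith
  have h10 : ‖i (w - v)‖ < δ :=
    lt_of_pow_lt_pow_left₀ 2 hδ.le (lt_of_mul_lt_mul_left h9 hb.le)
  rw [map_sub, norm_sub_rev] at h10
  rw [dist_eq_norm]
  exact h10

/-- A smooth contraction of the line that is the identity on `[0, 1]` and almost maps to it. -/
theorem exists_smooth_clamp {ε : ℝ} (hε : 0 < ε) : ∃ η : ℝ → ℝ, ContDiff ℝ ∞ η ∧ η 0 = 0 ∧
    (∀ x ∈ Icc (0 : ℝ) 1, η x = x) ∧ (∀ x, -ε ≤ η x ∧ η x ≤ 1 + ε) ∧ (∀ x, |deriv η x| ≤ 1) ∧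
    ∀ x y, |η x - η y| ≤ |x - y| := by
  -- The clamp is the primitive of a bump equal to `1` on `[0, 1]` and to `0` outside `(-ε, 1 + ε)`,
  -- so its slope stays in `[0, 1]`.
  let χ : ContDiffBump (1 / 2 : ℝ) := ⟨1 / 2, 1 / 2 + ε, by norm_num, by linarith⟩
  have hχc : Continuous χ := χ.continuous
  let η : ℝ → ℝ := fun x => ∫ y in (0 : ℝ)..x, χ y
  have hd : ∀ x, HasDerivAt η (χ x) x := fun x =>
    intervalIntegral.integral_hasDerivAt_right (hχc.intervalIntegrable _ _)
      (hχc.stronglyMeasurableAtFilter _ _) hχc.continuousAt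
  have hderiv : deriv η = χ := funext fun x => (hd x).deriv
  have habs : ∀ x, |deriv η x| ≤ 1 := fun x => by
    rw [hderiv, abs_of_nonneg χ.nonneg]
    exact χ.le_one
  have hlip : ∀ x y, |η x - η y| ≤ |x - y| := fun x y => by
    have := (convex_univ (𝕜 := ℝ) (E := ℝ)).norm_image_sub_le_of_norm_deriv_le (f := η) (C := 1)
      (fun x _ => (hd x).differentiableAt) (fun x _ => habs x) (mem_univ y) (mem_univ x)
    simpa using this
  have h0 : η 0 = 0 := intervalIntegral.integral_same
  have hmono : Monotone η := monotone_of_deriv_nonneg (fun x => (hd x).differentiableAt) fun x => by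
    rw [hderiv]
    exact χ.nonneg
  have hid : ∀ x ∈ Icc (0 : ℝ) 1, η x = x := fun x hx => by
    have : ∫ y in (0 : ℝ)..x, χ y = ∫ _ in (0 : ℝ)..x, (1 : ℝ) := by
      refine intervalIntegral.integral_congr fun y hy => ?_
      rw [uIcc_of_le hx.1] at hy
      refine χ.one_of_mem_closedBall ?_
      rw [Metric.mem_closedBall, Real.dist_eq, abs_le]
      change -(1 / 2 : ℝ) ≤ _ ∧ _ ≤ (1 / 2 : ℝ)
      constructor <;> linarith [hy.1, hy.2, hx.2]
    simp only [η]
    rw [this]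
    simp
  have hz : ∀ a b : ℝ, (∀ y ∈ uIcc a b, χ y = 0) → η b = η a := fun a b h => by
    have h1 : ∫ y in a..b, χ y = 0 := by
      rw [intervalIntegral.integral_congr (g := fun _ => (0 : ℝ)) h]
      simp
    have h2 := intervalIntegral.integral_add_adjacent_intervals
      (hχc.intervalIntegrable (μ := volume) 0 a) (hχc.intervalIntegrable (μ := volume) a b)
    simp only [η]
    rw [← h2, h1, add_zero]
  have hout : ∀ y : ℝ, (1 / 2 + ε ≤ |y - 1 / 2|) → χ y = 0 := fun y hy =>
    χ.zero_of_le_dist (by rwa [Real.dist_eq])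
  refine ⟨η, ?_, h0, hid, fun x => ⟨?_, ?_⟩, habs, hlip⟩
  · rw [contDiff_infty_iff_deriv, hderiv]
    exact ⟨fun x => (hd x).differentiableAt, χ.contDiff⟩
  · have h1 : -ε ≤ η (-ε) := by
      have := hlip 0 (-ε)
      rw [h0, zero_sub, zero_sub, neg_neg, abs_neg, abs_of_pos hε] at this
      exact neg_le_of_abs_le this
    rcases le_total (-ε) x with h | h
    · exact h1.trans (hmono h)
    · rw [hz (-ε) x fun y hy => hout y (by
        rw [uIcc_of_ge h] at hy
        rw [abs_sub_comm]
        exact le_trans (by linarith [hy.2]) (le_abs_self _))]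
      exact h1
  · have h1 : η (1 + ε) ≤ 1 + ε := by
      have := hlip (1 + ε) 0
      rw [h0, sub_zero, sub_zero, abs_of_pos (by linarith : 0 < 1 + ε)] at this
      exact le_of_abs_le this
    rcases le_total x (1 + ε) with h | h
    · exact (hmono h).trans h1
    · rw [hz (1 + ε) x fun y hy => hout y (by
        rw [uIcc_of_le h] at hy
        exact le_trans (by linarith [hy.1]) (le_abs_self _))]
      exact h1

section Resolvent

variable {d : ℕ} {Ω : Set (EuclideanSpace ℝ (Fin d))} [IsFiniteMeasure (volume.restrict Ω)]

/-- The normalized resolvents of the Dirichlet Laplacian. -/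
noncomputable def dirichletResolvent (Ω : Set (EuclideanSpace ℝ (Fin d))) (b : ℝ) :
    LTwo Ω →L[ℝ] LTwo Ω :=
  formResolvent (i := hIncl Ω) (q := hGrad Ω) hZeroOne_norm_sq b

omit [IsFiniteMeasure (volume.restrict Ω)] in
theorem IsTestFunction.norm_hGrad_comp_le {φ : EuclideanSpace ℝ (Fin d) → ℝ}
    (hφ : IsTestFunction Ω φ) {η : ℝ → ℝ} (hη : ContDiff ℝ ∞ η) (h0 : η 0 = 0)
    (hder : ∀ x, |deriv η x| ≤ 1) : ‖hGrad Ω (hφ.comp hη h0).toH‖ ≤ ‖hGrad Ω hφ.toH‖ := by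
  refine Lp.norm_le_norm_of_ae_le ?_
  filter_upwards [hφ.coeFn_hGrad, (hφ.comp hη h0).coeFn_hGrad] with x h1 h2
  rw [h1, h2]
  exact hφ.norm_gradient_comp_le hη hder x

omit [IsFiniteMeasure (volume.restrict Ω)] in
theorem IsTestFunction.norm_hIncl_comp_sub_le {φ : EuclideanSpace ℝ (Fin d) → ℝ}
    (hφ : IsTestFunction Ω φ) {F : LTwo Ω} (hF : ∀ᵐ x ∂(volume.restrict Ω), F x ∈ Icc (0 : ℝ) 1)
    {η : ℝ → ℝ} (hη : ContDiff ℝ ∞ η) (h0 : η 0 = 0) (hid : ∀ x ∈ Icc (0 : ℝ) 1, η x = x)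
    (hlip : ∀ x y, |η x - η y| ≤ |x - y|) :
    ‖hIncl Ω (hφ.comp hη h0).toH - F‖ ≤ ‖hIncl Ω hφ.toH - F‖ := by
  refine Lp.norm_le_norm_of_ae_le ?_
  filter_upwards [hφ.coeFn_hIncl, (hφ.comp hη h0).coeFn_hIncl, Lp.coeFn_sub (hIncl Ω hφ.toH) F,
    Lp.coeFn_sub (hIncl Ω (hφ.comp hη h0).toH) F, hF] with x h1 h2 h3 h4 h5
  rw [h3, h4, Pi.sub_apply, Pi.sub_apply, h1, h2, Function.comp_apply]
  have := hlip (φ x) (F x)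
  rwa [hid _ h5] at this

theorem IsTestFunction.hIncl_comp_mem_Icc {φ : EuclideanSpace ℝ (Fin d) → ℝ}
    (hφ : IsTestFunction Ω φ) {ε : ℝ} {η : ℝ → ℝ} (hη : ContDiff ℝ ∞ η) (h0 : η 0 = 0)
    (hbd : ∀ x, -ε ≤ η x ∧ η x ≤ 1 + ε) : hIncl Ω (hφ.comp hη h0).toH
        ∈ Icc (constLTwo (volume.restrict Ω) (-ε)) (constLTwo (volume.restrict Ω) (1 + ε)) := by
  rw [mem_Icc_constLTwo_iff]
  filter_upwards [(hφ.comp hη h0).coeFn_hIncl] with x h1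
  rw [h1]
  exact hbd _

/-- The competitor is `η ∘ φ`: the bound on `η'` controls the gradient, and the distance to `F` does
not grow because `η` is 1-Lipschitz and fixes the values of `F`. Smoothness of `η` keeps it a test
function. -/
theorem IsTestFunction.exists_competitor {φ : EuclideanSpace ℝ (Fin d) → ℝ}
    (hφ : IsTestFunction Ω φ) {F : LTwo Ω}
    (hF : F ∈ Icc (constLTwo (volume.restrict Ω) 0) (constLTwo (volume.restrict Ω) 1))
    {ε : ℝ} {η : ℝ → ℝ} (hη : ContDiff ℝ ∞ η) (h0 : η 0 = 0) (hid : ∀ x ∈ Icc (0 : ℝ) 1, η x = x)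
    (hbd : ∀ x, -ε ≤ η x ∧ η x ≤ 1 + ε) (hder : ∀ x, |deriv η x| ≤ 1)
    (hlip : ∀ x y, |η x - η y| ≤ |x - y|) :
    ∃ w : HZeroOne Ω, ‖hGrad Ω w‖ ≤ ‖hGrad Ω hφ.toH‖ ∧
      ‖hIncl Ω w - F‖ ≤ ‖hIncl Ω hφ.toH - F‖ ∧ hIncl Ω w
        ∈ Icc (constLTwo (volume.restrict Ω) (-ε)) (constLTwo (volume.restrict Ω) (1 + ε)) := by
  have h1 := hφ.norm_hGrad_comp_le hη h0 hder
  have h2 := hφ.norm_hIncl_comp_sub_le (mem_Icc_constLTwo_iff.1 hF) hη h0 hid hlip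
  have h3 := hφ.hIncl_comp_mem_Icc hη h0 hbd
  exact ⟨_, h1, h2, h3⟩

/-- The minimizer inherits the bounds of the clamped competitors. A smooth clamp reaches only `[-ε,
1 + ε]`, so `ε` runs through `1/(n+1)` at the end. -/
theorem isSubMarkovOp_dirichletResolvent {b : ℝ} (hb : 0 < b) :
    IsSubMarkovOp (dirichletResolvent Ω b) := by
  intro F hF
  have key : ∀ ε : ℝ, 0 < ε → dirichletResolvent Ω b F
      ∈ Icc (constLTwo (volume.restrict Ω) (-ε)) (constLTwo (volume.restrict Ω) (1 + ε)) :=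
    fun ε hε => by
      obtain ⟨η, hη, h0, hid, hbd, hder, hlip⟩ := exists_smooth_clamp hε
      exact formResolvent_mem_of_isClosed hZeroOne_norm_sq hb isClosed_Icc
        fun v ρ hρ => (denseRange_toH v hρ).elim fun φ h => h.elim fun hφ h =>
          (hφ.exists_competitor hF hη h0 hid hbd hder hlip).elim fun w hw => ⟨hφ.toH, w, h, hw⟩
  rw [mem_Icc_constLTwo_iff]
  have h1 : ∀ᵐ x ∂(volume.restrict Ω), ∀ n : ℕ, -(1 / ((n : ℝ) + 1)) ≤ dirichletResolvent Ω b F x ∧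
      dirichletResolvent Ω b F x ≤ 1 + 1 / ((n : ℝ) + 1) :=
    ae_all_iff.2 fun n => mem_Icc_constLTwo_iff.1 (key _ Nat.one_div_pos_of_nat)
  filter_upwards [h1] with x hx
  have ht := tendsto_one_div_add_atTop_nhds_zero_nat (𝕜 := ℝ)
  constructor
  · have := ht.neg
    rw [neg_zero] at this
    exact le_of_tendsto' this fun n => (hx n).1
  · have := ht.const_add 1
    rw [add_zero] at this
    exact ge_of_tendsto' this fun n => (hx n).2

theorem isResolventFamily_dirichletResolvent (hΩ : IsOpen Ω) :
    IsResolventFamily (DirichletLaplacianRel Ω) (dirichletResolvent Ω) := by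
  have h : DirichletLaplacianRel Ω = FormRel (hIncl Ω) (hGrad Ω) := by
    funext u h
    exact propext dirichletLaplacianRel_iff
  rw [h]
  exact isResolventFamily_formResolvent hZeroOne_norm_sq (hIncl_injective hΩ)
    (eq_zero_of_inner_hIncl_eq_zero hΩ)

end Resolvent

/-! ### The norm of `L¹` on `L²` -/

section LOne

variable {X : Type*} [MeasurableSpace X] {μ : Measure X} [IsFiniteMeasure μ]

/-- The `L¹` norm of an element of `L²`. -/
noncomputable def lOne (u : Lp ℝ 2 μ) : ℝ := inner ℝ (constLTwo μ 1) |u|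

theorem lOne_eq_integral (u : Lp ℝ 2 μ) : lOne u = ∫ x, |u x| ∂μ := by
  rw [lOne, L2.inner_def]
  refine integral_congr_ae ?_
  filter_upwards [Lp.coeFn_const 2 μ (1 : ℝ), Lp.coeFn_abs u] with x h1 h2
  rw [h1, h2]
  simp

theorem ofReal_lOne (u : Lp ℝ 2 μ) : ENNReal.ofReal (lOne u) = eLpNorm u 1 μ := by
  have hi : Integrable u μ := (Lp.memLp u).integrable (by norm_num)
  rw [lOne_eq_integral, eLpNorm_one_eq_lintegral_enorm, ← ofReal_integral_norm_eq_lintegral_enorm hi]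
  rfl

theorem lOne_nonneg (u : Lp ℝ 2 μ) : 0 ≤ lOne u := by
  rw [lOne_eq_integral]
  exact integral_nonneg fun x => abs_nonneg _

theorem continuous_lOne : Continuous (lOne : Lp ℝ 2 μ → ℝ) :=
  continuous_const.inner (continuous_id.sup continuous_neg)

theorem lOne_smul (c : ℝ) (u : Lp ℝ 2 μ) : lOne (c • u) = |c| * lOne u := by
  rw [lOne_eq_integral, lOne_eq_integral, ← integral_const_mul]
  refine integral_congr_ae ?_
  filter_upwards [Lp.coeFn_smul c u] with x hx
  rw [hx, Pi.smul_apply, smul_eq_mul, abs_mul]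

/-- Symmetric sub-Markovian operators are contractions for the `L¹` norm. -/
theorem IsSubMarkovOp.lOne_apply_le {T : Lp ℝ 2 μ →L[ℝ] Lp ℝ 2 μ} (hT : IsSubMarkovOp T)
    (hs : ∀ u v, inner ℝ (T u) v = inner ℝ u (T v)) (u : Lp ℝ 2 μ) : lOne (T u) ≤ lOne u := by
  have hw : StronglyMeasurable (T u : X → ℝ) := Lp.stronglyMeasurable _
  have hA : MeasurableSet {x | 0 < T u x} := measurableSet_lt measurable_const hw.measurable
  have hB : MeasurableSet {x | T u x < 0} := measurableSet_lt hw.measurable measurable_const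
  have hind : ∀ {S : Set X} (hS : MeasurableSet S),
      indicatorConstLp 2 hS (measure_ne_top μ S) (1 : ℝ) ∈ Icc (constLTwo μ 0) (constLTwo μ 1) :=
    fun {S} hS => by
      rw [mem_Icc_constLTwo_iff]
      filter_upwards [indicatorConstLp_coeFn (p := 2) (hs := hS) (hμs := measure_ne_top μ S)
        (c := (1 : ℝ))] with x hx
      rw [hx]
      by_cases h : x ∈ S <;> simp [h]
  -- Duality: `a - b` is the sign of `T u`. Symmetry moves `T` onto it, and `T a`, `T b` have values
  -- in `[0, 1]`, whence `|T a - T b| ≤ 1`.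
  set a := indicatorConstLp 2 hA (measure_ne_top μ _) (1 : ℝ) with ha
  set b := indicatorConstLp 2 hB (measure_ne_top μ _) (1 : ℝ) with hb
  have e1 : lOne (T u) = inner ℝ (T u) (a - b) := by
    rw [lOne_eq_integral, L2.inner_def]
    refine integral_congr_ae ?_
    filter_upwards [Lp.coeFn_sub a b, indicatorConstLp_coeFn (p := 2) (hs := hA)
      (hμs := measure_ne_top μ _) (c := (1 : ℝ)), indicatorConstLp_coeFn (p := 2) (hs := hB)
      (hμs := measure_ne_top μ _) (c := (1 : ℝ))] with x h1 h2 h3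
    rw [h1, Pi.sub_apply, ha, hb, h2, h3]
    rcases lt_trichotomy (T u x) 0 with h | h | h
    · simp [h, abs_of_neg h, not_lt.2 h.le]
    · simp [h]
    · simp [h, abs_of_pos h, not_lt.2 h.le]
  rw [e1, hs, lOne_eq_integral, L2.inner_def]
  refine integral_mono_ae (L2.integrable_inner _ _)
    (((Lp.memLp u).integrable (by norm_num)).abs) ?_
  filter_upwards [mem_Icc_constLTwo_iff.1 (hT (hind hA)), mem_Icc_constLTwo_iff.1 (hT (hind hB)),
    Lp.coeFn_sub (T a) (T b)] with x h1 h2 h3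
  rw [map_sub, h3, Pi.sub_apply]
  change (T a x - T b x) * u x ≤ |u x|
  have h4 : |T a x - T b x| ≤ 1 := abs_le.2 ⟨by linarith [h1.1, h2.2], by linarith [h1.2, h2.1]⟩
  calc _ ≤ |(T a x - T b x) * u x| := le_abs_self _
    _ = |T a x - T b x| * |u x| := abs_mul _ _
    _ ≤ 1 * |u x| := mul_le_mul_of_nonneg_right h4 (abs_nonneg _)
    _ = _ := one_mul _

end LOne

/-! ### The Poincaré and Nash inequalities -/

/-- Interpolation of `L²` between `L¹` and `L^r`. -/
theorem eLpNorm_two_sq_le {X : Type*} [MeasurableSpace X] {μ : Measure X} {f : X → ℝ}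
    (hf : AEStronglyMeasurable f μ) {r : ℝ≥0} {s : ℝ} (hr : r ≠ 0) (hs0 : 0 ≤ s) (hs1 : s ≤ 1)
    (hrs : s + r * (1 - s) = 2) :
    eLpNorm f 2 μ ^ (2 : ℝ) ≤ eLpNorm f 1 μ ^ s * eLpNorm f r μ ^ (2 - s) := by
  have hr' : (r : ℝ) ≠ 0 := by exact_mod_cast hr
  -- Hölder for `|f|^s` and `(|f|^r)^(1-s)`, whose product is `|f|²`; the `L^r` norm then appears
  -- with exponent `r (1 - s) = 2 - s`.
  have h := ENNReal.lintegral_mul_norm_pow_le (μ := μ) hf.enorm (hf.enorm.pow_const (r : ℝ)) hs0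
    (sub_nonneg.2 hs1) (add_sub_cancel s 1)
  have e1 : ∀ x, ‖f x‖ₑ ^ s * (‖f x‖ₑ ^ (r : ℝ)) ^ (1 - s) = ‖f x‖ₑ ^ (2 : ℝ) := fun x => by
    rw [← ENNReal.rpow_mul, ← ENNReal.rpow_add_of_nonneg _ _ hs0
      (mul_nonneg (NNReal.coe_nonneg r) (sub_nonneg.2 hs1)), hrs]
  simp only [e1] at h
  rw [eLpNorm_one_eq_lintegral_enorm,
    eLpNorm_eq_lintegral_rpow_enorm_toReal two_ne_zero ENNReal.ofNat_ne_top,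
    eLpNorm_eq_lintegral_rpow_enorm_toReal (by exact_mod_cast hr) ENNReal.coe_ne_top,
    ← ENNReal.rpow_mul, ← ENNReal.rpow_mul]
  refine Eq.trans_le ?_ (h.trans_eq ?_)
  · norm_num
  · congr 2
    rw [ENNReal.coe_toReal, ← hrs]
    field_simp
    ring

theorem ofReal_lOne_eq {X : Type*} [MeasurableSpace X] {μ : Measure X} [IsFiniteMeasure μ]
    {u : Lp ℝ 2 μ} {f : X → ℝ} (h : u =ᵐ[μ] f) : ENNReal.ofReal (lOne u) = eLpNorm f 1 μ :=
  (ofReal_lOne u).trans (eLpNorm_congr_ae h)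

variable {d : ℕ} {Ω : Set (EuclideanSpace ℝ (Fin d))}

/-- The Gagliardo-Nirenberg-Sobolev inequality with `p = 2 < d`. It serves twice: `q = 2` for
Poincaré and the critical `q = 2d/(d-2)` for Nash. -/
theorem exists_sobolev_const (hd : 3 ≤ d) (hb : Bornology.IsBounded Ω) {q : ℝ≥0}
    (hq : (2 : ℝ)⁻¹ - (d : ℝ)⁻¹ ≤ (q : ℝ)⁻¹) : ∃ C : ℝ≥0, ∀ φ, IsTestFunction Ω φ →
      eLpNorm φ q (volume.restrict Ω) ≤ C * eLpNorm (∇ φ) 2 (volume.restrict Ω) := by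
  refine ⟨eLpNormLESNormFDerivOfLeConst ℝ (volume : Measure (EuclideanSpace ℝ (Fin d))) Ω 2 q,
    fun φ hφ => ?_⟩
  have hsupp : Function.support φ ⊆ Ω := (subset_tsupport φ).trans hφ.2.2
  have h := eLpNorm_le_eLpNorm_fderiv_of_le (volume : Measure (EuclideanSpace ℝ (Fin d)))
    (hφ.1.of_le (by simp)) hsupp (p := 2) (q := q) one_le_two
    (by rw [finrank_euclideanSpace_fin]; exact_mod_cast hd)
    (by rw [finrank_euclideanSpace_fin]; exact_mod_cast hq) hb
  have e1 : eLpNorm (∇ φ) 2 (volume.restrict Ω) = eLpNorm (fderiv ℝ φ) (2 : ℝ≥0) volume := by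
    have hg : Function.support (∇ φ) ⊆ Ω := fun x hx => by
      refine hφ.2.2 (tsupport_fderiv_subset ℝ (subset_tsupport _ fun h0 => hx ?_))
      rw [← norm_eq_zero, norm_gradient, h0, norm_zero]
    rw [eLpNorm_restrict_eq_of_support_subset hg]
    exact eLpNorm_congr_norm_ae (Eventually.of_forall (norm_gradient φ))
  rw [e1]
  exact (eLpNorm_mono_measure _ Measure.restrict_le_self).trans h

theorem IsTestFunction.ofReal_norm_hIncl {φ : EuclideanSpace ℝ (Fin d) → ℝ}
    (hφ : IsTestFunction Ω φ) :
    ENNReal.ofReal ‖hIncl Ω hφ.toH‖ = eLpNorm φ 2 (volume.restrict Ω) := by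
  rw [hφ.hIncl_toH, ofReal_norm, Lp.enorm_toLp]

theorem IsTestFunction.ofReal_norm_hGrad {φ : EuclideanSpace ℝ (Fin d) → ℝ}
    (hφ : IsTestFunction Ω φ) :
    ENNReal.ofReal ‖hGrad Ω hφ.toH‖ = eLpNorm (∇ φ) 2 (volume.restrict Ω) := by
  rw [hφ.hGrad_toH, ofReal_norm, Lp.enorm_toLp]

theorem exists_poincare (hd : 3 ≤ d) (hb : Bornology.IsBounded Ω) :
    ∃ C : ℝ, 0 < C ∧ ∀ v : HZeroOne Ω, ‖hIncl Ω v‖ ≤ C * ‖hGrad Ω v‖ := by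
  obtain ⟨C, hC⟩ := exists_sobolev_const hd hb (q := 2) (by simp)
  -- The constant `C` could be `0`; `C + 1` is positive.
  refine ⟨C + 1, by positivity, hZeroOne_induction ?_ fun φ hφ => ?_⟩
  · exact isClosed_le (hIncl Ω).continuous.norm (continuous_const.mul (hGrad Ω).continuous.norm)
  · rw [← ENNReal.ofReal_le_ofReal_iff (by positivity), ENNReal.ofReal_mul (by positivity),
      hφ.ofReal_norm_hIncl, hφ.ofReal_norm_hGrad]
    refine (hC φ hφ).trans ?_
    gcongr
    rw [← ENNReal.ofReal_coe_nnreal]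
    exact ENNReal.ofReal_le_ofReal (by simp)

theorem IsTestFunction.ofReal_lOne_hIncl [IsFiniteMeasure (volume.restrict Ω)]
    {φ : EuclideanSpace ℝ (Fin d) → ℝ} (hφ : IsTestFunction Ω φ) :
    ENNReal.ofReal (lOne (hIncl Ω hφ.toH)) = eLpNorm φ 1 (volume.restrict Ω) :=
  ofReal_lOne_eq hφ.coeFn_hIncl

theorem isClosed_setOf_nash [IsFiniteMeasure (volume.restrict Ω)] {s a C : ℝ} (hs : 0 ≤ s)
    (ha : 0 ≤ a) : IsClosed {v : HZeroOne Ω |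
      ‖hIncl Ω v‖ ^ (2 : ℝ) ≤ lOne (hIncl Ω v) ^ s * (C * ‖hGrad Ω v‖) ^ a} := by
  refine isClosed_le ((hIncl Ω).continuous.norm.rpow_const fun _ => Or.inr zero_le_two)
    (Continuous.mul ?_ ?_)
  · exact (continuous_lOne.comp (hIncl Ω).continuous).rpow_const fun _ => Or.inr hs
  · exact (continuous_const.mul (hGrad Ω).continuous.norm).rpow_const fun _ => Or.inr ha

theorem rpow_two_le_of_ofReal {x y z : ℝ} {C : ℝ≥0} {X Y Z : ℝ≥0∞} {r s : ℝ} (hx : 0 ≤ x)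
    (hy : 0 ≤ y) (hz : 0 ≤ z) (hs : 0 ≤ s) (hr : 0 ≤ r) (ex : ENNReal.ofReal x = X)
    (ey : ENNReal.ofReal y = Y) (ez : ENNReal.ofReal z = Z)
    {W : ℝ≥0∞} (hW : W ≤ C * Z) (h : X ^ (2 : ℝ) ≤ Y ^ s * W ^ r) :
    x ^ (2 : ℝ) ≤ y ^ s * ((C + 1) * z) ^ r := by
  have h1 : 0 ≤ ((C : ℝ) + 1) * z := by positivity
  rw [← ENNReal.ofReal_le_ofReal_iff (by positivity), ENNReal.ofReal_mul (by positivity),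
    ← ENNReal.ofReal_rpow_of_nonneg hx zero_le_two, ← ENNReal.ofReal_rpow_of_nonneg hy hs,
    ← ENNReal.ofReal_rpow_of_nonneg h1 hr, ENNReal.ofReal_mul (by positivity), ex, ey, ez]
  refine h.trans (mul_le_mul_right (ENNReal.rpow_le_rpow (hW.trans ?_) hr) _)
  gcongr
  rw [← ENNReal.ofReal_coe_nnreal]
  exact ENNReal.ofReal_le_ofReal (by simp)

/-- Interpolation with `r = 2d/(d-2)`; the equation `s + r (1 - s) = 2` then forces `s = 4/(d+2)`.
Sobolev bounds the `L^r` norm by the gradient, and the inequality is closed in `H¹`. -/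
theorem exists_nash (hd : 3 ≤ d) (hb : Bornology.IsBounded Ω)
    [IsFiniteMeasure (volume.restrict Ω)] :
    ∃ C : ℝ, 0 < C ∧ ∀ v : HZeroOne Ω, ‖hIncl Ω v‖ ^ (2 : ℝ) ≤
      lOne (hIncl Ω v) ^ (4 / ((d : ℝ) + 2)) * (C * ‖hGrad Ω v‖) ^ (2 - 4 / ((d : ℝ) + 2)) := by
  have hd' : (3 : ℝ) ≤ d := by exact_mod_cast hd
  have hs0 : 0 ≤ 4 / ((d : ℝ) + 2) := by positivity
  have hs1 : 4 / ((d : ℝ) + 2) ≤ 1 := by rw [div_le_one (by positivity)]; linarith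
  have hs2 : 0 ≤ 2 - 4 / ((d : ℝ) + 2) := by linarith
  obtain ⟨r, hr⟩ : ∃ r : ℝ≥0, (r : ℝ) = 2 * d / (d - 2) :=
    ⟨⟨2 * d / (d - 2), div_nonneg (by positivity) (by linarith)⟩, rfl⟩
  have hd2 : (d : ℝ) - 2 ≠ 0 := by linarith
  have hr0 : r ≠ 0 := by
    rw [← NNReal.coe_ne_zero, hr]
    exact div_ne_zero (by positivity) hd2
  have hrs : 4 / ((d : ℝ) + 2) + r * (1 - 4 / ((d : ℝ) + 2)) = 2 := by
    rw [hr]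
    field_simp
    ring
  obtain ⟨C, hC⟩ := exists_sobolev_const hd hb (q := r) (le_of_eq (by rw [hr]; field_simp))
  exact ⟨C + 1, by positivity, hZeroOne_induction (isClosed_setOf_nash hs0 hs2) fun φ hφ =>
    rpow_two_le_of_ofReal (norm_nonneg _) (lOne_nonneg _) (norm_nonneg _) hs0 hs2
      hφ.ofReal_norm_hIncl hφ.ofReal_lOne_hIncl hφ.ofReal_norm_hGrad (hC φ hφ)
      (eLpNorm_two_sq_le (hφ.memLp 2).1 hr0 hs0 hs1 hrs)⟩

/-! ### Decay and smoothing of contraction semigroups -/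

section Decay

variable {H : Type*} [NormedAddCommGroup H] [InnerProductSpace ℝ H]

theorem ContractionSemigroup.HasGenerator.const_smul {P : ContractionSemigroup H} {u h : H}
    (hu : P.HasGenerator u h) (c : ℝ) : P.HasGenerator (c • u) (c • h) := by
  refine (Tendsto.const_smul hu c).congr fun t => ?_
  rw [map_smul, ← smul_sub, smul_comm]

variable {P : ContractionSemigroup H}

theorem ContractionSemigroup.norm_apply_antitone (P : ContractionSemigroup H) (u : H) :
    Antitone fun t => ‖P.toFun t u‖ := fun s t hst => by
  obtain ⟨r, rfl⟩ := exists_add_of_le hst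
  change ‖P.toFun (s + r) u‖ ≤ ‖P.toFun s u‖
  rw [add_comm, P.map_add']
  exact P.norm_apply_le r _

/-- Exponential decay from a spectral gap. -/
theorem ContractionSemigroup.norm_apply_le_exp (hd : Dense {u | ∃ h, P.HasGenerator u h}) {c : ℝ}
    (hc : ∀ u h, P.HasGenerator u h → c * ‖u‖ ^ 2 ≤ -inner ℝ h u) (t : ℝ≥0) (u : H) :
    ‖P.toFun t u‖ ≤ Real.exp (-(c * t)) * ‖u‖ := by
  have hcl : IsClosed {u | ‖P.toFun t u‖ ≤ Real.exp (-(c * t)) * ‖u‖} :=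
    isClosed_le (P.toFun t).continuous.norm (continuous_const.mul continuous_norm)
  refine hcl.closure_subset_iff.2 (fun u hu => ?_) (hd u)
  obtain ⟨h, hu⟩ := hu
  have hexp : ∀ s : ℝ, HasDerivWithinAt (fun r : ℝ => Real.exp (2 * c * r))
      (Real.exp (2 * c * s) * (2 * c)) (Ici s) s := fun s => by
    have := ((hasDerivAt_id s).const_mul (2 * c)).exp
    simpa using this.hasDerivWithinAt
  -- On the domain, `e^{2cr} ‖P_r u‖²` has nonpositive right derivative.
  have hle := image_le_of_deriv_right_le_deriv_boundary
    (f := fun r : ℝ => Real.exp (2 * c * r) * ‖P.toFun r.toNNReal u‖ ^ 2)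
    (f' := fun s => Real.exp (2 * c * s) * (2 * c) * ‖P.toFun s.toNNReal u‖ ^ 2 +
      Real.exp (2 * c * s) * (2 * inner ℝ (P.toFun s.toNNReal u) (P.toFun s.toNNReal h)))
    (B := fun _ => ‖u‖ ^ 2) (B' := fun _ => 0) (a := 0) (b := (t : ℝ))
    (((by fun_prop : Continuous fun r : ℝ => Real.exp (2 * c * r)).mul
      ((P.continuous_real u).norm.pow 2)).continuousOn)
    (fun s hs => (hexp s).mul (hu.hasDerivWithinAt_norm_sq hs.1))
    (by simp [P.map_zero']) continuousOn_const (fun s _ => hasDerivWithinAt_const _ _ _)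
    (fun s hs => by
      have h1 := hc _ _ (hu.apply s.toNNReal)
      rw [real_inner_comm] at h1
      have h2 := mul_le_mul_of_nonneg_left h1 (Real.exp_pos (2 * c * s)).le
      linarith) (right_mem_Icc.2 t.2)
  simp only [Real.toNNReal_coe] at hle
  change ‖P.toFun t u‖ ≤ Real.exp (-(c * t)) * ‖u‖
  rw [← sq_le_sq₀ (norm_nonneg _) (by positivity), mul_pow, ← Real.exp_nat_mul]
  have h3 := mul_le_mul_of_nonneg_left hle (Real.exp_pos (-(2 * c * t))).le
  rw [← mul_assoc, ← Real.exp_add, neg_add_cancel, Real.exp_zero, one_mul] at h3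
  refine h3.trans_eq ?_
  congr 2
  push_cast
  ring

/-- Nash's argument on the domain of the generator. -/
theorem ContractionSemigroup.HasGenerator.norm_sq_apply_le {u h : H} (hu : P.HasGenerator u h)
    {κ m : ℝ} (hκ : 0 < κ) (hm : 0 < m)
    (hN : ∀ s, κ * (‖P.toFun s u‖ ^ 2) ^ (1 + m) ≤ -inner ℝ (P.toFun s h) (P.toFun s u))
    {t : ℝ≥0} (ht : 0 < t) : ‖P.toFun t u‖ ^ 2 ≤ (2 * κ * m * t) ^ (-m⁻¹) := by
  have ht' : (0 : ℝ) < t := ht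
  rcases (norm_nonneg (P.toFun t u)).eq_or_lt with h0 | h0
  · rw [← h0, zero_pow two_ne_zero]
    positivity
  have hpos : ∀ s ∈ Icc (0 : ℝ) t, 0 < ‖P.toFun s.toNNReal u‖ ^ 2 := fun s hs =>
    pow_pos (h0.trans_le (P.norm_apply_antitone u (Real.toNNReal_le_iff_le_coe.2 hs.2))) 2
  -- With `y = ‖P_r u‖²`, the hypothesis reads `y' ≤ -2κ y^(1+m)`, so `y^(-m)` grows at rate at
  -- least `2κm`. The negative power is legitimate because `y > 0` up to time `t`.
  have hle := image_le_of_deriv_right_le_deriv_boundary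
    (f := fun r : ℝ => 2 * κ * m * r - (‖P.toFun r.toNNReal u‖ ^ 2) ^ (-m))
    (f' := fun s => 2 * κ * m * 1 -
      (2 * inner ℝ (P.toFun s.toNNReal u) (P.toFun s.toNNReal h)) * (-m)
        * (‖P.toFun s.toNNReal u‖ ^ 2) ^ (-m - 1))
    (B := fun _ => 0) (B' := fun _ => 0) (a := 0) (b := (t : ℝ))
    (by
      refine ContinuousOn.sub (by fun_prop) ?_
      exact ((P.continuous_real u).norm.pow 2).continuousOn.rpow_const
        fun s hs => Or.inl (hpos s hs).ne')
    (fun s hs => ((hasDerivWithinAt_id s _).const_mul _).sub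
      ((hu.hasDerivWithinAt_norm_sq hs.1).rpow_const (Or.inl (hpos s ⟨hs.1, hs.2.le⟩).ne')))
    (by
      simp only [mul_zero, zero_sub]
      exact neg_nonpos.2 (by positivity))
    continuousOn_const (fun s _ => hasDerivWithinAt_const _ _ _)
    (fun s hs => by
      have h1 := hN s.toNNReal
      rw [real_inner_comm] at h1
      have hp := hpos s ⟨hs.1, hs.2.le⟩
      have h2 := mul_le_mul_of_nonneg_right h1 (Real.rpow_pos_of_pos hp (-m - 1)).le
      rw [mul_assoc, ← Real.rpow_add hp, show 1 + m + (-m - 1) = 0 by ring, Real.rpow_zero] at h2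
      nlinarith) (right_mem_Icc.2 t.2)
  simp only [Real.toNNReal_coe] at hle
  have h1 : 2 * κ * m * t ≤ (‖P.toFun t u‖ ^ 2) ^ (-m) := by linarith
  have h2 := Real.rpow_le_rpow_of_nonpos (by positivity) h1
    (neg_nonpos.2 (inv_pos.2 hm).le : -m⁻¹ ≤ 0)
  rwa [← Real.rpow_mul (by positivity), neg_mul_neg, mul_inv_cancel₀ hm.ne', Real.rpow_one] at h2

/-- Nash's inequality for the generator implies ultracontractivity. -/
theorem ContractionSemigroup.norm_apply_le_of_nash (hd : Dense {u | ∃ h, P.HasGenerator u h})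
    {N : H → ℝ} (hNc : Continuous N) (hN0 : ∀ u, 0 ≤ N u) (hNs : ∀ (c : ℝ) u, N (c • u) = |c| * N u)
    (hNP : ∀ t u, N (P.toFun t u) ≤ N u) {κ m : ℝ} (hκ : 0 < κ) (hm : 0 < m)
    (hN : ∀ u h, P.HasGenerator u h → N u ≤ 1 → κ * (‖u‖ ^ 2) ^ (1 + m) ≤ -inner ℝ h u)
    {t : ℝ≥0} (ht : 0 < t) (u : H) :
    ‖P.toFun t u‖ ≤ √((2 * κ * m * t) ^ (-m⁻¹)) * N u := by
  have hcl : IsClosed {u | ‖P.toFun t u‖ ≤ √((2 * κ * m * t) ^ (-m⁻¹)) * N u} :=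
    isClosed_le (P.toFun t).continuous.norm (continuous_const.mul hNc)
  refine hcl.closure_subset_iff.2 (fun u hu => ?_) (hd u)
  obtain ⟨h, hu⟩ := hu
  -- `N u` may vanish, so `u` is divided by some `c > N u`, and `c` decreases to `N u` afterwards.
  have key : ∀ c, N u < c → ‖P.toFun t u‖ ≤ √((2 * κ * m * t) ^ (-m⁻¹)) * c := fun c hc => by
    have hc0 : 0 < c := (hN0 u).trans_lt hc
    have h1 : N (c⁻¹ • u) ≤ 1 := by
      rw [hNs, abs_of_pos (inv_pos.2 hc0), inv_mul_le_one₀ hc0]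
      exact hc.le
    have h2 := (hu.const_smul c⁻¹).norm_sq_apply_le hκ hm
      (fun s => hN _ _ ((hu.const_smul c⁻¹).apply s) ((hNP s _).trans h1)) ht
    have h3 := Real.abs_le_sqrt h2
    rw [abs_norm, map_smul, norm_smul, Real.norm_of_nonneg (inv_pos.2 hc0).le,
      inv_mul_le_iff₀ hc0, mul_comm] at h3
    exact h3
  refine ge_of_tendsto (f := fun c => √((2 * κ * m * t) ^ (-m⁻¹)) * c) (x := 𝓝[>] (N u)) ?_
    (eventually_nhdsWithin_of_forall key)
  exact ((continuous_const.mul continuous_id).tendsto _).mono_left nhdsWithin_le_nhds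

end Decay

/-! ### The heat semigroup of the Dirichlet Laplacian -/

section Heat

variable {d : ℕ} {Ω : Set (EuclideanSpace ℝ (Fin d))}

theorem dirichletResolvent_symm {b : ℝ} (hb : 0 < b) (u v : LTwo Ω) :
    inner ℝ (dirichletResolvent Ω b u) v = inner ℝ u (dirichletResolvent Ω b v) :=
  formResolvent_symm hZeroOne_norm_sq hb u v

theorem DirichletLaplacianRel.exists_energy {u h : LTwo Ω} (hu : DirichletLaplacianRel Ω u h) :
    ∃ v : HZeroOne Ω, hIncl Ω v = u ∧ ‖hGrad Ω v‖ ^ 2 = -inner ℝ h u := by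
  obtain ⟨v, hv, hw⟩ := dirichletLaplacianRel_iff.1 hu
  refine ⟨v, hv, ?_⟩
  rw [← real_inner_self_eq_norm_sq, hw v, hv]

variable [IsFiniteMeasure (volume.restrict Ω)]

theorem IsDirichletHeatSemigroup.dense {P : ContractionSemigroup (LTwo Ω)}
    (hP : IsDirichletHeatSemigroup Ω P) (hΩ : IsOpen Ω) : Dense {u | ∃ h, P.HasGenerator u h} :=
  (isResolventFamily_dirichletResolvent hΩ).dense.mono
    fun u hu => hu.elim fun h hu => ⟨h, (hP u h).2 hu⟩

theorem IsDirichletHeatSemigroup.unique {P Q : ContractionSemigroup (LTwo Ω)}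
    (hP : IsDirichletHeatSemigroup Ω P) (hQ : IsDirichletHeatSemigroup Ω Q) (hΩ : IsOpen Ω) :
    P = Q :=
  ContractionSemigroup.eq_of_hasGenerator_iff (fun u h => (hP u h).trans (hQ u h).symm)
    (hP.dense hΩ)

/-- The Yosida semigroups are exponentials of multiples of `J - 1` with `J` a symmetric
sub-Markovian resolvent; both properties persist under strong limits. -/
theorem exists_isDirichletHeatSemigroup (hΩ : IsOpen Ω) :
    ∃ P : ContractionSemigroup (LTwo Ω), IsDirichletHeatSemigroup Ω P ∧
      (∀ t, IsSubMarkovOp (P.toFun t)) ∧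
      ∀ t u v, inner ℝ (P.toFun t u) v = inner ℝ u (P.toFun t v) := by
  obtain ⟨P, hP, hlim⟩ := (isResolventFamily_dirichletResolvent hΩ).exists_semigroup
  have e : ∀ (t : ℝ≥0) (n : ℕ), (t : ℝ) • yosida (dirichletResolvent Ω) n
      = ((t : ℝ) * ((n : ℝ) + 1)) • (dirichletResolvent Ω ((n : ℝ) + 1) - 1) := fun t n => by
    rw [yosida, smul_smul]
  simp only [e] at hlim
  have hn : ∀ n : ℕ, (0 : ℝ) < (n : ℝ) + 1 := fun n => by positivity
  refine ⟨P, hP, fun t => IsSubMarkovOp.of_tendsto (fun n => ?_) (hlim t), fun t u v => ?_⟩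
  · exact (isSubMarkovOp_dirichletResolvent (hn n)).exp_smul_sub_one
      (mul_nonneg t.2 (hn n).le)
  · have h1 := (hlim t u).inner (𝕜 := ℝ) (tendsto_const_nhds (x := v))
    have h2 := (tendsto_const_nhds (x := u)).inner (𝕜 := ℝ) (hlim t v)
    refine tendsto_nhds_unique h1 (h2.congr fun n => ?_)
    exact (inner_exp_smul_sub_one (dirichletResolvent_symm (hn n)) _ u v).symm

end Heat

/-! ### Estimates for subordinate semigroups -/

/-- Integrating the decay `e^{-cs}` against `ν_t` gives its Laplace transform at `c`. -/
theorem norm_subordinateOp_apply_le_exp {H : Type*} [NormedAddCommGroup H] [NormedSpace ℝ H]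
    {P : ContractionSemigroup H} {ν : ConvolutionSemigroup} {f : ℝ → ℝ}
    (hν : ν.HasLaplaceExponent f) {c : ℝ} (hc : 0 < c) {u : H}
    (hP : ∀ t, ‖P.toFun t u‖ ≤ Real.exp (-(c * t)) * ‖u‖) (t : ℝ≥0) :
    ‖subordinateOp P ν t u‖ ≤ Real.exp (-(t * f c)) * ‖u‖ := by
  rw [subordinateOp_apply, ← hν t c hc, ← integral_mul_const]
  exact norm_integral_le_of_norm_le ((integrable_exp_neg_mul_coe _ hc.le).mul_const _)
    (Eventually.of_forall hP)

section LTwo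

variable {X : Type*} [MeasurableSpace X] {μ : Measure X}

/-- Replacing `e^{-ta}` by the larger `1/(1 + ta)` bounds the difference quotient below by `a/(1 +
ta) ‖u‖²`, whose limit is explicit. -/
theorem ContractionSemigroup.HasEnergy.le_of_norm_apply_le {P : ContractionSemigroup (Lp ℝ 2 μ)}
    {u : Lp ℝ 2 μ} {e a : ℝ} (he : P.HasEnergy u e) (ha : 0 ≤ a)
    (hP : ∀ t : ℝ≥0, ‖P.toFun t u‖ ≤ Real.exp (-(t * a)) * ‖u‖) : a * ‖u‖ ^ 2 ≤ e := by
  have hlim : Tendsto (fun t : ℝ≥0 => a * (1 + (t : ℝ) * a)⁻¹ * ‖u‖ ^ 2) (𝓝[>] 0)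
      (𝓝 (a * ‖u‖ ^ 2)) := by
    have hc : ContinuousAt (fun t : ℝ≥0 => a * (1 + (t : ℝ) * a)⁻¹ * ‖u‖ ^ 2) 0 := by
      refine ContinuousAt.mul (continuousAt_const.mul (ContinuousAt.inv₀ ?_ ?_)) continuousAt_const
      · fun_prop
      · simp
    have := hc.tendsto.mono_left (nhdsWithin_le_nhds (s := Ioi 0))
    simpa using this
  refine le_of_tendsto_of_tendsto hlim he ?_
  filter_upwards [self_mem_nhdsWithin] with t ht
  have ht' : (0 : ℝ) < t := ht
  have h0 : 0 < 1 + (t : ℝ) * a := by positivity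
  have h1 : Real.exp (-(t * a)) ≤ (1 + (t : ℝ) * a)⁻¹ := by
    rw [Real.exp_neg]
    refine inv_anti₀ h0 ?_
    rw [add_comm]
    exact Real.add_one_le_exp _
  have h2 : inner ℝ (P.toFun t u) u ≤ (1 + (t : ℝ) * a)⁻¹ * ‖u‖ ^ 2 := by
    refine (real_inner_le_norm _ _).trans ?_
    rw [pow_two, ← mul_assoc]
    exact mul_le_mul_of_nonneg_right
      ((hP t).trans (mul_le_mul_of_nonneg_right h1 (norm_nonneg u))) (norm_nonneg u)
  rw [inner_sub_left, real_inner_self_eq_norm_sq, le_inv_mul_iff₀ ht']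
  refine le_trans (le_of_eq ?_) (sub_le_sub_left h2 _)
  field_simp
  ring

variable [IsFiniteMeasure μ]

theorem normPQ_subordinateOp_lt_top {P : ContractionSemigroup (Lp ℝ 2 μ)}
    {ν : ConvolutionSemigroup} {t : ℝ≥0} {K γ : ℝ} (hK : 0 < K) (hγ : 0 < γ)
    (hP : ∀ s : ℝ≥0, 0 < s → ∀ u, ‖P.toFun s u‖ ≤ K * (s : ℝ) ^ (-γ) * lOne u)
    (hν : ∫⁻ s : ℝ≥0, (s : ℝ≥0∞) ^ (-γ) ∂(ν.measure t) < ⊤) :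
    normPQ 1 2 (subordinateOp P ν t) < ⊤ := by
  refine (iSup₂_le fun u hu => ?_).trans_lt (ENNReal.mul_lt_top (ENNReal.ofReal_lt_top (r := K)) hν)
  rw [← ofReal_lOne, ENNReal.ofReal_le_one] at hu
  rw [← Lp.enorm_def, subordinateOp_apply, ← lintegral_const_mul' _ _ ENNReal.ofReal_ne_top]
  refine (enorm_integral_le_lintegral_enorm _).trans (lintegral_mono fun s => ?_)
  -- At `s = 0` the hypothesis gives nothing, but there `0^(-γ) = ∞`.
  rcases eq_or_ne s 0 with rfl | hs
  · rw [ENNReal.coe_zero, ENNReal.zero_rpow_of_neg (neg_neg_of_pos hγ), ENNReal.mul_top]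
    · exact le_top
    · exact (ENNReal.ofReal_pos.2 hK).ne'
  · have hs' : 0 < s := pos_iff_ne_zero.2 hs
    rw [← ofReal_norm, ← ENNReal.ofReal_coe_nnreal, ENNReal.ofReal_rpow_of_pos (NNReal.coe_pos.2 hs'),
      ← ENNReal.ofReal_mul hK.le]
    refine ENNReal.ofReal_le_ofReal ((hP s hs' u).trans ?_)
    have h1 : 0 ≤ K * (s : ℝ) ^ (-γ) := by positivity
    exact mul_le_of_le_one_right h1 hu

theorem lOne_le (u : Lp ℝ 2 μ) : lOne u ≤ ‖constLTwo μ 1‖ * ‖u‖ := by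
  have := real_inner_le_norm (constLTwo μ 1) |u|
  rwa [norm_abs_eq_norm] at this

/-- Coercivity of the Dirichlet form implies its transience. -/
theorem ContractionSemigroup.isTransient_of_norm_apply_le {P : ContractionSemigroup (Lp ℝ 2 μ)}
    {a : ℝ} (ha : 0 < a)
    (hP : ∀ (t : ℝ≥0) u, ‖P.toFun t u‖ ≤ Real.exp (-(t * a)) * ‖u‖) : P.IsTransient := by
  -- The constant for `g` comes from `‖u‖₁ ≤ ‖1‖ ‖u‖₂`; the `+ 1` keeps the denominator positive.
  have hk : 0 < √a / (‖constLTwo μ 1‖ + 1) := div_pos (Real.sqrt_pos.2 ha) (by positivity)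
  refine ⟨fun _ => √a / (‖constLTwo μ 1‖ + 1), integrable_const _, ⟨_, Eventually.of_forall
    fun _ => le_rfl⟩, Eventually.of_forall fun _ => hk, fun u e he => ?_⟩
  have h1 := he.le_of_norm_apply_le ha.le fun t => hP t u
  have hi : Integrable (fun x => |u x| * (√a / (‖constLTwo μ 1‖ + 1))) μ :=
    (((Lp.memLp u).integrable (by norm_num)).abs).mul_const _
  rw [← ofReal_integral_eq_lintegral_ofReal hi
    (Eventually.of_forall fun x => mul_nonneg (abs_nonneg _) hk.le), integral_mul_const,
    ← lOne_eq_integral]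
  refine ENNReal.ofReal_le_ofReal (le_trans ?_ (Real.sqrt_le_sqrt h1))
  rw [Real.sqrt_mul ha.le, Real.sqrt_sq (norm_nonneg u), mul_div_left_comm]
  refine mul_le_mul_of_nonneg_left ?_ (Real.sqrt_nonneg a)
  rw [div_le_iff₀ (by positivity)]
  nlinarith [lOne_le u, norm_nonneg u]

end LTwo

/-! ### Estimates for the heat semigroup -/

section Heat

variable {d : ℕ} {Ω : Set (EuclideanSpace ℝ (Fin d))} [IsFiniteMeasure (volume.restrict Ω)]

theorem IsDirichletHeatSemigroup.exists_norm_apply_le_exp {P : ContractionSemigroup (LTwo Ω)}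
    (hP : IsDirichletHeatSemigroup Ω P) (hd : 3 ≤ d) (hΩ : IsOpen Ω)
    (hb : Bornology.IsBounded Ω) :
    ∃ c : ℝ, 0 < c ∧ ∀ (t : ℝ≥0) u, ‖P.toFun t u‖ ≤ Real.exp (-(c * t)) * ‖u‖ := by
  obtain ⟨C, hC, hp⟩ := exists_poincare hd hb
  refine ⟨(C ^ 2)⁻¹, by positivity, ContractionSemigroup.norm_apply_le_exp (hP.dense hΩ)
    fun u h hu => ?_⟩
  obtain ⟨v, rfl, hv⟩ := ((hP u h).1 hu).exists_energy
  rw [← hv, inv_mul_le_iff₀ (by positivity), ← mul_pow]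
  exact pow_le_pow_left₀ (norm_nonneg _) (hp v) 2

/-- The exponents satisfy `(2 - 4/(D+2)) (1 + 2/D) = 2`; this puts Nash's inequality on the `L¹`
unit ball into the form used for the semigroup, with `m = 2/D`. -/
theorem rpow_le_of_rpow_two_le {x y D : ℝ} (hy : 0 ≤ y) (hD : 0 < D)
    (h : x ^ (2 : ℝ) ≤ y ^ (2 - 4 / (D + 2))) : (x ^ 2) ^ (1 + 2 / D) ≤ y ^ 2 := by
  rw [Real.rpow_two] at h
  refine (Real.rpow_le_rpow (by positivity) h (by positivity)).trans_eq ?_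
  rw [← Real.rpow_mul hy, ← Real.rpow_natCast y 2]
  congr 1
  field_simp
  ring

/-- Nash's argument with `κ = C⁻²` and `m = 2/d`; the square root of `s^(-1/m)` gives `γ = d/4`. -/
theorem IsDirichletHeatSemigroup.exists_norm_apply_le_rpow {P : ContractionSemigroup (LTwo Ω)}
    (hP : IsDirichletHeatSemigroup Ω P) (hsub : ∀ t, IsSubMarkovOp (P.toFun t))
    (hsymm : ∀ t u v, inner ℝ (P.toFun t u) v = inner ℝ u (P.toFun t v)) (hd : 3 ≤ d)
    (hΩ : IsOpen Ω) (hb : Bornology.IsBounded Ω) :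
    ∃ K γ : ℝ, 0 < K ∧ 0 < γ ∧
      ∀ s : ℝ≥0, 0 < s → ∀ u, ‖P.toFun s u‖ ≤ K * (s : ℝ) ^ (-γ) * lOne u := by
  obtain ⟨C, hC, hp⟩ := exists_nash hd hb
  have hd' : (0 : ℝ) < d := by
    have : (3 : ℝ) ≤ d := by exact_mod_cast hd
    linarith
  have hs2 : 0 ≤ 2 - 4 / ((d : ℝ) + 2) := by
    rw [sub_nonneg, div_le_iff₀ (by positivity)]
    linarith
  have hκ : 0 < (C ^ 2)⁻¹ := by positivity
  have hm : 0 < 2 / (d : ℝ) := by positivity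
  refine ⟨√((2 * (C ^ 2)⁻¹ * (2 / (d : ℝ))) ^ (-(2 / (d : ℝ))⁻¹)), (2 / (d : ℝ))⁻¹ / 2,
    by positivity, by positivity, fun s hs u => ?_⟩
  refine (ContractionSemigroup.norm_apply_le_of_nash (hP.dense hΩ) continuous_lOne lOne_nonneg
    lOne_smul (fun t u => (hsub t).lOne_apply_le (hsymm t) u) hκ hm (fun u h hu hu1 => ?_)
    hs u).trans_eq ?_
  · obtain ⟨v, rfl, hv⟩ := ((hP u h).1 hu).exists_energy
    rw [← hv, inv_mul_le_iff₀ (by positivity), ← mul_pow]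
    refine rpow_le_of_rpow_two_le (by positivity) hd' ((hp v).trans ?_)
    exact mul_le_of_le_one_left (by positivity)
      (Real.rpow_le_one (lOne_nonneg _) hu1 (by positivity))
  · have hs' : (0 : ℝ) < s := hs
    rw [Real.mul_rpow (by positivity) hs'.le, Real.sqrt_mul (by positivity)]
    congr 2
    rw [Real.sqrt_eq_rpow, ← Real.rpow_mul hs'.le]
    congr 1
    ring

end Heat

end DirichletSubordination

open DirichletSubordination in
theorem mainTheorem5 (d : ℕ) (hd : 3 ≤ d) (Ω : Set (EuclideanSpace ℝ (Fin d)))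
    (hΩ : IsBoundedSmoothDomain Ω) (α : ℝ) (hα0 : 0 < α) (hα1 : α < 1) (f : ℝ → ℝ)
    (hf : f = (fun l => l ^ α) ∨ f = (fun l => (l + 1) ^ α - 1)) :
    IsBernsteinFunction f ∧ IsFiniteMeasure (volume.restrict Ω) ∧
    (∃! ν : ConvolutionSemigroup, ν.HasLaplaceExponent f) ∧
    (∃! P : ContractionSemigroup (LTwo Ω), IsDirichletHeatSemigroup Ω P) ∧
    ∀ (ν : ConvolutionSemigroup) (P : ContractionSemigroup (LTwo Ω)),
      ν.HasLaplaceExponent f → IsDirichletHeatSemigroup Ω P →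
        (∀ t : ℝ≥0, 0 < t → normPQ 1 2 ((P.subordinate ν).toFun t) < ⊤) ∧
        (P.subordinate ν).IsSymmetric ∧ (P.subordinate ν).IsSubMarkovian ∧
        (P.subordinate ν).IsTransient := by
  obtain ⟨ho, -, hb, -⟩ := hΩ
  have hfin : IsFiniteMeasure (volume.restrict Ω) :=
    ⟨by rw [Measure.restrict_apply_univ]; exact hb.measure_lt_top⟩
  obtain ⟨c, hc0, hc1, rfl⟩ : ∃ c : ℝ, 0 ≤ c ∧ c ≤ 1 ∧ f = fun l => (l + c) ^ α - c ^ α := by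
    rcases hf with rfl | rfl
    · exact ⟨0, le_rfl, zero_le_one, by simp [Real.zero_rpow hα0.ne']⟩
    · exact ⟨1, zero_le_one, le_rfl, by simp⟩
  obtain ⟨ν₀, hν₀⟩ := exists_tilted_stable hα0 hα1 hc0
  obtain ⟨P₀, hP₀, hsub, hsymm⟩ := exists_isDirichletHeatSemigroup ho
  refine ⟨isBernsteinFunction_rpow_add hc0 hα0 hα1 _ le_rfl, hfin,
    ⟨ν₀, hν₀, fun ν hν => hν.unique hν₀⟩, ⟨P₀, hP₀, fun P hP => hP.unique hP₀ ho⟩,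
    fun ν P hν hP => ?_⟩
  -- Uniqueness transfers symmetry and the sub-Markov property of the constructed semigroup to the
  -- given one.
  obtain rfl : P = P₀ := hP.unique hP₀ ho
  refine ⟨fun t ht => ?_, fun t => inner_subordinateOp hsymm ν t,
    ContractionSemigroup.isSubMarkovian_iff.2 fun t => IsSubMarkovOp.subordinateOp hsub ν t, ?_⟩
  · obtain ⟨K, γ, hK, hγ, hPK⟩ := hP.exists_norm_apply_le_rpow hsub hsymm hd ho hb
    refine normPQ_subordinateOp_lt_top hK hγ hPK
      (lintegral_rpow_neg_lt_top (t := t) ht hα0 hγ fun l hl => (hν t l hl).trans_le ?_)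
    -- With `c ≤ 1`, both cases satisfy `f(l) ≥ l^α - 1`, the bound required for negative moments.
    have h1 : c ^ α ≤ 1 := Real.rpow_le_one hc0 hc1 hα0.le
    have h2 : l ^ α ≤ (l + c) ^ α := Real.rpow_le_rpow hl.le (by linarith) hα0.le
    exact Real.exp_le_exp.2 (neg_le_neg (mul_le_mul_of_nonneg_left (by linarith) t.2))
  · obtain ⟨b, hb0, hdec⟩ := hP.exists_norm_apply_le_exp hd ho hb
    have hpos : 0 < (b + c) ^ α - c ^ α :=
      sub_pos.2 (Real.rpow_lt_rpow hc0 (by linarith) hα0)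
    exact ContractionSemigroup.isTransient_of_norm_apply_le hpos fun t u =>
      norm_subordinateOp_apply_le_exp hν hb0 (fun s => hdec s u) t
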